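/- **Setting.** Let $m,\tau\ge 1$ be integers, $n=m^2\tau^2$, and arrange $n$ qubits on an $m\tau\times m\tau$ grid, with rows and columns numbered $0,\dots,m\tau-1$. A *random coarse-grained Clifford circuit* is $D=W\,V$, where $V=V_{(m-1)^2}\otimes\cdots\otimes V_1$ is applied first and $W=W_{m^2}\otimes\cdots\otimes W_1$ second. The gates $W_i$ act on the $m^2$ squares of $\tau\times\tau$ qubits that tile the grid, i.e. those with top-left corner $(a\tau,b\tau)$, $0\le a,b\le m-1$. The gates $V_i$ act on the $(m-1)^2$ squares of $\tau\times\tau$ qubits shifted by half a square, i.e. those with top-left corner $(a\tau+\lfloor\tau/2\rfloor,\,b\tau+\lfloor\tau/2\rfloor)$, $0\le a,b\le m-2$. All gates are independent and uniformly random $\tau^2$-qubit Clifford unitaries (elements, up to global phase, of the normalizer of the Pauli group in the unitary group). A three-qubit state $|\Phi\rangle$ is *GHZ-type entangled* if $(C_1\otimes C_2\otimes C_3)|\Phi\rangle=\frac1{\sqrt2}(|000\rangle+|111\rangle)$ for some single-qubit Clifford unitaries $C_1,C_2,C_3$. Three qubits $\{h,i,j\}$ of an $n$-qubit stabilizer state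 $|\psi\rangle$ *exhibit GHZ-type MIE* (measurement-induced entanglement) if, after all the other $n-3$ qubits are measured in the computational basis, the normalized postmeasurement state of $h,i,j$ is GHZ-type entangled, for every outcome of nonzero probability. An $n$-qubit *circuit template* is a finite sequence of subsets of the qubits; its random Clifford circuit is the product of independent uniformly random Clifford gates on these subsets, applied in order. A *circuit architecture* assigns to each $n$ in a set $\Gamma\subseteq\mathbb N$ an $n$-qubit template. It has the *long-range tripartite MIE property* if there is a constant $c>0$ such that for every $n\in\Gamma$, with probability at least $c$ over the random Clifford circuit $U$ of the $n$-qubit template and an independent uniformly random triple $\{h,i,j\}$ of distinct qubits, the qubits $h,i,j$ exhibit GHZ-type MIE in $U|0^n\rangle$. **Theorem.** Let $n=m^2\tau^2\ge 3$ and $\tau\ge\sqrt{1000\log_2 m}$. Let $D$ be an $n$-qubit random coarse-grained Clifford circuit and let $\{h,i,j\}$ be an independent, uniformly random triple of distinct qubits. Then, with probability at least $0.005$ over $D$ and $\{h,i,j\}$, the qubits $h,i,j$ exhibit GHZ-type MIE in the state $D|0^n\rangle$. Consequently, every architecture whose templates are coarse-grained templates with parameters satisfying $n=m^2\tau^2\ge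 3$ and $\tau\ge\sqrt{1000\log_2 m}$ has the long-range tripartite MIE property. -/

import Mathlib

open scoped Matrix

noncomputable section

/-! Qubits are labelled by a finite type `Q`; the computational basis of the Hilbert space is
labelled by the bit strings `Q → Bool`, state vectors are functions `(Q → Bool) → ℂ`, and
operators are matrices indexed by bit strings. -/

/-- Operators on the qubits `Q`. -/
abbrev QOp (Q : Type) : Type := Matrix (Q → Bool) (Q → Bool) ℂ

/-- State vectors on the qubits `Q`. -/
abbrev QVec (Q : Type) : Type := (Q → Bool) → ℂ

/-- The unitary group on the qubits `Q`. -/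
abbrev QUnitary (Q : Type) [Fintype Q] [DecidableEq Q] : Type :=
  Matrix.unitaryGroup (Q → Bool) ℂ

/-- The tensor product of one-qubit operators, one for each qubit. -/
def tensorOp {Q : Type} [Fintype Q] (A : Q → Matrix Bool Bool ℂ) : QOp Q :=
  .of fun x y => ∏ q, A q (x q) (y q)

/-! ### Pauli operators and the Clifford group -/

/-- Labels of the one-qubit Pauli matrices. -/
inductive PauliLabel : Type
  | I | X | Y | Z

/-- The one-qubit Pauli matrices; `false` is the basis label 0 and `true` the label 1. -/
def PauliLabel.toMatrix : PauliLabel → Matrix Bool Bool ℂ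
  | .I => .of fun a b => if a = b then 1 else 0
  | .X => .of fun a b => if a = b then 0 else 1
  | .Y => .of fun a b => if a = b then 0 else if a then Complex.I else -Complex.I
  | .Z => .of fun a b => if a = b then (if a then -1 else 1) else 0

/-- The Pauli group on the qubits `Q`, as a set of unitaries: tensor products of one-qubit Pauli
matrices, times one of the phases `1, i, -1, -i`. -/
def pauliSet (Q : Type) [Fintype Q] [DecidableEq Q] : Set (QUnitary Q) :=
  {U | ∃ (k : Fin 4) (P : Q → PauliLabel),
    (U : QOp Q) = Complex.I ^ (k : ℕ) • tensorOp (fun q => (P q).toMatrix)}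

/-- The Clifford group on the qubits `Q`: the normalizer of the Pauli group in the unitary
group. -/
def cliffordGroup (Q : Type) [Fintype Q] [DecidableEq Q] : Subgroup (QUnitary Q) :=
  Subgroup.normalizer (pauliSet Q)

/-- The global phases: unitaries that are scalar multiples of the identity. -/
def globalPhases (Q : Type) [Fintype Q] [DecidableEq Q] : Subgroup (QUnitary Q) where
  carrier := {U | ∃ z : ℂ, (U : QOp Q) = z • (1 : QOp Q)}
  one_mem' := ⟨1, by simp⟩
  mul_mem' := by
    rintro U V ⟨z, hz⟩ ⟨w, hw⟩
    exact ⟨z * w, by simp [hz, hw, smul_smul, mul_comm]⟩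
  inv_mem' := by
    rintro U ⟨z, hz⟩
    exact ⟨star z, by
      rw [show ((U⁻¹ : QUnitary Q) : QOp Q) = star (U : QOp Q) from rfl, hz]
      simp⟩

/-- Clifford gates on the qubits `Q`, up to global phase. -/
abbrev CliffordGate (Q : Type) [Fintype Q] [DecidableEq Q] : Type :=
  cliffordGroup Q ⧸ (globalPhases Q).subgroupOf (cliffordGroup Q)

instance : Finite PauliLabel :=
  Finite.of_injective (β := Fin 4)
    (fun P => match P with | .I => 0 | .X => 1 | .Y => 2 | .Z => 3)
    (by intro a b; cases a <;> cases b <;> simp)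

/-! There are finitely many Clifford gates up to global phase, so that they can be drawn
uniformly at random. -/

theorem tensorOp_mul {Q : Type} [Fintype Q] [DecidableEq Q] (A B : Q → Matrix Bool Bool ℂ) :
    tensorOp A * tensorOp B = tensorOp (fun q => A q * B q) := by
  ext x y
  simp only [tensorOp, Matrix.of_apply, Matrix.mul_apply, Finset.prod_univ_sum,
    ← Finset.prod_mul_distrib, Fintype.piFinset_univ]

theorem tensorOp_star {Q : Type} [Fintype Q] (A : Q → Matrix Bool Bool ℂ) :
    star (tensorOp A) = tensorOp (fun q => star (A q)) := by
  ext x y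
  simp [tensorOp, Matrix.star_apply]

theorem tensorOp_one {Q : Type} [Fintype Q] [DecidableEq Q] :
    tensorOp (fun _ : Q => (1 : Matrix Bool Bool ℂ)) = 1 := by
  ext x y
  simp only [tensorOp, Matrix.of_apply, Matrix.one_apply, Finset.prod_ite_zero, Finset.prod_const_one]
  simp [funext_iff]

theorem PauliLabel.star_mul_self (P : PauliLabel) : star P.toMatrix * P.toMatrix = 1 := by
  ext a b
  cases P <;> cases a <;> cases b <;> simp [Matrix.mul_apply, PauliLabel.toMatrix]

/-- A tensor product of Pauli matrices, as a unitary. -/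
def pauliUnitary {Q : Type} [Fintype Q] [DecidableEq Q] (P : Q → PauliLabel) : QUnitary Q :=
  ⟨tensorOp (fun q => (P q).toMatrix), by
    rw [Matrix.mem_unitaryGroup_iff', tensorOp_star, tensorOp_mul]
    simp only [PauliLabel.star_mul_self]
    exact tensorOp_one⟩

theorem pauliUnitary_mem {Q : Type} [Fintype Q] [DecidableEq Q] (P : Q → PauliLabel) :
    pauliUnitary P ∈ pauliSet Q := ⟨0, P, by simp [pauliUnitary]⟩

theorem pauliSet_finite (Q : Type) [Fintype Q] [DecidableEq Q] : (pauliSet Q).Finite := by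
  refine Set.Finite.of_finite_image (f := fun U : QUnitary Q => (U : QOp Q)) ?_
    (Subtype.val_injective.injOn)
  refine (Set.finite_range (fun p : Fin 4 × (Q → PauliLabel) =>
    Complex.I ^ (p.1 : ℕ) • tensorOp (fun q => (p.2 q).toMatrix))).subset ?_
  rintro _ ⟨U, ⟨k, P, h⟩, rfl⟩
  exact ⟨(k, P), h.symm⟩

/-- A unitary that commutes with all Pauli operators is a global phase. -/
theorem mem_globalPhases_of_commute {Q : Type} [Fintype Q] [DecidableEq Q] (U : QUnitary Q)
    (h : ∀ P : Q → PauliLabel, pauliUnitary P * U = U * pauliUnitary P) :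
    U ∈ globalPhases Q := by
  have h' : ∀ P : Q → PauliLabel, tensorOp (fun q => (P q).toMatrix) * (U : QOp Q) =
      (U : QOp Q) * tensorOp (fun q => (P q).toMatrix) := fun P =>
    congrArg (fun V : QUnitary Q => (V : QOp Q)) (h P)
  have hoff : ∀ x y : Q → Bool, x ≠ y → (U : QOp Q) x y = 0 := by
    intro x y hxy
    obtain ⟨q, hq⟩ := Function.ne_iff.1 hxy
    have hd : tensorOp (fun r => (if r = q then PauliLabel.Z else .I).toMatrix) =
        Matrix.diagonal (fun x : Q → Bool => if x q then (-1 : ℂ) else 1) := by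
      ext a b
      by_cases hab : a = b
      · subst hab
        simp only [tensorOp, Matrix.of_apply, Matrix.diagonal_apply_eq]
        rw [Finset.prod_eq_single q]
        · simp [PauliLabel.toMatrix]
        · intro r _ hr
          simp [PauliLabel.toMatrix, hr]
        · simp
      · rw [Matrix.diagonal_apply_ne _ hab]
        obtain ⟨r, hr⟩ := Function.ne_iff.1 hab
        refine Finset.prod_eq_zero (Finset.mem_univ r) ?_
        beta_reduce
        by_cases hrq : r = q
        · rw [if_pos hrq]
          simp [PauliLabel.toMatrix, hr]
        · rw [if_neg hrq]
          simp [PauliLabel.toMatrix, hr]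
    have := congrFun (congrFun (h' (fun r => if r = q then .Z else .I)) x) y
    rw [hd, Matrix.diagonal_mul, Matrix.mul_diagonal] at this
    generalize (U : QOp Q) x y = u at this ⊢
    cases hx : x q <;> cases hy : y q <;> rw [hx, hy] at this hq <;> norm_num at this hq
    · linear_combination this / 2
    · linear_combination -this / 2
  have hdiag : ∀ x : Q → Bool, (U : QOp Q) x x = (U : QOp Q) (fun _ => false) (fun _ => false) := by
    intro x
    have ht : ∀ a b : Q → Bool,
        tensorOp (fun r => (if x r then PauliLabel.X else .I).toMatrix) a b =
          if ∀ r, (x r = xor (a r) (b r)) then 1 else 0 := by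
      intro a b
      simp only [tensorOp, Matrix.of_apply]
      rw [Finset.prod_congr rfl (g := fun r => if x r = xor (a r) (b r) then (1 : ℂ) else 0)
        (s₁ := Finset.univ), Finset.prod_ite_zero]
      · simp
      · intro r _
        cases x r <;> cases a r <;> cases b r <;> simp [PauliLabel.toMatrix]
    have := congrFun (congrFun (h' (fun r => if x r then .X else .I)) x) (fun _ => false)
    rw [Matrix.mul_apply, Matrix.mul_apply, Finset.sum_eq_single (fun _ => false),
      Finset.sum_eq_single x] at this
    · simpa [ht] using this.symm
    · intro b _ hb
      rw [hoff _ _ hb.symm, zero_mul]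
    · simp
    · intro b _ hb
      rw [hoff _ _ hb, mul_zero]
    · simp
  refine ⟨(U : QOp Q) (fun _ => false) (fun _ => false), ?_⟩
  ext x y
  by_cases hxy : x = y
  · subst hxy
    simp [hdiag x]
  · simp [hoff x y hxy, hxy]

instance (Q : Type) [Fintype Q] [DecidableEq Q] : Finite (CliffordGate Q) := by
  have hfin : Finite (pauliSet Q) := (pauliSet_finite Q).to_subtype
  let f : CliffordGate Q → (Q → PauliLabel) → pauliSet Q := fun g P =>
    ⟨(g.out : QUnitary Q) * pauliUnitary P * (g.out : QUnitary Q)⁻¹,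
      (g.out.2 _).1 (pauliUnitary_mem P)⟩
  refine Finite.of_injective f ?_
  intro g k hgk
  rw [← QuotientGroup.out_eq' g, ← QuotientGroup.out_eq' k, QuotientGroup.eq,
    Subgroup.mem_subgroupOf]
  refine mem_globalPhases_of_commute _ fun P => ?_
  have hP : (g.out : QUnitary Q) * pauliUnitary P * (g.out : QUnitary Q)⁻¹ =
      (k.out : QUnitary Q) * pauliUnitary P * (k.out : QUnitary Q)⁻¹ :=
    congrArg Subtype.val (congrFun hgk P)
  rw [mul_inv_eq_iff_eq_mul] at hP
  simp only [Subgroup.coe_mul, Subgroup.coe_inv]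
  rw [eq_comm, mul_assoc, inv_mul_eq_iff_eq_mul, ← mul_assoc, ← mul_assoc, hP]
  group

/-! ### Circuit templates and random Clifford circuits -/

/-- An `n`-qubit circuit template: the list of the supports `m₁, …, m_R` of the gates, in the
order in which the gates are applied. -/
abbrev CircuitTemplate (n : ℕ) : Type := List (Finset (Fin n))

/-- The operator on the qubits `Q` that acts as `U` on the qubits in `S` and as the identity on
the other qubits. -/
def embedGate {Q : Type} [Fintype Q] [DecidableEq Q] (S : Finset Q) (U : QOp S) : QOp Q :=
  .of fun x y => if ∀ q, q ∉ S → x q = y q then U (fun s => x s) (fun s => y s) else 0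

/-- A choice of a Clifford gate (up to global phase) for each gate position of a template. -/
abbrev CliffordCircuit {n : ℕ} (𝒯 : CircuitTemplate n) : Type :=
  ∀ i : Fin 𝒯.length, CliffordGate (𝒯.get i)

/-- The operator `U_R ⋯ U₂ U₁` of a Clifford circuit (representatives of the gates are chosen, so
that it is defined up to an irrelevant global phase). -/
def CliffordCircuit.toOp {n : ℕ} {𝒯 : CircuitTemplate n} (D : CliffordCircuit 𝒯) : QOp (Fin n) :=
  (List.ofFn fun i => embedGate (𝒯.get i) ((D i).out : QUnitary (𝒯.get i))).reverse.prod

/-- The output state of a Clifford circuit applied to the all-zeros basis state. -/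
def CliffordCircuit.outputState {n : ℕ} {𝒯 : CircuitTemplate n} (D : CliffordCircuit 𝒯) :
    QVec (Fin n) :=
  D.toOp *ᵥ Pi.single (fun _ => false) 1

/-! ### GHZ-type measurement-induced entanglement -/

/-- The GHZ state `(|0⋯0⟩ + |1⋯1⟩)/√2`. -/
def ghzState (Q : Type) [Fintype Q] : QVec Q :=
  fun x => if (∀ q, x q = false) ∨ (∀ q, x q = true) then ((1 / √2 : ℝ) : ℂ) else 0

/-- A one-qubit Clifford unitary as a `2 × 2` matrix. -/
def cliffordMatrix (C : cliffordGroup Unit) : Matrix Bool Bool ℂ :=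
  .of fun a b => ((C : QUnitary Unit) : QOp Unit) (fun _ => a) (fun _ => b)

/-- GHZ-type entanglement: some tensor product of one-qubit Clifford unitaries maps the state to
the GHZ state. -/
def IsGHZType {Q : Type} [Fintype Q] [DecidableEq Q] (Φ : QVec Q) : Prop :=
  ∃ C : Q → cliffordGroup Unit, tensorOp (fun q => cliffordMatrix (C q)) *ᵥ Φ = ghzState Q

/-- The unnormalized state `⟨x|ψ⟩` of the qubits in `T` after all qubits outside `T` have been
measured in the computational basis with outcome `x`. -/
def projectedState {Q : Type} [DecidableEq Q] (ψ : QVec Q) (T : Finset Q)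
    (x : {q // q ∉ T} → Bool) : QVec T :=
  fun y => ψ (fun q => if h : q ∈ T then y ⟨q, h⟩ else x ⟨q, h⟩)

/-- The probability of the measurement outcome `x` on the qubits outside `T`. -/
def outcomeProb {Q : Type} [DecidableEq Q] (ψ : QVec Q) (T : Finset Q)
    (x : {q // q ∉ T} → Bool) : ℝ :=
  ∑ y, ‖projectedState ψ T x y‖ ^ 2

/-- The (normalized) postmeasurement state of the qubits in `T`, given the outcome `x`. -/
def postMeasurementState {Q : Type} [DecidableEq Q] (ψ : QVec Q) (T : Finset Q)
    (x : {q // q ∉ T} → Bool) : QVec T :=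
  ((1 / √(outcomeProb ψ T x) : ℝ) : ℂ) • projectedState ψ T x

/-- The qubits in `T` share GHZ-type entanglement after all other qubits of `ψ` have been measured
in the computational basis, whatever the outcome is. -/
def HasGHZTypeMIE {Q : Type} [DecidableEq Q] (ψ : QVec Q) (T : Finset Q) : Prop :=
  ∀ x : {q // q ∉ T} → Bool, outcomeProb ψ T x ≠ 0 → IsGHZType (postMeasurementState ψ T x)

/-- The probability that a uniformly random triple of qubits exhibits GHZ-type
measurement-induced entanglement in the output state of a random Clifford circuit
with template `𝒯`, whose gates are independent and uniformly random: the fraction of the pairs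
(circuit, triple) with that property. -/
def ghzTypeMIEProb {n : ℕ} (𝒯 : CircuitTemplate n) : ℝ :=
  (Nat.card {p : CliffordCircuit 𝒯 × {T : Finset (Fin n) // T.card = 3} //
      HasGHZTypeMIE p.1.outputState p.2.1} : ℝ) /
    (Nat.card (CliffordCircuit 𝒯 × {T : Finset (Fin n) // T.card = 3}) : ℝ)

/-- A circuit architecture: a set of numbers of qubits, and a circuit template for each of
them. -/
structure CircuitArchitecture where
  sizes : Set ℕ
  template : ∀ n ∈ sizes, CircuitTemplate n

/-- The long-range tripartite MIE property of an architecture. -/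
def CircuitArchitecture.LongRangeTripartiteMIE (𝒜 : CircuitArchitecture) : Prop :=
  ∃ c : ℝ, 0 < c ∧ ∀ (n : ℕ) (hn : n ∈ 𝒜.sizes), c ≤ ghzTypeMIEProb (𝒜.template n hn)

/-! ### The coarse-grained architecture -/

/-- With `n = L * L` qubits in an `L × L` grid, qubit `q` sits in row `q / L` and column `q % L`.
This is the set of the qubits in the `τ × τ` square whose first row is `r` and whose first column
is `c`. -/
def gridSquare (n L τ r c : ℕ) : Finset (Fin n) :=
  {q | (r ≤ (q : ℕ) / L ∧ (q : ℕ) / L < r + τ) ∧ (c ≤ (q : ℕ) % L ∧ (q : ℕ) % L < c + τ)}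

/-- The coarse-grained template on an `mτ × mτ` grid. The first layer consists of `(m - 1)²` gates
on the `τ × τ` squares that are shifted by half a square in both directions, the second layer of
`m²` gates on the `τ × τ` squares that tile the grid. -/
def coarseGrainedTemplate (n m τ : ℕ) : CircuitTemplate n :=
  (List.range (m - 1) ×ˢ List.range (m - 1)).map
      (fun p => gridSquare n (m * τ) τ (p.1 * τ + τ / 2) (p.2 * τ + τ / 2)) ++
    (List.range m ×ˢ List.range m).map
      (fun p => gridSquare n (m * τ) τ (p.1 * τ) (p.2 * τ))

end

/-! Up to phases, the stabilizer group of the output state is a Lagrangian subspace of the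
symplectic space F₂^(2n) of Pauli operators. After all qubits but three are measured, the state of
the triple is, for every possible outcome and up to signs, stabilized by the restrictions to the
triple of those stabilizers that are of Z-type off the triple. These restrictions form a Lagrangian
subspace again (`measured`, `IsLagrangian.measured`), so the question becomes linear algebra over F₂
and does not depend on the outcome.

For m ≥ 2, at least half of the triples can be labelled h, i, j such that the second-layer tile of j
contains neither h nor i. Call a circuit good if (a) no element of the measured group acts on j
alone, and (b) for all Pauli values x and y there is a stabilizer with value x at h and y at i that
is of Z-type on all other qubits outside the tile of j. By (a), one of the 16 transvections of the
pair h, i turns the measured group into a GHZ group (`IsLagrangian.exists_transv_ghz_generators`).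
By (b), that transvection is realised by multiplying the gate on the tile of j by a transvection
(`IsTwoLayer.transv_mem_measured_twist`), and this operation is injective on circuits
(`IsTwoLayer.twist_injective`). Hence the circuits with GHZ-type entanglement number at least 1/16
of the good ones (`card_le_card_hasGHZTypeMIE`).

A failure of (a) or (b) produces a nontrivial stabilizer with restricted values, and a first-moment
bound controls its probability (`IsTwoLayer.card_hasStab_le`). A random Clifford gate maps a nonzero
Pauli operator to a uniformly random nonzero one, so the sum over the Pauli operators between the
two layers becomes a sum over sets σ of gates, with a factor 1/2 for every qubit where a gate in σ
overlaps a gate outside σ. The full set gives the main terms: 1/2 for (a) and 2⋅4⋅2^(-s) for (b),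
where s is the size of the tile. All other σ have domain walls. A spanning tree of the gates in
which neighbours share at least e = ⌊τ/2⌋² qubits (`exists_isOverlapTree`) bounds the sum over all σ
by 2(1 + 2^(-e))^(N-1) for N gates (`sum_prod_wallWeight_le`). The assumption on τ makes the excess
of this over 2 at most 2/511.

Altogether at least 2/5 of the circuits are good for a separated triple, and the probability is at
least 1/2 ⋅ 1/16 ⋅ 2/5 = 1/80. For m = 1 the single gate acts on all qubits, (b) is not needed, and
the transvections are multiplied into that gate directly. -/

/-- Phase-free one-qubit Pauli operators: `(1, 0)` is `X`, `(0, 1)` is `Z`, `(1, 1)` is `Y`. -/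
abbrev PBit : Type := ZMod 2 × ZMod 2

/-- Phase-free Pauli operators on the qubits `Q`. -/
abbrev PVec (Q : Type) : Type := Q → PBit

def PBit.toLabel (v : PBit) : PauliLabel :=
  if v = (0, 0) then .I else if v = (1, 0) then .X else if v = (0, 1) then .Z else .Y

def PBit.mat (v : PBit) : Matrix Bool Bool ℂ := v.toLabel.toMatrix

def sympAt (v w : PBit) : ZMod 2 := v.1 * w.2 + v.2 * w.1

theorem PBit.cases (v : PBit) : v = (0, 0) ∨ v = (1, 0) ∨ v = (0, 1) ∨ v = (1, 1) := by
  revert v; decide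

theorem zmod2_cases (a : ZMod 2) : a = 0 ∨ a = 1 := by
  revert a; decide

theorem PBit.toLabel_surjective : Function.Surjective PBit.toLabel := by
  intro P
  cases P
  · exact ⟨(0, 0), by simp [PBit.toLabel]⟩
  · exact ⟨(1, 0), by simp [PBit.toLabel]⟩
  · exact ⟨(1, 1), by simp [PBit.toLabel]⟩
  · exact ⟨(0, 1), by simp [PBit.toLabel]⟩

theorem PBit.mat_I : PBit.mat (0, 0) = .of fun a b => if a = b then 1 else 0 := rfl

theorem PBit.mat_X : PBit.mat (1, 0) = .of fun a b => if a = b then 0 else 1 := by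
  simp [PBit.mat, PBit.toLabel, PauliLabel.toMatrix]

theorem PBit.mat_Z :
    PBit.mat (0, 1) = .of fun a b => if a = b then (if a then -1 else 1) else 0 := by
  simp [PBit.mat, PBit.toLabel, PauliLabel.toMatrix]

theorem PBit.mat_Y : PBit.mat (1, 1) =
    .of fun a b => if a = b then 0 else if a then Complex.I else -Complex.I := by
  simp [PBit.mat, PBit.toLabel, PauliLabel.toMatrix]

theorem PBit.mat_mul_self (v : PBit) : v.mat * v.mat = 1 := by
  rcases v.cases with rfl | rfl | rfl | rfl <;> ext a b <;> cases a <;> cases b <;>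
    simp [mat_I, mat_X, mat_Z, mat_Y, Matrix.mul_apply]

theorem PBit.star_mat (v : PBit) : star v.mat = v.mat := by
  rcases v.cases with rfl | rfl | rfl | rfl <;> ext a b <;> cases a <;> cases b <;>
    simp [mat_I, mat_X, mat_Z, mat_Y, Matrix.star_apply]

theorem PBit.mat_mul (v w : PBit) : ∃ k : ℕ, v.mat * w.mat = Complex.I ^ k • (v + w).mat := by
  have key : ∀ (A B C : Matrix Bool Bool ℂ), (A * B = C ∨ A * B = Complex.I • C ∨
      A * B = (-Complex.I) • C) → ∃ k : ℕ, A * B = Complex.I ^ k • C := by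
    rintro A B C (h | h | h)
    · exact ⟨0, by simp [h]⟩
    · exact ⟨1, by simp [h]⟩
    · exact ⟨3, by rw [h, Complex.I_pow_three]⟩
  refine key _ _ _ ?_
  have h11 : (1 : ZMod 2) + 1 = 0 := by decide
  rcases v.cases with rfl | rfl | rfl | rfl <;> rcases w.cases with rfl | rfl | rfl | rfl <;>
    simp only [Prod.mk_add_mk, add_zero, zero_add, h11, mat_I, mat_X, mat_Z, mat_Y,
      ← Matrix.ext_iff, Bool.forall_bool, Matrix.mul_apply, Fintype.sum_bool, Matrix.of_apply,
      Matrix.smul_apply] <;> simp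

def signOf (a : ZMod 2) : ℂ := if a = 0 then 1 else -1

theorem signOf_add (a b : ZMod 2) : signOf (a + b) = signOf a * signOf b := by
  have h11 : (1 : ZMod 2) + 1 = 0 := by decide
  rcases zmod2_cases a with rfl | rfl <;> rcases zmod2_cases b with rfl | rfl <;>
    simp [signOf, h11]

theorem signOf_injective : Function.Injective signOf := by
  intro a b
  rcases zmod2_cases a with rfl | rfl <;> rcases zmod2_cases b with rfl | rfl <;>
    norm_num [signOf, neg_eq_iff_add_eq_zero, eq_neg_iff_add_eq_zero]

theorem signOf_sum {ι : Type} (s : Finset ι) (f : ι → ZMod 2) :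
    signOf (∑ i ∈ s, f i) = ∏ i ∈ s, signOf (f i) := by
  classical
  induction s using Finset.induction_on with
  | empty => simp [signOf]
  | insert a s ha ih => rw [Finset.sum_insert ha, Finset.prod_insert ha, signOf_add, ih]

theorem PBit.mat_comm (v w : PBit) : v.mat * w.mat = signOf (sympAt v w) • (w.mat * v.mat) := by
  have h11 : (1 : ZMod 2) + 1 = 0 := by decide
  rcases v.cases with rfl | rfl | rfl | rfl <;> rcases w.cases with rfl | rfl | rfl | rfl <;>
    simp only [sympAt, mul_zero, mul_one, add_zero, zero_add, h11, mat_I, mat_X, mat_Z, mat_Y,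
      ← Matrix.ext_iff, Bool.forall_bool, Matrix.mul_apply, Fintype.sum_bool, Matrix.of_apply,
      Matrix.smul_apply, signOf] <;> simp

/-! ### Pauli operators as vectors over F₂ with the commutation form -/

section Pauli

variable {Q : Type} [Fintype Q]

/-- The commutation form of Pauli operators. -/
def symp : LinearMap.BilinForm (ZMod 2) (PVec Q) :=
  LinearMap.mk₂ (ZMod 2) (fun g h => ∑ q, sympAt (g q) (h q))
    (by intro a b c; simp only [sympAt, ← Finset.sum_add_distrib]; congr; ext; simp; ring)
    (by intro a b c; simp only [sympAt, Finset.smul_sum]; congr; ext; simp; ring)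
    (by intro a b c; simp only [sympAt, ← Finset.sum_add_distrib]; congr; ext; simp; ring)
    (by intro a b c; simp only [sympAt, Finset.smul_sum]; congr; ext; simp; ring)

theorem symp_apply (g h : PVec Q) : symp g h = ∑ q, sympAt (g q) (h q) := rfl

theorem sympAt_comm (v w : PBit) : sympAt v w = sympAt w v := by
  simp only [sympAt]; ring

theorem sympAt_self (v : PBit) : sympAt v v = 0 := by
  revert v; decide

theorem symp_comm (g h : PVec Q) : symp g h = symp h g := by
  simp only [symp_apply, sympAt_comm]

theorem symp_self (g : PVec Q) : symp g g = 0 := by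
  simp [symp_apply, sympAt_self]

theorem sympAt_zero_left (v : PBit) : sympAt 0 v = 0 := by
  simp [sympAt]

theorem sympAt_zero_right (v : PBit) : sympAt v 0 = 0 := by
  simp [sympAt]

theorem symp_single [DecidableEq Q] (q : Q) (v : PBit) (h : PVec Q) :
    symp (Pi.single q v) h = sympAt v (h q) := by
  rw [symp_apply, Finset.sum_eq_single q]
  · simp
  · intro b _ hb; simp [hb, sympAt_zero_left]
  · simp

theorem exists_sympAt_eq_one {v : PBit} (hv : v ≠ 0) : ∃ w, sympAt w v = 1 := by
  revert v; decide

/-- Nondegeneracy: at a qubit where the two operators differ, a one-qubit Pauli operator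
anticommutes with their difference. -/
theorem eq_of_symp_eq {g h : PVec Q} (H : ∀ k, symp k g = symp k h) : g = h := by
  classical
  by_contra hne
  obtain ⟨q, hq⟩ := Function.ne_iff.1 hne
  obtain ⟨w, hw⟩ := exists_sympAt_eq_one (sub_ne_zero.2 hq)
  have := H (Pi.single q w)
  rw [symp_single, symp_single] at this
  have h2 : sympAt w (g q - h q) = sympAt w (g q) - sympAt w (h q) := by
    simp only [sympAt, Prod.fst_sub, Prod.snd_sub]; ring
  rw [h2, this, sub_self] at hw
  exact zero_ne_one hw

theorem symp_isRefl : (symp (Q := Q)).IsRefl := fun g h H => by rw [symp_comm, H]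

theorem symp_nondegenerate : (symp (Q := Q)).Nondegenerate := by
  constructor
  · intro g hg
    exact eq_of_symp_eq fun k => by rw [symp_comm, hg, map_zero]
  · intro g hg
    exact eq_of_symp_eq fun k => by rw [hg, map_zero]

/-- The Pauli operator with trivial phase. -/
def pauliOp (g : PVec Q) : QOp Q := tensorOp fun q => (g q).mat

theorem tensorOp_smul (c : Q → ℂ) (A : Q → Matrix Bool Bool ℂ) :
    tensorOp (fun q => c q • A q) = (∏ q, c q) • tensorOp A := by
  ext x y
  simp [tensorOp, Finset.prod_mul_distrib]

theorem star_pauliOp (g : PVec Q) : star (pauliOp g) = pauliOp g := by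
  simp only [pauliOp, tensorOp_star, PBit.star_mat]

variable [DecidableEq Q]

theorem pauliOp_mul (g h : PVec Q) :
    ∃ k : ℕ, pauliOp g * pauliOp h = Complex.I ^ k • pauliOp (g + h) := by
  choose k hk using PBit.mat_mul
  refine ⟨∑ q, k (g q) (h q), ?_⟩
  simp only [pauliOp, tensorOp_mul, hk, tensorOp_smul, Finset.prod_pow_eq_pow_sum]
  rfl

theorem pauliOp_comm (g h : PVec Q) :
    pauliOp g * pauliOp h = signOf (symp g h) • (pauliOp h * pauliOp g) := by
  simp only [pauliOp, tensorOp_mul]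
  rw [symp_apply, signOf_sum, ← tensorOp_smul]
  congr 1
  funext q
  exact PBit.mat_comm _ _

theorem pauliOp_mul_self (g : PVec Q) : pauliOp g * pauliOp g = 1 := by
  simp only [pauliOp, tensorOp_mul, PBit.mat_mul_self, tensorOp_one]

theorem pauliOp_ne_zero (g : PVec Q) : pauliOp g ≠ 0 := by
  intro h
  have := pauliOp_mul_self g
  rw [h, zero_mul] at this
  exact zero_ne_one this

/-- Proportional operators have the same commutation signs with every Pauli operator, and the form
is nondegenerate. -/
theorem eq_of_pauliOp_eq_smul {g h : PVec Q} {c : ℂ} (H : pauliOp g = c • pauliOp h) : g = h := by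
  refine eq_of_symp_eq fun k => signOf_injective ?_
  have h1 := pauliOp_comm k g
  have h2 := pauliOp_comm k h
  have h3 : (signOf (symp k g) - signOf (symp k h)) • (pauliOp g * pauliOp k) = 0 := by
    rw [sub_smul, ← h1, H, mul_smul_comm, h2, smul_mul_assoc, smul_comm, sub_self]
  rcases smul_eq_zero.1 h3 with h4 | h4
  · exact sub_eq_zero.1 h4
  · exfalso
    apply pauliOp_ne_zero g
    rw [← mul_one (pauliOp g), ← pauliOp_mul_self k, ← mul_assoc, h4, zero_mul]

/-- The Pauli operator with trivial phase, as a unitary. -/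
def pauliU (g : PVec Q) : QUnitary Q := pauliUnitary fun q => (g q).toLabel

theorem pauliU_coe (g : PVec Q) : (pauliU g : QOp Q) = pauliOp g := rfl

theorem pauliU_mem (g : PVec Q) : pauliU g ∈ pauliSet Q := pauliUnitary_mem _

theorem mem_pauliSet_iff (U : QUnitary Q) :
    U ∈ pauliSet Q ↔ ∃ (k : ℕ) (g : PVec Q), (U : QOp Q) = Complex.I ^ k • pauliOp g := by
  constructor
  · rintro ⟨k, P, h⟩
    choose f hf using PBit.toLabel_surjective
    refine ⟨k, fun q => f (P q), ?_⟩
    simp only [pauliOp, PBit.mat, hf, h]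
  · rintro ⟨k, g, h⟩
    refine ⟨⟨k % 4, Nat.mod_lt _ (by norm_num)⟩, fun q => (g q).toLabel, ?_⟩
    rw [h]
    simp only [pauliOp, PBit.mat]
    rw [Complex.I_pow_eq_pow_mod]

end Pauli

noncomputable section

/-! ### Clifford unitaries as symplectic maps, and transvections -/

section Clifford

variable {Q : Type} [Fintype Q] [DecidableEq Q]

/-- `A` intertwines the Pauli operators `g` and `h` up to a phase. -/
def Intertwines (A : QOp Q) (g h : PVec Q) : Prop :=
  ∃ c : ℂ, c ≠ 0 ∧ A * pauliOp g = c • (pauliOp h * A)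

theorem Intertwines.mul {A B : QOp Q} {g h k : PVec Q} (hB : Intertwines B g h)
    (hA : Intertwines A h k) : Intertwines (A * B) g k := by
  obtain ⟨c, hc, h1⟩ := hB
  obtain ⟨d, hd, h2⟩ := hA
  refine ⟨c * d, mul_ne_zero hc hd, ?_⟩
  rw [mul_assoc, h1, mul_smul_comm, ← mul_assoc, h2, smul_mul_assoc, smul_smul, mul_assoc]

theorem Intertwines.one (g : PVec Q) : Intertwines 1 g g := ⟨1, one_ne_zero, by simp⟩

theorem Intertwines.smul {A : QOp Q} {g h : PVec Q} (H : Intertwines A g h) (z : ℂ) :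
    Intertwines (z • A) g h := by
  obtain ⟨c, hc, h1⟩ := H
  refine ⟨c, hc, ?_⟩
  rw [smul_mul_assoc, h1, mul_smul_comm, smul_comm]

theorem Intertwines.add {A : QOp Q} {g h g' h' : PVec Q} (H : Intertwines A g g')
    (H' : Intertwines A h h') : Intertwines A (g + h) (g' + h') := by
  obtain ⟨c, hc, h1⟩ := H
  obtain ⟨d, hd, h2⟩ := H'
  obtain ⟨k, hk⟩ := pauliOp_mul g h
  obtain ⟨l, hl⟩ := pauliOp_mul g' h'
  have hI : ∀ n : ℕ, Complex.I ^ n ≠ 0 := fun n => pow_ne_zero n Complex.I_ne_zero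
  refine ⟨(Complex.I ^ k)⁻¹ * (c * d) * Complex.I ^ l,
    mul_ne_zero (mul_ne_zero (inv_ne_zero (hI k)) (mul_ne_zero hc hd)) (hI l), ?_⟩
  have h3 : pauliOp (g + h) = (Complex.I ^ k)⁻¹ • (pauliOp g * pauliOp h) := by
    rw [hk, smul_smul, inv_mul_cancel₀ (hI k), one_smul]
  rw [h3, mul_smul_comm, ← mul_assoc, h1, smul_mul_assoc, mul_assoc, h2, mul_smul_comm,
    ← mul_assoc, hl]
  simp only [smul_mul_assoc, smul_smul, mul_assoc]

theorem Intertwines.unique {A B : QOp Q} (hAB : A * B = 1) {g h h' : PVec Q}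
    (H : Intertwines A g h) (H' : Intertwines A g h') : h = h' := by
  obtain ⟨c, hc, h1⟩ := H
  obtain ⟨d, hd, h2⟩ := H'
  have : ∀ k, pauliOp k = (pauliOp k * A) * B := fun k => by rw [mul_assoc, hAB, mul_one]
  refine eq_of_pauliOp_eq_smul (c := c⁻¹ * d) ?_
  rw [this h, this h', ← smul_mul_assoc, mul_smul, ← h2, h1, smul_smul, inv_mul_cancel₀ hc,
    one_smul]

/-- Pushing both products of the two operators through the invertible `A` produces the same scalar,
so the commutation sign is preserved. -/
theorem Intertwines.symp_eq {A B : QOp Q} (hAB : A * B = 1) {g h g' h' : PVec Q}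
    (H : Intertwines A g g') (H' : Intertwines A h h') : symp g h = symp g' h' := by
  obtain ⟨c, hc, h1⟩ := H
  obtain ⟨d, hd, h2⟩ := H'
  apply signOf_injective
  have e1 : A * (pauliOp g * pauliOp h) = (c * d) • (pauliOp g' * pauliOp h' * A) := by
    rw [← mul_assoc, h1, smul_mul_assoc, mul_assoc, h2, mul_smul_comm, smul_smul, mul_assoc]
  have e2 : A * (pauliOp h * pauliOp g) = (c * d) • (pauliOp h' * pauliOp g' * A) := by
    rw [← mul_assoc, h2, smul_mul_assoc, mul_assoc, h1, mul_smul_comm, smul_smul, mul_comm d c,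
      mul_assoc]
  rw [pauliOp_comm g h, mul_smul_comm, e2, pauliOp_comm g' h'] at e1
  rw [smul_mul_assoc, smul_comm] at e1
  have e3 := smul_right_injective (QOp Q) (mul_ne_zero hc hd) e1
  have e4 : (signOf (symp g h) - signOf (symp g' h')) • (pauliOp h' * pauliOp g' * A) = 0 := by
    rw [sub_smul, sub_eq_zero]; exact e3
  rcases smul_eq_zero.1 e4 with h5 | h5
  · exact sub_eq_zero.1 h5
  · exfalso
    have : (1 : QOp Q) = 0 := by
      calc (1 : QOp Q) = pauliOp g' * (pauliOp h' * (pauliOp h' * pauliOp g' * A)) * B := by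
            rw [← mul_assoc (pauliOp h'), ← mul_assoc (pauliOp h'), pauliOp_mul_self, one_mul,
              ← mul_assoc, pauliOp_mul_self, one_mul, hAB]
        _ = 0 := by rw [h5]; simp
    exact one_ne_zero this

theorem unitary_mul_inv (U : QUnitary Q) :
    (U : QOp Q) * ((U⁻¹ : QUnitary Q) : QOp Q) = 1 := by
  have := congrArg (fun V : QUnitary Q => (V : QOp Q)) (mul_inv_cancel U)
  simpa only [Submonoid.coe_mul, OneMemClass.coe_one] using this

/-- The Pauli group is finite, so an injective conjugation that maps it into itself maps it onto
itself; one inclusion suffices for membership in the normalizer. -/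
theorem mem_cliffordGroup_iff (U : QUnitary Q) :
    U ∈ cliffordGroup Q ↔ ∀ g : PVec Q, ∃ (k : ℕ) (h : PVec Q),
      (U : QOp Q) * pauliOp g = Complex.I ^ k • (pauliOp h * U) := by
  have hinv : ((U⁻¹ : QUnitary Q) : QOp Q) * (U : QOp Q) = 1 := by
    have := congrArg (fun V : QUnitary Q => (V : QOp Q)) (inv_mul_cancel U)
    simpa only [Submonoid.coe_mul, OneMemClass.coe_one] using this
  constructor
  · intro hU g
    obtain ⟨k, h, hk⟩ := (mem_pauliSet_iff _).1 ((hU _).1 (pauliU_mem g))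
    refine ⟨k, h, ?_⟩
    simp only [Submonoid.coe_mul, pauliU_coe] at hk
    rw [← smul_mul_assoc, ← hk, mul_assoc, hinv, mul_one]
  · intro H
    have : Finite (pauliSet Q) := (pauliSet_finite Q).to_subtype
    refine Subgroup.mem_normalizer_fintype fun V hV => ?_
    obtain ⟨l, g, hl⟩ := (mem_pauliSet_iff _).1 hV
    obtain ⟨k, h, hk⟩ := H g
    refine (mem_pauliSet_iff _).2 ⟨l + k, h, ?_⟩
    simp only [Submonoid.coe_mul]
    rw [hl, mul_smul_comm, hk, smul_mul_assoc, smul_mul_assoc, mul_assoc, unitary_mul_inv, mul_one,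
      smul_smul, pow_add]

theorem exists_intertwines (U : cliffordGroup Q) (g : PVec Q) :
    ∃ h, Intertwines ((U : QUnitary Q) : QOp Q) g h := by
  obtain ⟨k, h, hk⟩ := (mem_cliffordGroup_iff _).1 U.2 g
  exact ⟨h, _, pow_ne_zero k Complex.I_ne_zero, hk⟩

/-- The action of a Clifford unitary on Pauli operators by conjugation, up to phases. -/
def cliffAct (U : cliffordGroup Q) : PVec Q →ₗ[ZMod 2] PVec Q :=
  AddMonoidHom.toZModLinearMap 2 (AddMonoidHom.mk' (fun g => (exists_intertwines U g).choose)
    fun g h => Intertwines.unique (unitary_mul_inv _) (exists_intertwines U (g + h)).choose_spec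
      ((exists_intertwines U g).choose_spec.add (exists_intertwines U h).choose_spec))

theorem cliffAct_spec (U : cliffordGroup Q) (g : PVec Q) :
    Intertwines ((U : QUnitary Q) : QOp Q) g (cliffAct U g) :=
  (exists_intertwines U g).choose_spec

theorem cliffAct_eq {U : cliffordGroup Q} {g h : PVec Q}
    (H : Intertwines ((U : QUnitary Q) : QOp Q) g h) : cliffAct U g = h :=
  Intertwines.unique (unitary_mul_inv _) (cliffAct_spec U g) H

theorem symp_cliffAct (U : cliffordGroup Q) (g h : PVec Q) :
    symp (cliffAct U g) (cliffAct U h) = symp g h :=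
  (Intertwines.symp_eq (unitary_mul_inv _) (cliffAct_spec U g) (cliffAct_spec U h)).symm

theorem cliffAct_mul (U V : cliffordGroup Q) (g : PVec Q) :
    cliffAct (U * V) g = cliffAct U (cliffAct V g) :=
  cliffAct_eq ((cliffAct_spec V g).mul (cliffAct_spec U _))

theorem cliffAct_of_mem_globalPhases {U : cliffordGroup Q}
    (hU : U ∈ (globalPhases Q).subgroupOf (cliffordGroup Q)) (g : PVec Q) : cliffAct U g = g := by
  obtain ⟨z, hz⟩ := Subgroup.mem_subgroupOf.1 hU
  apply cliffAct_eq
  rw [hz]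
  exact (Intertwines.one g).smul z

/-- The action of a Clifford gate on Pauli operators. -/
def gateAct (γ : CliffordGate Q) : PVec Q →ₗ[ZMod 2] PVec Q := cliffAct γ.out

theorem symp_gateAct (γ : CliffordGate Q) (g h : PVec Q) :
    symp (gateAct γ g) (gateAct γ h) = symp g h := symp_cliffAct _ g h

instance : MulAction (cliffordGroup Q) (CliffordGate Q) :=
  MulAction.quotient (cliffordGroup Q) ((globalPhases Q).subgroupOf (cliffordGroup Q))

/-- The chosen representatives of `t • γ` and `γ` match only up to a global phase, and phases act
trivially on Pauli operators. -/
theorem gateAct_smul (t : cliffordGroup Q) (γ : CliffordGate Q) (g : PVec Q) :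
    gateAct (t • γ) g = cliffAct t (gateAct γ g) := by
  have h : (((t • γ).out : cliffordGroup Q) : CliffordGate Q) = ((t * γ.out : cliffordGroup Q)) := by
    rw [QuotientGroup.out_eq', ← smul_eq_mul, ← MulAction.Quotient.smul_mk, QuotientGroup.out_eq']
  rw [eq_comm, QuotientGroup.eq] at h
  have h2 : (t • γ).out = (t * γ.out) * ((t * γ.out)⁻¹ * (t • γ).out) := by group
  rw [gateAct, h2, cliffAct_mul, cliffAct_of_mem_globalPhases h, cliffAct_mul, gateAct]

/-- A symplectic transvection. -/
def transv (x : PVec Q) : PVec Q →ₗ[ZMod 2] PVec Q :=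
  LinearMap.id + (symp x).smulRight x

theorem transv_apply (x g : PVec Q) : transv x g = g + symp x g • x := rfl

theorem transv_self (x : PVec Q) : transv x x = x := by
  rw [transv_apply, symp_self, zero_smul, add_zero]

/-- With P the operator of `x` and G that of `g`: if they commute, G passes through 1 + iP. If they
anticommute, then (1 + iP)G = G - iGP = -i(GP)(1 + iP), and GP is a power of i times the operator of
`g + x`. -/
theorem transvOp_mul (x g : PVec Q) : ∃ k : ℕ,
    (1 + Complex.I • pauliOp x) * pauliOp g =
      Complex.I ^ k • (pauliOp (transv x g) * (1 + Complex.I • pauliOp x)) := by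
  have hc := pauliOp_comm x g
  rw [transv_apply]
  rcases zmod2_cases (symp x g) with h | h <;> rw [h] at hc ⊢
  · refine ⟨0, ?_⟩
    simp only [signOf, if_true, one_smul] at hc
    rw [zero_smul, add_zero, pow_zero, one_smul, add_mul, mul_add, smul_mul_assoc, mul_smul_comm,
      hc, one_mul, mul_one]
  · have hs : signOf 1 = -1 := by simp [signOf]
    rw [hs, neg_one_smul] at hc
    obtain ⟨k, hk⟩ := pauliOp_mul g x
    have hI : Complex.I ^ k ≠ 0 := pow_ne_zero k Complex.I_ne_zero
    have h2 : pauliOp (g + x) = (Complex.I ^ k)⁻¹ • (pauliOp g * pauliOp x) := by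
      rw [hk, smul_smul, inv_mul_cancel₀ hI, one_smul]
    have h3 : ∃ l : ℕ, Complex.I ^ l = -Complex.I * Complex.I ^ k :=
      ⟨3 + k, by rw [pow_add, Complex.I_pow_three]⟩
    obtain ⟨l, hl⟩ := h3
    refine ⟨l, ?_⟩
    rw [one_smul, h2, hl, smul_mul_assoc, smul_smul, mul_assoc, mul_inv_cancel₀ hI, mul_one,
      mul_add, mul_one, add_mul, one_mul, mul_smul_comm, mul_assoc (pauliOp g), pauliOp_mul_self,
      smul_mul_assoc, hc, smul_add, smul_smul]
    simp [add_comm]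

/-- A Clifford unitary that acts as a transvection. -/
def transvUnitary (x : PVec Q) : QUnitary Q :=
  ⟨((1 / √2 : ℝ) : ℂ) • (1 + Complex.I • pauliOp x), by
    rw [Matrix.mem_unitaryGroup_iff', star_smul, smul_mul_smul_comm, star_add, star_smul,
      star_pauliOp, star_one, add_mul, mul_add, mul_add, smul_mul_smul_comm, pauliOp_mul_self]
    have h2 : star ((1 / √2 : ℝ) : ℂ) * ((1 / √2 : ℝ) : ℂ) = 1 / 2 := by
      rw [Complex.star_def, Complex.conj_ofReal, ← Complex.ofReal_mul]
      have : (1 / √2 : ℝ) * (1 / √2) = 1 / 2 := by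
        rw [div_mul_div_comm, Real.mul_self_sqrt (by norm_num)]; norm_num
      rw [this]; norm_num
    rw [h2]
    ext a b
    simp
    ring⟩

theorem transvUnitary_mul (x g : PVec Q) : ∃ k : ℕ, (transvUnitary x : QOp Q) * pauliOp g =
      Complex.I ^ k • (pauliOp (transv x g) * transvUnitary x) := by
  obtain ⟨k, hk⟩ := transvOp_mul x g
  refine ⟨k, ?_⟩
  simp only [transvUnitary]
  rw [smul_mul_assoc, hk, mul_smul_comm, smul_comm]

/-- A Clifford element that acts as a transvection. -/
def transvCliff (x : PVec Q) : cliffordGroup Q :=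
  ⟨transvUnitary x, (mem_cliffordGroup_iff _).2 fun g =>
    let ⟨k, hk⟩ := transvUnitary_mul x g
    ⟨k, _, hk⟩⟩

theorem cliffAct_transvCliff (x g : PVec Q) : cliffAct (transvCliff x) g = transv x g := by
  obtain ⟨k, hk⟩ := transvUnitary_mul x g
  exact cliffAct_eq ⟨_, pow_ne_zero k Complex.I_ne_zero, hk⟩

theorem exists_symp_eq_one {v : PVec Q} (hv : v ≠ 0) : ∃ y, symp y v = 1 := by
  by_contra! h
  refine hv (eq_of_symp_eq fun k => ?_)
  rw [map_zero]
  exact (zmod2_cases _).resolve_right (h k)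

theorem exists_symp_eq_one_of_two {v w : PVec Q} (hv : v ≠ 0) (hw : w ≠ 0) :
    ∃ y, symp y v = 1 ∧ symp y w = 1 := by
  obtain ⟨y₁, h₁⟩ := exists_symp_eq_one hv
  obtain ⟨y₂, h₂⟩ := exists_symp_eq_one hw
  rcases zmod2_cases (symp y₁ w) with h3 | h3
  · rcases zmod2_cases (symp y₂ v) with h4 | h4
    · exact ⟨y₁ + y₂, by simp [h₁, h4], by simp [h₂, h3]⟩
    · exact ⟨y₂, h4, h₂⟩
  · exact ⟨y₁, h₁, h3⟩

theorem pvec_add_self (v : PVec Q) : v + v = 0 := by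
  have h11 : (1 : ZMod 2) + 1 = 0 := by decide
  rw [← one_smul (ZMod 2) v, ← add_smul, h11, zero_smul]

/-- If v and w anticommute, the transvection along v + w maps v to w. In general, two such steps
lead through an operator y that anticommutes with both. -/
theorem exists_cliffAct_eq {v w : PVec Q} (hv : v ≠ 0) (hw : w ≠ 0) :
    ∃ t : cliffordGroup Q, cliffAct t v = w := by
  have key : ∀ v w : PVec Q, symp w v = 1 → cliffAct (transvCliff (v + w)) v = w := by
    intro v w h
    rw [cliffAct_transvCliff, transv_apply, map_add, LinearMap.add_apply, symp_self, h, zero_add,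
      one_smul, ← add_assoc, pvec_add_self, zero_add]
  obtain ⟨y, h1, h2⟩ := exists_symp_eq_one_of_two hv hw
  refine ⟨transvCliff (y + w) * transvCliff (v + y), ?_⟩
  rw [cliffAct_mul, key v y h1, key y w (by rw [symp_comm, h2])]

theorem gateAct_injective (γ : CliffordGate Q) : Function.Injective (gateAct γ) := by
  rw [← LinearMap.ker_eq_bot, LinearMap.ker_eq_bot']
  intro g hg
  refine eq_of_symp_eq fun k => ?_
  rw [← symp_gateAct γ, hg, map_zero, map_zero]

/-- Left multiplication by a Clifford unitary that maps `w` to `w'` carries one fibre injectively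
into the other. This is the source of uniformity in all later counts. -/
theorem card_gate_eq {v w w' : PVec Q} (hw : w ≠ 0) (hw' : w' ≠ 0) :
    Nat.card {γ : CliffordGate Q // gateAct γ v = w} =
      Nat.card {γ : CliffordGate Q // gateAct γ v = w'} := by
  have key : ∀ w w' : PVec Q, w ≠ 0 → w' ≠ 0 →
      Nat.card {γ : CliffordGate Q // gateAct γ v = w} ≤
      Nat.card {γ : CliffordGate Q // gateAct γ v = w'} := by
    intro w w' hw hw'
    obtain ⟨t, ht⟩ := exists_cliffAct_eq hw hw'
    refine Nat.card_le_card_of_injective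
      (fun γ => ⟨t • γ.1, by rw [gateAct_smul, γ.2, ht]⟩) fun a b hab => ?_
    have h := congrArg Subtype.val hab
    exact Subtype.ext (MulAction.injective t h)
  exact le_antisymm (key w w' hw hw') (key w' w hw' hw)

end Clifford

end

noncomputable section

/-! ### Lagrangian subspaces -/

section Lagrangian

variable {Q : Type} [Fintype Q]

/-- The Pauli operators that are tensor products of `I` and `Z` outside `S`. -/
def zOff (S : Set Q) : Submodule (ZMod 2) (PVec Q) where
  carrier := {g | ∀ q, q ∉ S → (g q).1 = 0}
  add_mem' := by
    intro a b ha hb q hq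
    simp [ha q hq, hb q hq]
  zero_mem' := by simp
  smul_mem' := by
    intro c a ha q hq
    simp [ha q hq]

/-- Maximal sets of pairwise commuting Pauli operators. -/
def IsLagrangian (M : Submodule (ZMod 2) (PVec Q)) : Prop :=
  ∀ g, g ∈ M ↔ ∀ h ∈ M, symp h g = 0

theorem sympAt_zero_one (v : PBit) : sympAt (0, 1) v = v.1 := by
  simp [sympAt]

theorem isLagrangian_zOff_empty [DecidableEq Q] :
    IsLagrangian (zOff (∅ : Set Q)) := by
  intro g
  constructor
  · intro hg h hh
    rw [symp_apply]
    refine Finset.sum_eq_zero fun q _ => ?_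
    simp [sympAt, hg q (by simp), hh q (by simp)]
  · intro H q _
    have := H (Pi.single q (0, 1)) (by
      intro r _
      by_cases hr : r = q
      · subst hr; simp
      · simp [hr])
    rwa [symp_single, sympAt_zero_one] at this

theorem IsLagrangian.map {M : Submodule (ZMod 2) (PVec Q)} (hM : IsLagrangian M)
    (f : PVec Q →ₗ[ZMod 2] PVec Q) (hf : ∀ g h, symp (f g) (f h) = symp g h) :
    IsLagrangian (M.map f) := by
  have hinj : Function.Injective f := by
    rw [← LinearMap.ker_eq_bot, LinearMap.ker_eq_bot']
    intro g hg
    refine eq_of_symp_eq fun k => ?_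
    rw [← hf, hg, map_zero, map_zero]
  intro g
  obtain ⟨g, rfl⟩ := LinearMap.injective_iff_surjective.1 hinj g
  constructor
  · rintro ⟨g', hg', h⟩ _ ⟨h', hh', rfl⟩
    rw [← hinj h, hf]
    exact (hM g').1 hg' h' hh'
  · intro H
    exact ⟨g, (hM g).2 fun h hh => by rw [← hf]; exact H _ ⟨h, hh, rfl⟩, rfl⟩

/-- A Pauli operator that commutes with all elements of `M` that are of `Z`-type outside `S`
extends, by an operator of `Z`-type outside `S`, to an element of `M`. -/
theorem IsLagrangian.exists_extension [DecidableEq Q] {M : Submodule (ZMod 2) (PVec Q)}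
    (hM : IsLagrangian M)
    (S : Set Q) (u : PVec Q) (hu : ∀ g ∈ M, g ∈ zOff S → symp g u = 0) :
    ∃ m ∈ M, (∀ q ∈ S, m q = u q) ∧ ∀ q, q ∉ S → (m q).1 = (u q).1 := by
  -- `K` consists of the Z-type operators supported off `S`. Anything orthogonal to both `M` and `K`
  -- lies in `M` and is of Z-type off `S`, so the hypothesis puts `u` in the double orthogonal
  -- complement of `M ⊔ K`, which is `M ⊔ K` itself.
  let K : Submodule (ZMod 2) (PVec Q) :=
    { carrier := {k | (∀ q ∈ S, k q = 0) ∧ ∀ q, q ∉ S → (k q).1 = 0}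
      add_mem' := by
        intro a b ha hb
        exact ⟨fun q hq => by simp [ha.1 q hq, hb.1 q hq],
          fun q hq => by simp [ha.2 q hq, hb.2 q hq]⟩
      zero_mem' := by simp
      smul_mem' := by
        intro c a ha
        exact ⟨fun q hq => by simp [ha.1 q hq], fun q hq => by simp [ha.2 q hq]⟩ }
  have hmem : u ∈ symp.orthogonal (symp.orthogonal (M ⊔ K)) := by
    rw [LinearMap.BilinForm.mem_orthogonal_iff]
    intro g hg
    rw [LinearMap.BilinForm.mem_orthogonal_iff] at hg
    refine hu g ((hM g).2 fun h hh => hg h (Submodule.mem_sup_left hh)) fun q hq => ?_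
    have : symp (Pi.single q (0, 1)) g = 0 := by
      refine hg _ (Submodule.mem_sup_right ⟨fun r hr => ?_, fun r _ => ?_⟩)
      · have : r ≠ q := fun h => hq (h ▸ hr)
        simp [this]
      · by_cases hr : r = q
        · subst hr; simp
        · simp [hr]
    rwa [symp_single, sympAt_zero_one] at this
  rw [LinearMap.BilinForm.orthogonal_orthogonal symp_nondegenerate symp_isRefl] at hmem
  obtain ⟨m, hm, k, hk, rfl⟩ := Submodule.mem_sup.1 hmem
  exact ⟨m, hm, fun q hq => by simp [hk.1 q hq], fun q hq => by simp [hk.2 q hq]⟩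

end Lagrangian

/-! ### Gates acting on a subset of the qubits -/

section Embedding

variable {Q : Type} [Fintype Q] [DecidableEq Q]

/-- Combine bit strings on `S` and on its complement. -/
def mergeBits (S : Finset Q) (x : {q // q ∉ S} → Bool) (y : S → Bool) : Q → Bool :=
  fun q => if h : q ∈ S then y ⟨q, h⟩ else x ⟨q, h⟩

theorem mergeBits_of_mem {S : Finset Q} (x : {q // q ∉ S} → Bool) (y : S → Bool) (q : S) :
    mergeBits S x y q = y q := by
  simp [mergeBits]

theorem mergeBits_of_notMem {S : Finset Q} (x : {q // q ∉ S} → Bool) (y : S → Bool)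
    (q : {q // q ∉ S}) : mergeBits S x y q = x q := by
  simp [mergeBits, q.2]

theorem mergeBits_restrict (S : Finset Q) (z : Q → Bool) :
    mergeBits S (fun q => z q) (fun q => z q) = z := by
  funext q
  simp [mergeBits]

theorem sum_eq_sum_mergeBits (S : Finset Q) (x : {q // q ∉ S} → Bool) (f : (Q → Bool) → ℂ)
    (hf : ∀ z, (∃ q : {q // q ∉ S}, x q ≠ z q) → f z = 0) :
    ∑ z, f z = ∑ y, f (mergeBits S x y) := by
  symm
  refine Fintype.sum_of_injective (mergeBits S x) ?_ _ _ ?_ fun _ => rfl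
  · intro y y' h
    funext q
    rw [← mergeBits_of_mem x y q, h, mergeBits_of_mem]
  · intro z hz
    refine hf z ?_
    by_contra! h
    refine hz ⟨fun q => z q, ?_⟩
    conv_rhs => rw [← mergeBits_restrict S z]
    rw [show x = fun q : {q // q ∉ S} => z q from funext h]

theorem prod_eq_mul_prod_compl (S : Finset Q) (f : Q → ℂ) :
    ∏ q, f q = (∏ q : S, f q) * ∏ q : {q // q ∉ S}, f q := by
  rw [← Fintype.prod_subtype_mul_prod_subtype (fun q => q ∈ S) f]
  congr 2
  exact congrArg (fun i => @Finset.univ S i) (Subsingleton.elim _ _)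

/-- The gate is the identity off `S`, so only intermediate bit strings agreeing with `x` there
contribute, and the entry factors into the parts on and off `S`. -/
theorem embedGate_mul_tensorOp (S : Finset Q) (U : QOp S) (A : Q → Matrix Bool Bool ℂ)
    (x y : Q → Bool) :
    (embedGate S U * tensorOp A) x y = (∏ q : {q // q ∉ S}, A q (x q) (y q)) *
      (U * tensorOp fun q : S => A q) (fun q => x q) (fun q => y q) := by
  rw [Matrix.mul_apply, sum_eq_sum_mergeBits S fun q => x q]
  · rw [Matrix.mul_apply, Finset.mul_sum]
    refine Finset.sum_congr rfl fun z _ => ?_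
    have h1 : ∀ q, q ∉ S → x q = mergeBits S (fun q => x q) z q := fun q hq =>
      (mergeBits_of_notMem (fun q => x q) z ⟨q, hq⟩).symm
    simp only [embedGate, tensorOp, Matrix.of_apply]
    rw [if_pos h1, prod_eq_mul_prod_compl S]
    simp only [mergeBits_of_mem, mergeBits_of_notMem]
    ring
  · rintro z ⟨q, hq⟩
    simp only [embedGate, Matrix.of_apply]
    rw [if_neg fun h => hq (h q q.2), zero_mul]

theorem tensorOp_mul_embedGate (S : Finset Q) (U : QOp S) (A : Q → Matrix Bool Bool ℂ)
    (x y : Q → Bool) :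
    (tensorOp A * embedGate S U) x y = (∏ q : {q // q ∉ S}, A q (x q) (y q)) *
      ((tensorOp fun q : S => A q) * U) (fun q => x q) (fun q => y q) := by
  rw [Matrix.mul_apply, sum_eq_sum_mergeBits S fun q => y q]
  · rw [Matrix.mul_apply, Finset.mul_sum]
    refine Finset.sum_congr rfl fun z _ => ?_
    have h1 : ∀ q, q ∉ S → mergeBits S (fun q => y q) z q = y q := fun q hq =>
      mergeBits_of_notMem (fun q => y q) z ⟨q, hq⟩
    simp only [embedGate, tensorOp, Matrix.of_apply]
    rw [if_pos h1, prod_eq_mul_prod_compl S]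
    simp only [mergeBits_of_mem, mergeBits_of_notMem]
    ring
  · rintro z ⟨q, hq⟩
    simp only [embedGate, Matrix.of_apply]
    rw [if_neg fun h => hq (h q q.2).symm, mul_zero]

/-- Apply a linear map to the part of a Pauli operator that is supported on `S`. -/
def embedAct (S : Finset Q) (φ : PVec S →ₗ[ZMod 2] PVec S) : PVec Q →ₗ[ZMod 2] PVec Q where
  toFun g := fun q => if h : q ∈ S then φ (fun s => g s) ⟨q, h⟩ else g q
  map_add' g h := by
    funext q
    by_cases hq : q ∈ S
    · simp only [hq, dif_pos, Pi.add_apply]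
      exact congrFun (φ.map_add (fun s => g s) fun s => h s) _
    · simp [hq]
  map_smul' c g := by
    funext q
    by_cases hq : q ∈ S
    · simp only [hq, dif_pos, Pi.smul_apply, RingHom.id_apply]
      exact congrFun (φ.map_smul c fun s => g s) _
    · simp [hq]

theorem embedAct_restrict (S : Finset Q) (φ : PVec S →ₗ[ZMod 2] PVec S) (g : PVec Q) :
    (fun s : S => embedAct S φ g s) = φ fun s => g s := by
  funext s
  simp [embedAct]

theorem embedAct_of_notMem {S : Finset Q} (φ : PVec S →ₗ[ZMod 2] PVec S) (g : PVec Q) {q : Q}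
    (hq : q ∉ S) : embedAct S φ g q = g q := by
  simp [embedAct, hq]

theorem symp_eq_add_compl (S : Finset Q) (g h : PVec Q) :
    symp g h = symp (fun s : S => g s) (fun s : S => h s) +
      ∑ q : {q // q ∉ S}, sympAt (g q) (h q) := by
  rw [symp_apply, ← Fintype.sum_subtype_add_sum_subtype (fun q => q ∈ S), symp_apply]
  congr 2
  exact congrArg (fun i => @Finset.univ S i) (Subsingleton.elim _ _)

theorem symp_embedAct (S : Finset Q) {φ : PVec S →ₗ[ZMod 2] PVec S}
    (hφ : ∀ g h, symp (φ g) (φ h) = symp g h) (g h : PVec Q) :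
    symp (embedAct S φ g) (embedAct S φ h) = symp g h := by
  rw [symp_eq_add_compl S, symp_eq_add_compl S g h, embedAct_restrict, embedAct_restrict, hφ]
  congr 1
  exact Finset.sum_congr rfl fun q _ => by
    rw [embedAct_of_notMem _ _ q.2, embedAct_of_notMem _ _ q.2]

theorem intertwines_embedGate (S : Finset Q) {U : QOp S} {φ : PVec S →ₗ[ZMod 2] PVec S}
    (hφ : ∀ g, Intertwines U g (φ g)) (g : PVec Q) :
    Intertwines (embedGate S U) g (embedAct S φ g) := by
  obtain ⟨c, hc, h⟩ := hφ fun s => g s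
  refine ⟨c, hc, ?_⟩
  ext x y
  rw [Matrix.smul_apply, pauliOp, pauliOp, embedGate_mul_tensorOp, tensorOp_mul_embedGate]
  have h1 := congrFun (congrFun h (fun q => x q)) (fun q => y q)
  rw [Matrix.smul_apply] at h1
  have h2 : (tensorOp fun q : S => (g q).mat) = pauliOp fun s : S => g s := rfl
  have h3 : (tensorOp fun q : S => (embedAct S φ g q).mat) = pauliOp (φ fun s : S => g s) := by
    rw [← embedAct_restrict]; rfl
  rw [h2, h3, h1, smul_eq_mul, smul_eq_mul, mul_left_comm]
  congr 2
  exact Finset.prod_congr rfl fun q _ => by rw [embedAct_of_notMem _ _ q.2]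

end Embedding

/-! ### The stabilizer group of the output state and its behaviour under measurement -/

section Circuit

variable {n : ℕ} {𝒯 : CircuitTemplate n}

/-- The action of a Clifford circuit on Pauli operators. -/
def CliffordCircuit.act (D : CliffordCircuit 𝒯) : PVec (Fin n) →ₗ[ZMod 2] PVec (Fin n) :=
  (List.ofFn fun i => (embedAct (𝒯.get i) (gateAct (D i)) :
    Module.End (ZMod 2) (PVec (Fin n)))).reverse.prod

theorem intertwines_list_prod {Q : Type} [Fintype Q] [DecidableEq Q] {k : ℕ} (A : Fin k → QOp Q)
    (B : Fin k → Module.End (ZMod 2) (PVec Q)) (h : ∀ i g, Intertwines (A i) g (B i g))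
    (g : PVec Q) :
    Intertwines (List.ofFn A).reverse.prod g ((List.ofFn B).reverse.prod g) := by
  induction k generalizing g with
  | zero => simpa using Intertwines.one g
  | succ k ih =>
    simp only [List.ofFn_succ, List.reverse_cons, List.prod_append, List.prod_singleton]
    exact (h 0 g).mul (ih _ _ (fun i => h i.succ) _)

theorem symp_list_prod {Q : Type} [Fintype Q] (l : List (Module.End (ZMod 2) (PVec Q)))
    (h : ∀ f ∈ l, ∀ a b, symp (f a) (f b) = symp a b) (a b : PVec Q) :
    symp (l.prod a) (l.prod b) = symp a b := by
  induction l with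
  | nil => simp
  | cons f l ih =>
    rw [List.prod_cons, Module.End.mul_apply, Module.End.mul_apply, h f (by simp),
      ih fun f' hf' => h f' (by simp [hf'])]

theorem CliffordCircuit.intertwines (D : CliffordCircuit 𝒯) (g : PVec (Fin n)) :
    Intertwines D.toOp g (D.act g) :=
  intertwines_list_prod _ _ (fun _ g => intertwines_embedGate _ (cliffAct_spec _) g) g

theorem CliffordCircuit.symp_act (D : CliffordCircuit 𝒯) (g h : PVec (Fin n)) :
    symp (D.act g) (D.act h) = symp g h := by
  refine symp_list_prod _ ?_ g h
  intro f hf a b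
  rw [List.mem_reverse, List.mem_ofFn] at hf
  obtain ⟨i, rfl⟩ := hf
  exact symp_embedAct _ (symp_gateAct _) a b

/-- The stabilizer group of the output state, up to phases. -/
def CliffordCircuit.stab (D : CliffordCircuit 𝒯) : Submodule (ZMod 2) (PVec (Fin n)) :=
  (zOff ∅).map D.act

theorem CliffordCircuit.isLagrangian_stab (D : CliffordCircuit 𝒯) : IsLagrangian D.stab :=
  isLagrangian_zOff_empty.map D.act D.symp_act

theorem PBit.mat_of_zType {v : PBit} (hv : v.1 = 0) {a b : Bool} (hab : a ≠ b) :
    v.mat a b = 0 := by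
  rcases v.cases with rfl | rfl | rfl | rfl <;> simp_all [mat_I, mat_Z]

theorem PBit.mat_diag_ne_zero {v : PBit} (hv : v.1 = 0) (a : Bool) : v.mat a a ≠ 0 := by
  rcases v.cases with rfl | rfl | rfl | rfl <;> cases a <;> simp_all [mat_I, mat_Z]

theorem PBit.mat_false_false {v : PBit} (hv : v.1 = 0) : v.mat false false = 1 := by
  rcases v.cases with rfl | rfl | rfl | rfl <;> simp_all [mat_I, mat_Z]

theorem pauliOp_mulVec_zero {Q : Type} [Fintype Q] [DecidableEq Q] {g : PVec Q}
    (hg : g ∈ zOff (∅ : Set Q)) :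
    pauliOp g *ᵥ Pi.single (fun _ => false) 1 = Pi.single (fun _ => false) 1 := by
  funext x
  simp only [Matrix.mulVec_single_one, Matrix.col_apply, pauliOp, tensorOp, Matrix.of_apply]
  by_cases hx : x = fun _ => false
  · subst hx
    simp [PBit.mat_false_false (hg _ (by simp))]
  · rw [Pi.single_eq_of_ne hx]
    obtain ⟨q, hq⟩ := Function.ne_iff.1 hx
    exact Finset.prod_eq_zero (Finset.mem_univ q) (PBit.mat_of_zType (hg q (by simp)) hq)

theorem CliffordCircuit.pauliOp_mulVec_outputState (D : CliffordCircuit 𝒯) {g : PVec (Fin n)}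
    (hg : g ∈ D.stab) : ∃ c : ℂ, pauliOp g *ᵥ D.outputState = c • D.outputState := by
  obtain ⟨z, hz, rfl⟩ := hg
  obtain ⟨c, hc, h⟩ := D.intertwines z
  refine ⟨c⁻¹, ?_⟩
  have h2 : pauliOp (D.act z) * D.toOp = c⁻¹ • (D.toOp * pauliOp z) := by
    rw [h, smul_smul, inv_mul_cancel₀ hc, one_smul]
  rw [CliffordCircuit.outputState, Matrix.mulVec_mulVec, h2, Matrix.smul_mulVec,
    ← Matrix.mulVec_mulVec, pauliOp_mulVec_zero hz]

/-- Off `T` the operator is diagonal, so it contributes only a nonzero scalar κ that depends on the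
outcome `x`; dividing by κ leaves an eigenvalue equation on `T`. -/
theorem pauliOp_mulVec_projectedState {Q : Type} [Fintype Q] [DecidableEq Q] {ψ : QVec Q}
    {g : PVec Q} (T : Finset Q) (hg : g ∈ zOff (T : Set Q)) {c : ℂ}
    (h : pauliOp g *ᵥ ψ = c • ψ) (x : {q // q ∉ T} → Bool) :
    ∃ d : ℂ, pauliOp (fun q : T => g q) *ᵥ projectedState ψ T x = d • projectedState ψ T x := by
  set κ : ℂ := ∏ q : {q // q ∉ T}, (g q).mat (x q) (x q) with hκ
  have hκ0 : κ ≠ 0 := Finset.prod_ne_zero_iff.2 fun q _ =>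
    PBit.mat_diag_ne_zero (hg q (by simpa using q.2)) _
  refine ⟨κ⁻¹ * c, ?_⟩
  funext y
  have h1 := congrFun h (mergeBits T x y)
  have h2 : (pauliOp g *ᵥ ψ) (mergeBits T x y) =
      κ * (pauliOp (fun q : T => g q) *ᵥ projectedState ψ T x) y := by
    rw [Matrix.mulVec, dotProduct, sum_eq_sum_mergeBits T x, Matrix.mulVec, dotProduct,
      Finset.mul_sum]
    · refine Finset.sum_congr rfl fun s _ => ?_
      simp only [pauliOp, tensorOp, Matrix.of_apply]
      rw [prod_eq_mul_prod_compl T]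
      simp only [mergeBits_of_mem, mergeBits_of_notMem]
      rw [← hκ]
      have : projectedState ψ T x s = ψ (mergeBits T x s) := rfl
      rw [this]
      ring
    · rintro z ⟨q, hq⟩
      simp only [pauliOp, tensorOp, Matrix.of_apply]
      rw [Finset.prod_eq_zero (Finset.mem_univ (q : Q)), zero_mul]
      refine PBit.mat_of_zType (hg q (by simpa using q.2)) ?_
      rwa [mergeBits_of_notMem]
  rw [h2] at h1
  have h3 : (c • projectedState ψ T x) y = (c • ψ) (mergeBits T x y) := rfl
  rw [mul_smul, Pi.smul_apply, h3, ← h1, smul_eq_mul, ← mul_assoc, inv_mul_cancel₀ hκ0, one_mul]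

end Circuit

end

noncomputable section

/-! ### Recognising GHZ-type states from their stabilizers -/

section GHZ

theorem pauliOp_unit_apply (g : PVec Unit) (a b : Bool) :
    pauliOp g (fun _ => a) (fun _ => b) = (g ()).mat a b := by
  simp [pauliOp, tensorOp]

theorem sum_unit_bits (f : (Unit → Bool) → ℂ) : ∑ x, f x = ∑ a : Bool, f fun _ => a :=
  Fintype.sum_equiv (Equiv.funUnique Unit Bool) _ _ fun x => by
    congr 1

theorem cliffordMatrix_mul (C D : cliffordGroup Unit) :
    cliffordMatrix (C * D) = cliffordMatrix C * cliffordMatrix D := by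
  ext a b
  simp only [cliffordMatrix, Matrix.of_apply, Matrix.mul_apply, Subgroup.coe_mul,
    Submonoid.coe_mul]
  exact sum_unit_bits _

theorem star_cliffordMatrix_mul_self (C : cliffordGroup Unit) :
    star (cliffordMatrix C) * cliffordMatrix C = 1 := by
  have h := Matrix.mem_unitaryGroup_iff'.1 (C : QUnitary Unit).2
  ext a b
  have h1 := congrFun (congrFun h fun _ => a) fun _ => b
  rw [Matrix.mul_apply, sum_unit_bits] at h1
  rw [Matrix.mul_apply]
  simp only [cliffordMatrix, Matrix.star_apply, Matrix.of_apply] at h1 ⊢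
  rw [h1, Matrix.one_apply, Matrix.one_apply]
  simp [funext_iff]

theorem cliffordMatrix_mul_mat (C : cliffordGroup Unit) (v : PBit) : ∃ c : ℂ, c ≠ 0 ∧
    cliffordMatrix C * v.mat = c • ((cliffAct C (fun _ => v) ()).mat * cliffordMatrix C) := by
  obtain ⟨c, hc, h⟩ := cliffAct_spec C fun _ => v
  refine ⟨c, hc, ?_⟩
  ext a b
  have h1 := congrFun (congrFun h fun _ => a) fun _ => b
  rw [Matrix.smul_apply, Matrix.mul_apply, sum_unit_bits, Matrix.mul_apply, sum_unit_bits] at h1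
  rw [Matrix.smul_apply, Matrix.mul_apply, Matrix.mul_apply]
  simpa only [pauliOp_unit_apply, cliffordMatrix, Matrix.of_apply] using h1

/-- Any anticommuting pair of one-qubit Pauli operators is moved to Z, X by two transvections,
possibly trivial; this is a finite check. -/
theorem exists_cliff_map_pair {p r : PBit} (h : sympAt p r = 1) :
    ∃ C : cliffordGroup Unit, cliffAct C (fun _ => p) () = (0, 1) ∧
      cliffAct C (fun _ => r) () = (1, 0) := by
  have key : ∀ p r : PBit, sympAt p r = 1 → ∃ a b : PBit,
      ((p + sympAt b p • b) + sympAt a (p + sympAt b p • b) • a = (0, 1)) ∧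
      ((r + sympAt b r • b) + sympAt a (r + sympAt b r • b) • a = (1, 0)) := by decide
  obtain ⟨a, b, h1, h2⟩ := key p r h
  have hs : ∀ g h : PVec Unit, symp g h = sympAt (g ()) (h ()) := fun g h => by simp [symp_apply]
  refine ⟨transvCliff (fun _ => a) * transvCliff (fun _ => b), ?_, ?_⟩
  · rw [cliffAct_mul, cliffAct_transvCliff, cliffAct_transvCliff, transv_apply, transv_apply, hs,
      hs, ← h1]
    rfl
  · rw [cliffAct_mul, cliffAct_transvCliff, cliffAct_transvCliff, transv_apply, transv_apply, hs,
      hs, ← h2]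
    rfl

variable {Q : Type} [Fintype Q] [DecidableEq Q]

theorem IsGHZType.of_mulVec (C : Q → cliffordGroup Unit) {Φ : QVec Q}
    (h : IsGHZType (tensorOp (fun q => cliffordMatrix (C q)) *ᵥ Φ)) : IsGHZType Φ := by
  obtain ⟨D, hD⟩ := h
  refine ⟨fun q => D q * C q, ?_⟩
  rw [← hD, Matrix.mulVec_mulVec, tensorOp_mul]
  simp only [cliffordMatrix_mul]

/-- A Pauli operator times a phase, as a one-qubit Clifford unitary. -/
theorem exists_cliff_eq_smul_mat (z : ℂ) (hz : star z * z = 1) (v : PBit) :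
    ∃ C : cliffordGroup Unit, cliffordMatrix C = z • v.mat := by
  let U : QUnitary Unit := ⟨z • pauliOp fun _ => v, by
    rw [Matrix.mem_unitaryGroup_iff', star_smul, smul_mul_smul_comm, star_pauliOp,
      pauliOp_mul_self, hz, one_smul]⟩
  have hU : U ∈ cliffordGroup Unit := by
    refine (mem_cliffordGroup_iff U).2 fun g => ?_
    have h := pauliOp_comm (fun _ => v) g
    have hs : ∃ k : ℕ, Complex.I ^ k = signOf (symp (fun _ => v) g) := by
      rcases zmod2_cases (symp (fun _ => v) g) with h | h <;> rw [h]
      · exact ⟨0, by simp [signOf]⟩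
      · exact ⟨2, by simp [signOf]⟩
    obtain ⟨k, hk⟩ := hs
    refine ⟨k, g, ?_⟩
    rw [hk]
    simp only [U]
    rw [smul_mul_assoc, h, mul_smul_comm, smul_comm]
  refine ⟨⟨U, hU⟩, ?_⟩
  ext a b
  simp only [cliffordMatrix, U, Matrix.of_apply, Matrix.smul_apply, pauliOp_unit_apply]

theorem IsGHZType.of_smul_pauliOp [Nonempty Q] (z : ℂ) (hz : star z * z = 1) (g : PVec Q)
    {Φ : QVec Q} (h : IsGHZType ((z • pauliOp g) *ᵥ Φ)) : IsGHZType Φ := by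
  obtain ⟨a⟩ := ‹Nonempty Q›
  have h1 : ∀ q, star (if q = a then z else 1) * (if q = a then z else 1) = 1 := by
    intro q
    by_cases hq : q = a <;> simp only [hq, if_true, if_false, hz, star_one, mul_one]
  choose C hC using fun q => exists_cliff_eq_smul_mat _ (h1 q) (g q)
  refine IsGHZType.of_mulVec C ?_
  simp only [hC]
  rw [tensorOp_smul]
  simpa [pauliOp] using h

theorem sum_norm_sq_mulVec {U : QOp Q} (hU : star U * U = 1) (Φ : QVec Q) :
    ∑ y, ‖(U *ᵥ Φ) y‖ ^ 2 = ∑ y, ‖Φ y‖ ^ 2 := by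
  have h : ∀ Ψ : QVec Q, ((∑ y, ‖Ψ y‖ ^ 2 : ℝ) : ℂ) = star Ψ ⬝ᵥ Ψ := by
    intro Ψ
    simp only [dotProduct, Complex.ofReal_sum, Pi.star_apply, Complex.ofReal_pow]
    exact Finset.sum_congr rfl fun y _ => (Complex.conj_mul' (Ψ y)).symm
  apply Complex.ofReal_injective
  rw [h, h, Matrix.star_mulVec, Matrix.dotProduct_mulVec, Matrix.vecMul_vecMul,
    ← Matrix.star_eq_conjTranspose, hU, Matrix.vecMul_one]

theorem star_pauliOp_mul_self (g : PVec Q) : star (pauliOp g) * pauliOp g = 1 := by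
  rw [star_pauliOp, pauliOp_mul_self]

/-- Normalization gives both amplitudes modulus 1/√2. A global phase and, if their ratio is -1, a Z
on a single qubit turn the state into the GHZ state. -/
theorem isGHZType_of_two_amplitudes [Nonempty Q] {Φ : QVec Q} (hnorm : ∑ y, ‖Φ y‖ ^ 2 = 1) {c : ℂ}
    (hc : c = 1 ∨ c = -1) (hsupp : ∀ y, Φ y ≠ 0 → y = (fun _ => false) ∨ y = fun _ => true)
    (htrue : Φ (fun _ => true) = c * Φ fun _ => false) : IsGHZType Φ := by
  have a : Q := Classical.arbitrary Q
  set α := Φ fun _ => false with hα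
  have hne : (fun _ : Q => false) ≠ fun _ => true := fun h => by simpa using congrFun h a
  have hcn : ‖c‖ = 1 := by rcases hc with rfl | rfl <;> simp
  have hα2 : 2 * ‖α‖ ^ 2 = 1 := by
    rw [← hnorm, Finset.sum_eq_add_of_mem _ _ (Finset.mem_univ _) (Finset.mem_univ _) hne, htrue,
      norm_mul, hcn, ← hα]
    · ring
    · intro y _ hy
      by_contra h
      have := hsupp y fun h0 => h (by simp [h0])
      tauto
  set s : ℝ := √2 with hs
  have hs2 : s * s = 2 := Real.mul_self_sqrt (by norm_num)
  have hs0 : s ≠ 0 := by positivity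
  have hαα : star α * α = ((1 / 2 : ℝ) : ℂ) := by
    rw [Complex.star_def, Complex.conj_mul', ← Complex.ofReal_pow]
    congr 1
    linarith
  -- The number √2 times the conjugate of α has modulus 1 and makes the amplitude of the all-zeros
  -- string equal to 1/√2.
  have hz : star ((s : ℂ) * star α) * ((s : ℂ) * star α) = 1 := by
    rw [star_mul', star_star, Complex.star_def, Complex.conj_ofReal]
    calc (s : ℂ) * α * (s * (starRingEnd ℂ) α) = ((s * s : ℝ) : ℂ) * (star α * α) := by
          rw [Complex.star_def]; push_cast; ring
      _ = 1 := by rw [hαα, hs2, ← Complex.ofReal_mul]; norm_num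
  have hzα : (s : ℂ) * star α * α = ((1 / s : ℝ) : ℂ) := by
    rw [mul_assoc, hαα, ← Complex.ofReal_mul]
    congr 1
    field_simp
    linarith
  set b : PBit := if c = 1 then 0 else (0, 1) with hb
  refine IsGHZType.of_smul_pauliOp _ hz (Pi.single a b) ⟨fun _ => 1, ?_⟩
  have hone : (cliffordMatrix 1 : Matrix Bool Bool ℂ) = 1 := by
    ext x y
    simp [cliffordMatrix, Matrix.one_apply, funext_iff]
  simp only [hone]
  rw [tensorOp_one, Matrix.one_mulVec]
  have hmul : ∀ y, (pauliOp (Pi.single a b) *ᵥ Φ) y = b.mat (y a) (y a) * Φ y := by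
    intro y
    rw [Matrix.mulVec, dotProduct, Finset.sum_eq_single y]
    · congr 1
      simp only [pauliOp, tensorOp, Matrix.of_apply]
      rw [Finset.prod_eq_single a]
      · simp
      · intro q _ hq
        simp [hq, show (0 : PBit) = (0, 0) from rfl, PBit.mat_I]
      · simp
    · intro x _ hx
      obtain ⟨q, hq⟩ := Function.ne_iff.1 hx
      simp only [pauliOp, tensorOp, Matrix.of_apply]
      rw [Finset.prod_eq_zero (Finset.mem_univ q), zero_mul]
      refine PBit.mat_of_zType ?_ hq.symm
      by_cases hqa : q = a
      · subst hqa
        rw [Pi.single_eq_same, hb]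
        split_ifs <;> simp
      · simp [hqa]
    · simp
  funext y
  rw [Matrix.smul_mulVec, Pi.smul_apply, hmul, smul_eq_mul, ghzState]
  by_cases hy0 : y = fun _ => false
  · subst hy0
    have hb0 : b.mat false false = 1 := PBit.mat_false_false (by rw [hb]; split_ifs <;> simp)
    rw [if_pos (Or.inl fun _ => rfl), hb0, one_mul, ← hα, hzα]
  · by_cases hy1 : y = fun _ => true
    · subst hy1
      have hb1 : b.mat true true * c = 1 := by
        rcases hc with rfl | rfl
        · simp [hb, show (0 : PBit) = (0, 0) from rfl, PBit.mat_I]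
        · rw [hb, if_neg (by norm_num)]
          simp [PBit.mat_Z]
      rw [if_pos (Or.inr fun _ => rfl), htrue, ← mul_assoc (b.mat true true), hb1, one_mul, hzα]
    · have : Φ y = 0 := by
        by_contra h
        exact (hsupp y h).elim hy0 hy1
      rw [this, mul_zero, mul_zero, if_neg]
      simp only [not_or, not_forall]
      exact ⟨by obtain ⟨q, hq⟩ := Function.ne_iff.1 hy0; exact ⟨q, hq⟩,
        by obtain ⟨q, hq⟩ := Function.ne_iff.1 hy1; exact ⟨q, hq⟩⟩

theorem pauliOp_X_mulVec (x : Q → Bool) (Φ : QVec Q) (y : Q → Bool) :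
    (pauliOp (fun q => if x q then (1, 0) else (0, 0)) *ᵥ Φ) y = Φ fun q => xor (y q) (x q) := by
  rw [Matrix.mulVec, dotProduct, Finset.sum_eq_single fun q => xor (y q) (x q)]
  · simp only [pauliOp, tensorOp, Matrix.of_apply]
    rw [Finset.prod_eq_one, one_mul]
    intro q _
    cases x q <;> cases y q <;> simp [PBit.mat_I, PBit.mat_X]
  · intro z _ hz
    obtain ⟨q, hq⟩ := Function.ne_iff.1 hz
    simp only [pauliOp, tensorOp, Matrix.of_apply]
    rw [Finset.prod_eq_zero (Finset.mem_univ q), zero_mul]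
    revert hq
    cases x q <;> cases y q <;> cases z q <;> simp [PBit.mat_I, PBit.mat_X]
  · simp

theorem pauliOp_ZZ_mulVec {a b : Q} (hab : a ≠ b) (Φ : QVec Q) (y : Q → Bool) :
    (pauliOp (Pi.single a (0, 1) + Pi.single b (0, 1)) *ᵥ Φ) y =
      (if y a = y b then 1 else -1) * Φ y := by
  have hval : ∀ q, (Pi.single a (0, 1) + Pi.single b (0, 1) : PVec Q) q =
      if q = a ∨ q = b then (0, 1) else (0, 0) := by
    intro q
    by_cases h1 : q = a
    · subst h1; simp [hab]
    · by_cases h2 : q = b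
      · subst h2; simp [hab.symm]
      · simp only [Pi.add_apply, Pi.single_apply, h1, h2, if_false, or_self]
        rfl
  rw [Matrix.mulVec, dotProduct, Finset.sum_eq_single y]
  · congr 1
    simp only [pauliOp, tensorOp, Matrix.of_apply, hval]
    rw [Finset.prod_eq_mul a b hab]
    · simp only [true_or, or_true, if_true, PBit.mat_Z, Matrix.of_apply]
      cases y a <;> cases y b <;> simp
    · intro q _ hq
      simp [hq.1, hq.2, PBit.mat_I]
    · simp
    · simp
  · intro x _ hx
    obtain ⟨q, hq⟩ := Function.ne_iff.1 hx
    simp only [pauliOp, tensorOp, Matrix.of_apply, hval]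
    rw [Finset.prod_eq_zero (Finset.mem_univ q), zero_mul]
    refine PBit.mat_of_zType ?_ hq.symm
    split_ifs <;> rfl
  · simp

/-- The ZZ eigenvalues fix all parities between pairs of bits, so the support lies in {x, complement
of x}. The X-string swaps these two, so the amplitudes agree up to a sign. Flipping the bits of x
reduces to support on the two constant strings. -/
theorem isGHZType_of_standard_stabilizers [Nonempty Q] {Φ : QVec Q} (hnorm : ∑ y, ‖Φ y‖ ^ 2 = 1)
    (hZ : ∀ a b : Q, a ≠ b → ∃ c : ℂ,
      pauliOp (Pi.single a (0, 1) + Pi.single b (0, 1)) *ᵥ Φ = c • Φ)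
    (hX : ∃ c : ℂ, pauliOp (fun _ : Q => (1, 0)) *ᵥ Φ = c • Φ) : IsGHZType Φ := by
  obtain ⟨x, hx⟩ : ∃ x, Φ x ≠ 0 := by
    by_contra! h
    simp [h] at hnorm
  have hsupp : ∀ y, Φ y ≠ 0 → ∀ a b, (y a = y b ↔ x a = x b) := by
    intro y hy a b
    by_cases hab : a = b
    · simp [hab]
    obtain ⟨c, hc⟩ := hZ a b hab
    have h1 := congrFun hc x
    have h2 := congrFun hc y
    rw [pauliOp_ZZ_mulVec hab, Pi.smul_apply, smul_eq_mul] at h1 h2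
    have h3 := (mul_right_cancel₀ hx h1).trans (mul_right_cancel₀ hy h2).symm
    by_cases h4 : x a = x b <;> by_cases h5 : y a = y b
    · simp [h4, h5]
    · norm_num [h4, h5] at h3
    · norm_num [h4, h5] at h3
    · simp [h4, h5]
  obtain ⟨c, hc⟩ := hX
  have hflip : ∀ y, Φ (fun q => !y q) = c * Φ y := by
    intro y
    have := pauliOp_X_mulVec (fun _ => true) Φ y
    simp only [if_true, Bool.xor_true] at this
    rw [← this, hc, Pi.smul_apply, smul_eq_mul]
  have hc2 : c = 1 ∨ c = -1 := by
    have := hflip fun q => !x q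
    simp only [Bool.not_not] at this
    rw [hflip, ← mul_assoc] at this
    have h1 : c * c = 1 := by
      apply mul_right_cancel₀ hx
      rw [← this, one_mul]
    exact mul_self_eq_one_iff.1 h1
  refine IsGHZType.of_smul_pauliOp 1 (by simp) (fun q => if x q then (1, 0) else (0, 0)) ?_
  rw [one_smul]
  refine isGHZType_of_two_amplitudes ?_ hc2 ?_ ?_
  · rw [sum_norm_sq_mulVec (star_pauliOp_mul_self _), hnorm]
  · intro y hy
    rw [pauliOp_X_mulVec] at hy
    have h := hsupp _ hy
    have a : Q := Classical.arbitrary Q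
    cases hya : y a
    · left
      funext q
      have := h q a
      rw [hya] at this
      revert this
      cases x q <;> cases x a <;> cases y q <;> simp
    · right
      funext q
      have := h q a
      rw [hya] at this
      revert this
      cases x q <;> cases x a <;> cases y q <;> simp
  · rw [pauliOp_X_mulVec, pauliOp_X_mulVec]
    simp only [Bool.true_xor, Bool.false_xor]
    exact hflip x

/-- A normalized state whose stabilizer group contains the generators of a GHZ state, up to local
Clifford unitaries and phases, is of GHZ type. -/
theorem isGHZType_of_stabilizers [Nonempty Q] {Φ : QVec Q} (hnorm : ∑ y, ‖Φ y‖ ^ 2 = 1)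
    (p r : PVec Q) (hpr : ∀ q, sympAt (p q) (r q) = 1)
    (hp : ∀ a b : Q, a ≠ b → ∃ c : ℂ,
      pauliOp (Pi.single a (p a) + Pi.single b (p b)) *ᵥ Φ = c • Φ)
    (hr : ∃ c : ℂ, pauliOp r *ᵥ Φ = c • Φ) : IsGHZType Φ := by
  choose C hCp hCr using fun q => exists_cliff_map_pair (hpr q)
  refine IsGHZType.of_mulVec C ?_
  set U : QOp Q := tensorOp fun q => cliffordMatrix (C q) with hU
  have hUU : star U * U = 1 := by
    rw [hU, tensorOp_star, tensorOp_mul]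
    simp only [star_cliffordMatrix_mul_self, tensorOp_one]
  have key : ∀ g : PVec Q, (∃ c : ℂ, pauliOp g *ᵥ Φ = c • Φ) → ∃ c : ℂ,
      pauliOp (fun q => cliffAct (C q) (fun _ => g q) ()) *ᵥ (U *ᵥ Φ) = c • (U *ᵥ Φ) := by
    rintro g ⟨c, hc⟩
    choose d hd0 hd using fun q => cliffordMatrix_mul_mat (C q) (g q)
    have h1 : U * pauliOp g =
        (∏ q, d q) • (pauliOp (fun q => cliffAct (C q) (fun _ => g q) ()) * U) := by
      simp only [hU, pauliOp, tensorOp_mul, hd, tensorOp_smul]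
    have h0 : (∏ q, d q) ≠ 0 := Finset.prod_ne_zero_iff.2 fun q _ => hd0 q
    refine ⟨(∏ q, d q)⁻¹ * c, ?_⟩
    have h2 : pauliOp (fun q => cliffAct (C q) (fun _ => g q) ()) * U =
        (∏ q, d q)⁻¹ • (U * pauliOp g) := by
      rw [h1, smul_smul, inv_mul_cancel₀ h0, one_smul]
    rw [Matrix.mulVec_mulVec, h2, Matrix.smul_mulVec, ← Matrix.mulVec_mulVec, hc,
      Matrix.mulVec_smul, smul_smul]
  have hzero : ∀ q, cliffAct (C q) (fun _ => 0) () = 0 := fun q => by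
    have : (fun _ : Unit => (0 : PBit)) = 0 := rfl
    rw [this, map_zero]; rfl
  refine isGHZType_of_standard_stabilizers ?_ ?_ ?_
  · rw [sum_norm_sq_mulVec hUU, hnorm]
  · intro a b hab
    have h := key _ (hp a b hab)
    have h1 : (fun q => cliffAct (C q)
        (fun _ => (Pi.single a (p a) + Pi.single b (p b) : PVec Q) q) ()) =
        (Pi.single a (0, 1) + Pi.single b (0, 1) : PVec Q) := by
      funext q
      by_cases h1 : q = a
      · subst h1; simp [hab, hCp]
      · by_cases h2 : q = b
        · subst h2; simp [hab.symm, hCp]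
        · simp [h1, h2, hzero]
    rwa [h1] at h
  · have h := key _ hr
    simpa only [hCr] using h

end GHZ

end

noncomputable section

/-! ### Stabilizer groups on three qubits -/

section ThreeQubits

theorem symp_fin_three (g h : PVec (Fin 3)) :
    symp g h = sympAt (g 0) (h 0) + sympAt (g 1) (h 1) + sympAt (g 2) (h 2) := by
  rw [symp_apply, Fin.sum_univ_three]

theorem symp_transv {Q : Type} [Fintype Q] [DecidableEq Q] (x g h : PVec Q) :
    symp (transv x g) (transv x h) = symp g h := by
  simp only [transv_apply, map_add, LinearMap.add_apply, map_smul, LinearMap.smul_apply, symp_self,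
    symp_comm g x, smul_eq_mul]
  generalize symp x g = a, symp x h = b, symp g h = c
  revert a b c
  decide

/-- A Lagrangian subspace has dimension 3, while one coordinate takes values in a space of dimension
2. -/
theorem IsLagrangian.exists_coord_eq_zero {L : Submodule (ZMod 2) (PVec (Fin 3))}
    (hL : IsLagrangian L) (c : Fin 3) : ∃ l ∈ L, l ≠ 0 ∧ l c = 0 := by
  have h1 : symp.orthogonal L = L := by
    ext g
    rw [LinearMap.BilinForm.mem_orthogonal_iff]
    exact (hL g).symm
  have h2 := LinearMap.BilinForm.finrank_orthogonal (symp_nondegenerate (Q := Fin 3)) L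
  rw [h1, Module.finrank_pi_fintype] at h2
  simp only [Module.finrank_prod, Module.finrank_self, Fin.sum_univ_three] at h2
  let f : L →ₗ[ZMod 2] PBit := (LinearMap.proj c).comp L.subtype
  have h3 : LinearMap.ker f ≠ ⊥ := by
    apply LinearMap.ker_ne_bot_of_finrank_lt
    rw [Module.finrank_prod, Module.finrank_self]
    omega
  obtain ⟨l, hl, hl0⟩ := Submodule.exists_mem_ne_zero_of_ne_bot h3
  exact ⟨l, l.2, fun h => hl0 (Subtype.ext h), hl⟩

theorem PBit.eq_of_sympAt_eq_zero {v w : PBit} (hv : v ≠ 0) (hw : w ≠ 0) (h : sympAt v w = 0) :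
    v = w := by
  revert v w; decide

/-- The idea is to spread a one-qubit operator over both qubits: if `w = 0`, take `a` anticommuting
with `v` and any `b ≠ 0`. If both are already nonzero, `a = b = 0` works. -/
theorem exists_transv_both_ne_zero {v w : PBit} (h : v ≠ 0 ∨ w ≠ 0) : ∃ a b : PBit,
    v + (sympAt a v + sympAt b w) • a ≠ 0 ∧ w + (sympAt a v + sympAt b w) • b ≠ 0 := by
  revert v w; decide

/-- A three-qubit stabilizer group in which the third qubit is not in a pure state. If moreover
qubits one and two have a joint stabilizer element without trivial factor, then the group
contains the generators of a GHZ state. -/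
theorem IsLagrangian.exists_ghz_generators {L : Submodule (ZMod 2) (PVec (Fin 3))}
    (hL : IsLagrangian L) (h2 : ∀ l ∈ L, l 0 = 0 → l 1 = 0 → l 2 = 0)
    {v : PVec (Fin 3)} (hv : v ∈ L) (hv0 : v 0 ≠ 0) (hv1 : v 1 ≠ 0) (hv2 : v 2 = 0) :
    ∃ p r : PVec (Fin 3), (∀ c, sympAt (p c) (r c) = 1) ∧ r ∈ L ∧
      ∀ a b, a ≠ b → Pi.single a (p a) + Pi.single b (p b) ∈ L := by
  have hcomm : ∀ l ∈ L, ∀ l' ∈ L, symp l l' = 0 := fun l hl l' hl' => (hL l').1 hl' l hl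
  have hvl : ∀ l ∈ L, sympAt (v 0) (l 0) + sympAt (v 1) (l 1) = 0 := by
    intro l hl
    have := hcomm v hv l hl
    rwa [symp_fin_three, hv2, sympAt_zero_left, add_zero] at this
  -- If both factors of `v` were in `L`, commutation would make every element, modulo these two, an
  -- operator on the third qubit alone, hence trivial there. Then X on the third qubit would commute
  -- with `L` and so belong to `L`, a contradiction.
  have hboth : Pi.single 0 (v 0) ∈ L → Pi.single 1 (v 1) ∈ L → False := by
    intro h0 h1
    have hz : ∀ l ∈ L, l 2 = 0 := by
      intro l hl
      have e0 := hcomm _ h0 l hl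
      have e1 := hcomm _ h1 l hl
      rw [symp_single] at e0 e1
      have c0 : l 0 = 0 ∨ l 0 = v 0 := by
        by_cases h : l 0 = 0
        · exact Or.inl h
        · exact Or.inr (PBit.eq_of_sympAt_eq_zero hv0 h e0).symm
      have c1 : l 1 = 0 ∨ l 1 = v 1 := by
        by_cases h : l 1 = 0
        · exact Or.inl h
        · exact Or.inr (PBit.eq_of_sympAt_eq_zero hv1 h e1).symm
      rcases c0 with c0 | c0 <;> rcases c1 with c1 | c1
      · exact h2 l hl c0 c1
      · simpa using h2 _ (L.sub_mem hl h1) (by simp [c0]) (by simp [c1])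
      · simpa using h2 _ (L.sub_mem hl h0) (by simp [c0]) (by simp [c1])
      · simpa using h2 _ (L.sub_mem (L.sub_mem hl h0) h1) (by simp [c0]) (by simp [c1])
    have hx : (Pi.single 2 (1, 0) : PVec (Fin 3)) ∈ L := (hL _).2 fun l hl => by
      rw [symp_comm, symp_single, hz l hl, sympAt_zero_right]
    simpa using hz _ hx
  have hsum : v = Pi.single 0 (v 0) + Pi.single 1 (v 1) := by
    funext c
    fin_cases c <;> simp [hv2]
  have hn0 : ∀ x, x ≠ 0 → Pi.single 0 x ∉ L := by
    intro x hx hxL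
    have h := hvl _ hxL
    simp only [Pi.single_eq_same, ne_eq, one_ne_zero, not_false_eq_true, Pi.single_eq_of_ne,
      sympAt_zero_right, add_zero] at h
    rw [← PBit.eq_of_sympAt_eq_zero hv0 hx h] at hxL
    refine hboth hxL ?_
    rw [show (Pi.single 1 (v 1) : PVec (Fin 3)) = v - Pi.single 0 (v 0) from
      eq_sub_of_add_eq' hsum.symm]
    exact L.sub_mem hv hxL
  have hn1 : ∀ x, x ≠ 0 → Pi.single 1 x ∉ L := by
    intro x hx hxL
    have h := hvl _ hxL
    simp only [Pi.single_eq_same, ne_eq, zero_ne_one, not_false_eq_true, Pi.single_eq_of_ne,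
      sympAt_zero_right, zero_add] at h
    rw [← PBit.eq_of_sympAt_eq_zero hv1 hx h] at hxL
    refine hboth ?_ hxL
    rw [show (Pi.single 0 (v 0) : PVec (Fin 3)) = v - Pi.single 1 (v 1) from
      eq_sub_of_add_eq hsum.symm]
    exact L.sub_mem hv hxL
  -- This `w` is the second ZZ-type generator, acting on the last two qubits. Having excluded
  -- elements of weight one, both of its factors are nontrivial, and commutation with `v` forces the
  -- middle ones to agree.
  obtain ⟨w, hw, hwne, hw0⟩ := hL.exists_coord_eq_zero 0
  have hw1 : w 1 ≠ 0 := by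
    intro h
    have h22 := h2 w hw hw0 h
    exact hwne (by funext c; fin_cases c <;> simp [hw0, h, h22])
  have hw2 : w 2 ≠ 0 := by
    intro h
    refine hn1 _ hw1 ?_
    convert hw using 1
    funext c; fin_cases c <;> simp [hw0, h]
  have hw1v : v 1 = w 1 := by
    have h := hvl w hw
    rw [hw0, sympAt_zero_right, zero_add] at h
    exact PBit.eq_of_sympAt_eq_zero hv1 hw1 h
  -- This `r` is the XXX-type generator. If it did not exist, `Pi.single 0 (v 0)` would commute with
  -- `L` and hence lie in it.
  obtain ⟨r, hr, hr0⟩ : ∃ r ∈ L, sympAt (v 0) (r 0) = 1 := by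
    by_contra! h
    refine hn0 _ hv0 ((hL _).2 fun l hl => ?_)
    rw [symp_comm, symp_single]
    exact (zmod2_cases _).resolve_right (h l hl)
  have hadd : ∀ x y : ZMod 2, x = 1 → x + y = 0 → y = 1 := by decide
  have hr1 : sympAt (v 1) (r 1) = 1 := hadd _ _ hr0 (hvl r hr)
  have hr2 : sympAt (w 2) (r 2) = 1 := by
    have h := hcomm w hw r hr
    rw [symp_fin_three, hw0, sympAt_zero_left, zero_add, ← hw1v] at h
    exact hadd _ _ hr1 h
  have hwsum : w = Pi.single 1 (v 1) + Pi.single 2 (w 2) := by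
    funext c
    fin_cases c <;> simp [hw0, hw1v]
  have h01 : Pi.single 0 (v 0) + Pi.single 1 (v 1) ∈ L := hsum ▸ hv
  have h12 : Pi.single 1 (v 1) + Pi.single 2 (w 2) ∈ L := hwsum ▸ hw
  have h02 : Pi.single 0 (v 0) + Pi.single 2 (w 2) ∈ L := by
    convert L.add_mem h01 h12 using 1
    have := pvec_add_self (Pi.single 1 (v 1) : PVec (Fin 3))
    rw [add_assoc, ← add_assoc (Pi.single 1 (v 1) : PVec (Fin 3)), this, zero_add]
  refine ⟨![v 0, v 1, w 2], r, ?_, hr, ?_⟩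
  · intro c
    fin_cases c
    exacts [hr0, hr1, hr2]
  · intro a b hab
    fin_cases a <;> fin_cases b <;> first | exact absurd rfl hab | skip
    · exact h01
    · exact h02
    · exact add_comm (Pi.single (0 : Fin 3) (v 0) : PVec (Fin 3)) _ ▸ h01
    · exact h12
    · exact add_comm (Pi.single (0 : Fin 3) (v 0) : PVec (Fin 3)) _ ▸ h02
    · exact add_comm (Pi.single (1 : Fin 3) (v 1) : PVec (Fin 3)) _ ▸ h12

/-- If the third qubit is not in a pure state, then some two-qubit transvection on the first two
qubits makes the stabilizer group contain the generators of a GHZ state. -/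
theorem IsLagrangian.exists_transv_ghz_generators {L : Submodule (ZMod 2) (PVec (Fin 3))}
    (hL : IsLagrangian L) (h2 : ∀ l ∈ L, l 0 = 0 → l 1 = 0 → l 2 = 0) :
    ∃ x y : PBit, ∃ p r : PVec (Fin 3), (∀ c, sympAt (p c) (r c) = 1) ∧
      r ∈ L.map (transv ![x, y, 0]) ∧
      ∀ a b, a ≠ b → Pi.single a (p a) + Pi.single b (p b) ∈ L.map (transv ![x, y, 0]) := by
  obtain ⟨v, hv, hvne, hv2⟩ := hL.exists_coord_eq_zero 2
  have hv01 : v 0 ≠ 0 ∨ v 1 ≠ 0 := by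
    by_contra! h
    exact hvne (by funext c; fin_cases c <;> simp [hv2, h.1, h.2])
  obtain ⟨x, y, hx, hy⟩ := exists_transv_both_ne_zero hv01
  have hval : ∀ g : PVec (Fin 3), symp ![x, y, 0] g = sympAt x (g 0) + sympAt y (g 1) := by
    intro g
    rw [symp_fin_three]
    simp [sympAt_zero_left]
  refine ⟨x, y, (hL.map _ (symp_transv _)).exists_ghz_generators ?_ ⟨v, hv, rfl⟩ ?_ ?_ ?_⟩
  · rintro _ ⟨l, hl, rfl⟩ h0 h1
    rw [transv_apply, hval, Pi.add_apply] at h0 h1 ⊢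
    simp only [Pi.smul_apply, Matrix.cons_val_zero, Matrix.cons_val_one, Matrix.cons_val,
      smul_zero, add_zero] at h0 h1 ⊢
    -- The transvection vector vanishes at the third qubit, so the transvection acts injectively on
    -- the first two coordinates and fixes the third. The purity condition therefore carries over to
    -- the new group.
    have key : ∀ x y a b : PBit, a + (sympAt x a + sympAt y b) • x = 0 →
        b + (sympAt x a + sympAt y b) • y = 0 → a = 0 ∧ b = 0 := by
      intro x y a b
      rcases zmod2_cases (sympAt x a + sympAt y b) with h | h
      · rw [h, zero_smul, zero_smul, add_zero, add_zero]
        exact And.intro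
      · intro ha hb
        have hx : ∀ a x : PBit, a + (1 : ZMod 2) • x = 0 → a = x := by decide
        rw [h] at ha hb
        rw [hx _ _ ha, hx _ _ hb, sympAt_self, sympAt_self, add_zero] at h
        exact absurd h zero_ne_one
    obtain ⟨ha, hb⟩ := key _ _ _ _ h0 h1
    exact h2 l hl ha hb
  · rw [transv_apply, hval]; simpa using hx
  · rw [transv_apply, hval]; simpa using hy
  · rw [transv_apply]; simp [hv2]

end ThreeQubits

/-! ### From the measured stabilizer group to GHZ-type entanglement -/

section Measurement

variable {Q : Type} [Fintype Q]

/-- The stabilizer group, up to phases, of three qubits after all others have been measured. -/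
def measured (M : Submodule (ZMod 2) (PVec Q)) (t : Fin 3 → Q) :
    Submodule (ZMod 2) (PVec (Fin 3)) :=
  (M ⊓ zOff (Set.range t)).map (LinearMap.funLeft (ZMod 2) PBit t)

theorem mem_measured {M : Submodule (ZMod 2) (PVec Q)} {t : Fin 3 → Q} {l : PVec (Fin 3)} :
    l ∈ measured M t ↔ ∃ g ∈ M, g ∈ zOff (Set.range t) ∧ ∀ c, g (t c) = l c := by
  constructor
  · rintro ⟨g, hg, rfl⟩
    exact ⟨g, hg.1, hg.2, fun c => rfl⟩
  · rintro ⟨g, hg, hg', h⟩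
    exact ⟨g, ⟨hg, hg'⟩, funext h⟩

theorem symp_eq_of_zOff {t : Fin 3 → Q} (ht : Function.Injective t) {g h : PVec Q}
    (hg : g ∈ zOff (Set.range t)) (hh : h ∈ zOff (Set.range t)) :
    symp g h = symp (fun c => g (t c)) fun c => h (t c) := by
  rw [symp_apply, symp_apply]
  symm
  refine Fintype.sum_of_injective t ht _ _ ?_ fun _ => rfl
  intro q hq
  simp [sympAt, hg q hq, hh q hq]

/-- Isotropy holds because Z-type parts off the triple commute. Maximality is
`IsLagrangian.exists_extension` applied to `l` extended by the identity. -/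
theorem IsLagrangian.measured [DecidableEq Q] {M : Submodule (ZMod 2) (PVec Q)}
    (hM : IsLagrangian M) {t : Fin 3 → Q} (ht : Function.Injective t) :
    IsLagrangian (measured M t) := by
  intro l
  constructor
  · intro hl l' hl'
    obtain ⟨g, hg, hgz, h1⟩ := mem_measured.1 hl
    obtain ⟨g', hg', hgz', h1'⟩ := mem_measured.1 hl'
    rw [← (hM g).1 hg g' hg', symp_eq_of_zOff ht hgz' hgz]
    simp only [h1, h1']
  · intro H
    let u : PVec Q := fun q => ∑ c, if t c = q then l c else 0
    have hut : ∀ c, u (t c) = l c := by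
      intro c
      simp only [u, ht.eq_iff]
      simp
    have hu0 : u ∈ zOff (Set.range t) := by
      intro q hq
      have : u q = 0 := Finset.sum_eq_zero fun c _ => if_neg fun h => hq ⟨c, h⟩
      rw [this]; rfl
    obtain ⟨m, hm, h1, h2⟩ := hM.exists_extension (Set.range t) u fun g hg hgz => by
      rw [symp_eq_of_zOff ht hgz hu0]
      simp only [hut]
      exact H _ (mem_measured.2 ⟨g, hg, hgz, fun _ => rfl⟩)
    refine mem_measured.2 ⟨m, hm, fun q hq => ?_, fun c => ?_⟩
    · rw [h2 q hq, hu0 q hq]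
    · rw [h1 _ ⟨c, rfl⟩, hut]

/-- Measured stabilizers have the postmeasurement state as an eigenvector for every outcome; only
the eigenvalues depend on the outcome, and the GHZ criterion ignores them. -/
theorem hasGHZTypeMIE_of_measured [DecidableEq Q] {ψ : QVec Q} {M : Submodule (ZMod 2) (PVec Q)}
    (hM : ∀ g ∈ M, ∃ c : ℂ, pauliOp g *ᵥ ψ = c • ψ) {t : Fin 3 → Q}
    {T : Finset Q} (hT : (T : Set Q) = Set.range t)
    (p r : PVec (Fin 3)) (hpr : ∀ c, sympAt (p c) (r c) = 1) (hr : r ∈ measured M t)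
    (hp : ∀ a b, a ≠ b → Pi.single a (p a) + Pi.single b (p b) ∈ measured M t) :
    HasGHZTypeMIE ψ T := by
  intro x hx
  have hmem : ∀ q : T, ∃ c, t c = q := fun q => by
    have : (q : Q) ∈ (T : Set Q) := q.2
    rwa [hT] at this
  choose e he using hmem
  have heinj : Function.Injective e := fun a b h => Subtype.ext (by rw [← he a, h, he b])
  have hstab : ∀ l ∈ measured M t, ∃ d : ℂ, pauliOp (fun q : T => l (e q)) *ᵥ
      postMeasurementState ψ T x = d • postMeasurementState ψ T x := by
    intro l hl
    obtain ⟨g, hg, hgz, h1⟩ := mem_measured.1 hl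
    obtain ⟨c, hc⟩ := hM g hg
    obtain ⟨d, hd⟩ := pauliOp_mulVec_projectedState T (by rwa [hT]) hc x
    refine ⟨d, ?_⟩
    have h2 : (fun q : T => l (e q)) = fun q : T => g q := by
      funext q
      rw [← h1, he]
    rw [h2, postMeasurementState, Matrix.mulVec_smul, hd, smul_comm]
  have hne : Nonempty T := ⟨⟨t 0, by
    have : t 0 ∈ (T : Set Q) := by rw [hT]; exact ⟨0, rfl⟩
    exact this⟩⟩
  refine isGHZType_of_stabilizers ?_ (fun q => p (e q)) (fun q => r (e q)) (fun q => hpr _) ?_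
    (hstab r hr)
  · have h0 : 0 ≤ outcomeProb ψ T x := Finset.sum_nonneg fun y _ => by positivity
    have hs : ∀ y, ‖postMeasurementState ψ T x y‖ ^ 2 =
        (outcomeProb ψ T x)⁻¹ * ‖projectedState ψ T x y‖ ^ 2 := by
      intro y
      rw [postMeasurementState, Pi.smul_apply, smul_eq_mul, norm_mul, mul_pow, Complex.norm_real,
        Real.norm_eq_abs, sq_abs, div_pow, Real.sq_sqrt h0, one_pow, one_div]
    rw [Finset.sum_congr rfl fun y _ => hs y, ← Finset.mul_sum]
    exact inv_mul_cancel₀ hx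
  · intro a b hab
    beta_reduce
    have hab' : e a ≠ e b := heinj.ne hab
    convert hstab _ (hp _ _ hab') using 6
    rename_i q
    simp only [Pi.add_apply, Pi.single_apply, heinj.eq_iff]

end Measurement

end

noncomputable section

/-! ### Counting gates with a prescribed action -/

section GateCount

variable {Q : Type} [Fintype Q] [DecidableEq Q]

instance : Fintype (CliffordGate Q) := Fintype.ofFinite _

/-- The image of `v` is nonzero, and all nonzero images have equally large fibres. -/
theorem card_gateAct_eq_mul {v w : PVec Q} (hv : v ≠ 0) (hw : w ≠ 0) :
    (Finset.univ.filter fun γ : CliffordGate Q => gateAct γ v = w).card *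
      (4 ^ Fintype.card Q - 1) = Fintype.card (CliffordGate Q) := by
  have h1 : ∀ u ∈ Finset.univ.erase (0 : PVec Q),
      (Finset.univ.filter fun γ : CliffordGate Q => gateAct γ v = u).card =
      (Finset.univ.filter fun γ : CliffordGate Q => gateAct γ v = w).card := by
    intro u hu
    have := card_gate_eq (v := v) (Finset.ne_of_mem_erase hu) hw
    rwa [Nat.card_eq_fintype_card, Nat.card_eq_fintype_card, Fintype.card_subtype,
      Fintype.card_subtype] at this
  have h2 : Fintype.card (CliffordGate Q) = ∑ u ∈ Finset.univ.erase (0 : PVec Q),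
      (Finset.univ.filter fun γ : CliffordGate Q => gateAct γ v = u).card := by
    rw [← Finset.card_univ]
    refine Finset.card_eq_sum_card_fiberwise fun γ _ => ?_
    simp only [Finset.coe_erase, Finset.coe_univ, Set.mem_sdiff, Set.mem_univ, true_and,
      Set.mem_singleton_iff]
    rw [map_eq_zero_iff _ (gateAct_injective γ)]
    exact hv
  rw [h2, Finset.sum_congr rfl h1, Finset.sum_const, smul_eq_mul, mul_comm,
    Finset.card_erase_of_mem (Finset.mem_univ _), Finset.card_univ]
  congr 2
  simp

/-- A union bound gives the fraction (|B| - 1)/(4^q - 1). Adding the trivial bound `X.card ≤`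
(number of gates) replaces this by the product-form bound |B|/4^q, which factors over qubits when
`B` is a box. -/
theorem card_mul_le_of_forall_exists {B : Finset (PVec Q)} (hB : 0 ∈ B)
    (X : Finset (CliffordGate Q)) (Y : PVec Q → Finset (CliffordGate Q))
    (hX : ∀ γ ∈ X, ∃ w ∈ B.erase 0, γ ∈ Y w)
    (hY : ∀ w ∈ B.erase 0, (Y w).card * (4 ^ Fintype.card Q - 1) = Fintype.card (CliffordGate Q)) :
    X.card * 4 ^ Fintype.card Q ≤ B.card * Fintype.card (CliffordGate Q) := by
  classical
  have hX' : X ⊆ (B.erase 0).biUnion Y := fun γ hγ => Finset.mem_biUnion.2 (hX γ hγ)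
  have h1 : X.card * (4 ^ Fintype.card Q - 1) ≤ (B.card - 1) * Fintype.card (CliffordGate Q) := by
    calc X.card * (4 ^ Fintype.card Q - 1)
        ≤ (∑ w ∈ B.erase 0, (Y w).card) * (4 ^ Fintype.card Q - 1) :=
          Nat.mul_le_mul_right _ ((Finset.card_le_card hX').trans Finset.card_biUnion_le)
      _ = (B.card - 1) * Fintype.card (CliffordGate Q) := by
          rw [Finset.sum_mul, Finset.sum_congr rfl hY, Finset.sum_const,
            Finset.card_erase_of_mem hB, smul_eq_mul]
  have h2 : X.card ≤ Fintype.card (CliffordGate Q) := Finset.card_le_univ _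
  have h3 : 4 ^ Fintype.card Q = (4 ^ Fintype.card Q - 1) + 1 :=
    (Nat.succ_pred_eq_of_pos (by positivity)).symm
  have h4 : B.card = (B.card - 1) + 1 :=
    (Nat.succ_pred_eq_of_pos (Finset.card_pos.2 ⟨0, hB⟩)).symm
  rw [h3, h4, mul_add, add_mul]
  simpa using add_le_add h1 h2

theorem card_gateAct_mem_le {B : Finset (PVec Q)} (hB : 0 ∈ B) {v : PVec Q} (hv : v ≠ 0) :
    (Finset.univ.filter fun γ : CliffordGate Q => gateAct γ v ∈ B).card * 4 ^ Fintype.card Q ≤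
      B.card * Fintype.card (CliffordGate Q) := by
  refine card_mul_le_of_forall_exists hB _
    (fun w => Finset.univ.filter fun γ : CliffordGate Q => gateAct γ v = w) ?_ ?_
  · intro γ hγ
    rw [Finset.mem_filter] at hγ
    refine ⟨_, Finset.mem_erase.2 ⟨?_, hγ.2⟩, by simp⟩
    rw [ne_eq, map_eq_zero_iff _ (gateAct_injective γ)]
    exact hv
  · intro w hw
    exact card_gateAct_eq_mul hv (Finset.ne_of_mem_erase hw)

/-- This is the backward count, used for the first layer: there the output is given and the input is
only known to be of Z-type. -/
theorem card_exists_gateAct_le {B : Finset (PVec Q)} (hB : 0 ∈ B) {v : PVec Q} (hv : v ≠ 0) :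
    (Finset.univ.filter fun γ : CliffordGate Q => ∃ z ∈ B, gateAct γ z = v).card *
      4 ^ Fintype.card Q ≤ B.card * Fintype.card (CliffordGate Q) := by
  refine card_mul_le_of_forall_exists hB _
    (fun z => Finset.univ.filter fun γ : CliffordGate Q => gateAct γ z = v) ?_ ?_
  · intro γ hγ
    rw [Finset.mem_filter] at hγ
    obtain ⟨-, z, hz, h⟩ := hγ
    refine ⟨z, Finset.mem_erase.2 ⟨?_, hz⟩, by simp [h]⟩
    rintro rfl
    rw [map_zero] at h
    exact hv h.symm
  · intro w hw
    exact card_gateAct_eq_mul (Finset.ne_of_mem_erase hw) hv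

end GateCount

/-! ### Circuits with two layers of disjoint gates -/

section Layers

variable {n : ℕ} {𝒯 : CircuitTemplate n}

/-- The action of the gates at some of the positions of a circuit. -/
def CliffordCircuit.layerAct (D : CliffordCircuit 𝒯) (l : List (Fin 𝒯.length)) :
    Module.End (ZMod 2) (PVec (Fin n)) :=
  (l.map fun i => (embedAct (𝒯.get i) (gateAct (D i)) :
    Module.End (ZMod 2) (PVec (Fin n)))).reverse.prod

theorem CliffordCircuit.layerAct_cons (D : CliffordCircuit 𝒯) (i : Fin 𝒯.length)
    (l : List (Fin 𝒯.length)) (g : PVec (Fin n)) :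
    D.layerAct (i :: l) g = D.layerAct l (embedAct (𝒯.get i) (gateAct (D i)) g) := by
  simp [layerAct]

theorem CliffordCircuit.layerAct_of_notMem (D : CliffordCircuit 𝒯) (l : List (Fin 𝒯.length))
    (g : PVec (Fin n)) {q : Fin n} (hq : ∀ i ∈ l, q ∉ 𝒯.get i) : D.layerAct l g q = g q := by
  induction l generalizing g with
  | nil => simp [layerAct]
  | cons i l ih =>
    rw [layerAct_cons, ih _ fun j hj => hq j (by simp [hj]), embedAct_of_notMem _ _ (hq i (by simp))]

theorem CliffordCircuit.layerAct_restrict (D : CliffordCircuit 𝒯) (l : List (Fin 𝒯.length))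
    (hl : l.Pairwise fun i j => Disjoint (𝒯.get i) (𝒯.get j)) (g : PVec (Fin n))
    {i : Fin 𝒯.length} (hi : i ∈ l) :
    (fun s : 𝒯.get i => D.layerAct l g s) = gateAct (D i) fun s => g s := by
  induction l generalizing g with
  | nil => simp at hi
  | cons j l ih =>
    rw [List.pairwise_cons] at hl
    rw [layerAct_cons]
    rcases List.mem_cons.1 hi with rfl | hi'
    · rw [← embedAct_restrict]
      funext s
      exact layerAct_of_notMem D l _ fun k hk h => Finset.disjoint_left.1 (hl.1 k hk) s.2 h
    · rw [ih hl.2 _ hi']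
      congr 1
      funext s
      exact embedAct_of_notMem _ _ fun h => Finset.disjoint_left.1 (hl.1 i hi') h s.2

/-- The first `k` gates of the template have disjoint supports, and the other gates have disjoint
supports that cover all qubits. -/
structure IsTwoLayer (𝒯 : CircuitTemplate n) (k : ℕ) : Prop where
  disjoint : ∀ i j : Fin 𝒯.length, i ≠ j → ((i : ℕ) < k ↔ (j : ℕ) < k) →
    Disjoint (𝒯.get i) (𝒯.get j)
  cover : ∀ q, ∃ i : Fin 𝒯.length, k ≤ i ∧ q ∈ 𝒯.get i

theorem mem_take_finRange {N k : ℕ} {i : Fin N} : i ∈ (List.finRange N).take k ↔ (i : ℕ) < k := by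
  rw [List.mem_take_iff_getElem]
  simp only [List.getElem_finRange, List.length_finRange]
  constructor
  · rintro ⟨j, hj, rfl⟩
    simp at hj ⊢
    omega
  · intro h
    exact ⟨i, by simp [h], by simp⟩

theorem mem_drop_finRange {N k : ℕ} {i : Fin N} : i ∈ (List.finRange N).drop k ↔ k ≤ (i : ℕ) := by
  rw [List.mem_drop_iff_getElem]
  simp only [List.getElem_finRange, List.length_finRange]
  constructor
  · rintro ⟨j, hj, rfl⟩
    simp
  · intro h
    exact ⟨i - k, by omega, by ext; simp; omega⟩

/-- The action of the first layer. -/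
def CliffordCircuit.firstAct (k : ℕ) (D : CliffordCircuit 𝒯) : Module.End (ZMod 2) (PVec (Fin n)) :=
  D.layerAct ((List.finRange 𝒯.length).take k)

theorem CliffordCircuit.act_eq (k : ℕ) (D : CliffordCircuit 𝒯) (g : PVec (Fin n)) :
    D.act g = D.layerAct ((List.finRange 𝒯.length).drop k) (D.firstAct k g) := by
  rw [firstAct, ← Module.End.mul_apply, layerAct, layerAct, ← List.prod_append,
    ← List.reverse_append, ← List.map_append, List.take_append_drop, act, List.ofFn_eq_map]

variable {k : ℕ}

theorem IsTwoLayer.pairwise_take (H : IsTwoLayer 𝒯 k) : ((List.finRange 𝒯.length).take k).Pairwise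
    fun i j => Disjoint (𝒯.get i) (𝒯.get j) := by
  refine ((List.nodup_finRange _).sublist (List.take_sublist _ _)).pairwise_of_forall_ne ?_
  intro i hi j hj hij
  exact H.disjoint i j hij (iff_of_true (mem_take_finRange.1 hi) (mem_take_finRange.1 hj))

theorem IsTwoLayer.pairwise_drop (H : IsTwoLayer 𝒯 k) : ((List.finRange 𝒯.length).drop k).Pairwise
    fun i j => Disjoint (𝒯.get i) (𝒯.get j) := by
  refine ((List.nodup_finRange _).sublist (List.drop_sublist _ _)).pairwise_of_forall_ne ?_
  intro i hi j hj hij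
  exact H.disjoint i j hij (iff_of_false (mem_drop_finRange.1 hi).not_gt
    (mem_drop_finRange.1 hj).not_gt)

theorem IsTwoLayer.firstAct_restrict (H : IsTwoLayer 𝒯 k) (D : CliffordCircuit 𝒯)
    (g : PVec (Fin n)) {i : Fin 𝒯.length} (hi : (i : ℕ) < k) :
    (fun s : 𝒯.get i => D.firstAct k g s) = gateAct (D i) fun s => g s :=
  D.layerAct_restrict _ H.pairwise_take g (mem_take_finRange.2 hi)

theorem firstAct_of_notMem (D : CliffordCircuit 𝒯) (g : PVec (Fin n)) {q : Fin n}
    (hq : ∀ i : Fin 𝒯.length, (i : ℕ) < k → q ∉ 𝒯.get i) : D.firstAct k g q = g q :=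
  D.layerAct_of_notMem _ g fun i hi => hq i (mem_take_finRange.1 hi)

theorem IsTwoLayer.act_restrict (H : IsTwoLayer 𝒯 k) (D : CliffordCircuit 𝒯)
    (g : PVec (Fin n)) {i : Fin 𝒯.length} (hi : k ≤ (i : ℕ)) :
    (fun s : 𝒯.get i => D.act g s) = gateAct (D i) fun s => D.firstAct k g s := by
  rw [D.act_eq k]
  exact D.layerAct_restrict _ H.pairwise_drop _ (mem_drop_finRange.2 hi)

/-- Supports within the second layer are disjoint, so changing one of its gates by `t` amounts to
applying `t` after the whole circuit. -/
theorem IsTwoLayer.act_update (H : IsTwoLayer 𝒯 k) (D : CliffordCircuit 𝒯) {i : Fin 𝒯.length}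
    (hi : k ≤ (i : ℕ)) (t : cliffordGroup (𝒯.get i)) (g : PVec (Fin n)) :
    CliffordCircuit.act (Function.update D i (t • D i)) g =
      embedAct (𝒯.get i) (cliffAct t) (D.act g) := by
  set D' : CliffordCircuit 𝒯 := Function.update D i (t • D i) with hD'
  have hfirst : D'.firstAct k g = D.firstAct k g := by
    unfold CliffordCircuit.firstAct CliffordCircuit.layerAct
    congr 3
    refine List.map_congr_left fun j hj => ?_
    have hji : j ≠ i := by
      rintro rfl
      exact absurd (mem_take_finRange.1 hj) (by omega)
    rw [hD', Function.update_of_ne hji]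
  funext q
  obtain ⟨j, hj, hq⟩ := H.cover q
  have h1 := congrFun (H.act_restrict D' g hj) ⟨q, hq⟩
  have h2 := congrFun (H.act_restrict D g hj) ⟨q, hq⟩
  dsimp only at h1 h2
  rw [h1, hfirst]
  by_cases hji : j = i
  · subst hji
    rw [hD', Function.update_self, gateAct_smul, ← H.act_restrict D g hj]
    exact (congrFun (embedAct_restrict _ _ _) ⟨q, hq⟩).symm
  · have hqi : q ∉ 𝒯.get i := fun h => Finset.disjoint_left.1
      (H.disjoint j i hji (iff_of_false hj.not_gt hi.not_gt)) hq h
    rw [hD', Function.update_of_ne hji, embedAct_of_notMem _ _ hqi, h2]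

end Layers

end

noncomputable section

/-! ### First moment bound for stabilizers with prescribed values -/

section FirstMoment

variable {n : ℕ} {𝒯 : CircuitTemplate n}

/-- The number of values that are allowed for the qubit `q` at the gate `i`, when the input of the
first layer is of `Z`-type and the outputs of the second layer are allowed to be in `a`. -/
def allowedCard (k : ℕ) (a : Fin n → Finset PBit) (i : Fin 𝒯.length) (q : Fin n) : ℕ :=
  if (i : ℕ) < k then 2 else (a q).card

def gateWeight (k : ℕ) (a : Fin n → Finset PBit) (i : Fin 𝒯.length) : ℝ :=
  ∏ q, if q ∈ 𝒯.get i then (allowedCard k a i q : ℝ) / 4 else 1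

/-- The condition on the gate `i` for the Pauli operator `g` between the two layers to come from
an input of `Z`-type and to result in an output allowed by `a`, with `g` nontrivial on the support
of the gate `c`. -/
def GateCond (k : ℕ) (a : Fin n → Finset PBit) (c : Fin 𝒯.length) (g : PVec (Fin n))
    (i : Fin 𝒯.length) (γ : CliffordGate (𝒯.get i)) : Prop :=
  if (i : ℕ) < k then
    ∃ z : PVec (𝒯.get i), (∀ s, (z s).1 = 0) ∧ gateAct γ z = fun s : 𝒯.get i => g s
  else (∀ s : 𝒯.get i, gateAct γ (fun s : 𝒯.get i => g s) s ∈ a s) ∧ (i = c → (fun s : 𝒯.get i => g s) ≠ 0)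

theorem card_filter_fst_eq_zero : (Finset.univ.filter fun v : PBit => v.1 = 0).card = 2 := by
  decide

open Classical in
-- If `g` is nontrivial on the gate, the condition has probability at most the fraction of allowed
-- values. If `g` is trivial there, only the bound 1 is available, except at `c`, where the
-- condition fails.
theorem card_gateCond_le (k : ℕ) {a : Fin n → Finset PBit} (ha : ∀ q, 0 ∈ a q)
    {c : Fin 𝒯.length} (hc : k ≤ (c : ℕ)) (g : PVec (Fin n)) (i : Fin 𝒯.length) :
    ((Finset.univ.filter fun γ => GateCond k a c g i γ).card : ℝ) ≤
      Fintype.card (CliffordGate (𝒯.get i)) *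
        (gateWeight k a i + if i ≠ c ∧ ∀ q ∈ 𝒯.get i, g q = 0 then 1 else 0) := by
  have hw0 : 0 ≤ gateWeight k a i := Finset.prod_nonneg fun q _ => by split_ifs <;> positivity
  have hle : ((Finset.univ.filter fun γ => GateCond k a c g i γ).card : ℝ) ≤
      Fintype.card (CliffordGate (𝒯.get i)) := by
    exact_mod_cast Finset.card_le_univ _
  have hzero : (fun s : 𝒯.get i => g s) = 0 ↔ ∀ q ∈ 𝒯.get i, g q = 0 := by
    simp [funext_iff]
  by_cases hg : ∀ q ∈ 𝒯.get i, g q = 0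
  · by_cases hic : i = c
    · have : (Finset.univ.filter fun γ => GateCond k a c g i γ) = ∅ := by
        refine Finset.filter_eq_empty_iff.2 fun γ _ h => ?_
        rw [GateCond, if_neg (by rw [hic]; omega)] at h
        exact h.2 hic (hzero.2 hg)
      rw [this]
      simp only [Finset.card_empty, Nat.cast_zero]
      refine mul_nonneg (Nat.cast_nonneg _) (add_nonneg hw0 ?_)
      split_ifs <;> norm_num
    · rw [if_pos ⟨hic, hg⟩]
      refine hle.trans (le_mul_of_one_le_right (Nat.cast_nonneg _) (by linarith))
  · rw [if_neg fun h => hg h.2, add_zero]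
    have hv : (fun s : 𝒯.get i => g s) ≠ 0 := fun h => hg (hzero.1 h)
    have key : ∃ B : Finset (PVec (𝒯.get i)), (B.card : ℝ) = gateWeight k a i *
        4 ^ Fintype.card (𝒯.get i) ∧
        (Finset.univ.filter fun γ => GateCond k a c g i γ).card * 4 ^ Fintype.card (𝒯.get i) ≤
          B.card * Fintype.card (CliffordGate (𝒯.get i)) := by
      let A : 𝒯.get i → Finset PBit := fun s =>
        if (i : ℕ) < k then Finset.univ.filter fun v : PBit => v.1 = 0 else a s
      refine ⟨Fintype.piFinset A, ?_, ?_⟩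
      · rw [Fintype.card_piFinset, gateWeight]
        have h1 : ∀ s : 𝒯.get i, (A s).card = allowedCard k a i s := by
          intro s
          simp only [A, allowedCard]
          split_ifs
          · exact card_filter_fst_eq_zero
          · rfl
        rw [Finset.prod_ite_mem, Finset.univ_inter, Finset.prod_div_distrib,
          Finset.prod_const, Fintype.card_coe, div_mul_cancel₀ _ (by positivity)]
        push_cast
        simp only [h1]
        exact Finset.prod_coe_sort (𝒯.get i) fun q => (allowedCard k a i q : ℝ)
      · have h0 : (0 : PVec (𝒯.get i)) ∈ Fintype.piFinset A := by
          rw [Fintype.mem_piFinset]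
          intro s
          simp only [A]
          split_ifs
          · simp
          · exact ha s
        by_cases hik : (i : ℕ) < k
        · refine le_trans (Nat.mul_le_mul_right _ (Finset.card_le_card ?_))
            (card_exists_gateAct_le h0 hv)
          intro γ hγ
          rw [Finset.mem_filter, GateCond, if_pos hik] at hγ
          obtain ⟨-, z, hz, h⟩ := hγ
          refine Finset.mem_filter.2 ⟨Finset.mem_univ _, z, ?_, h⟩
          rw [Fintype.mem_piFinset]
          intro s
          simp [A, hik, hz s]
        · refine le_trans (Nat.mul_le_mul_right _ (Finset.card_le_card ?_))
            (card_gateAct_mem_le h0 hv)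
          intro γ hγ
          rw [Finset.mem_filter, GateCond, if_neg hik] at hγ
          refine Finset.mem_filter.2 ⟨Finset.mem_univ _, ?_⟩
          rw [Fintype.mem_piFinset]
          intro s
          simpa [A, hik] using hγ.2.1 s
    obtain ⟨B, hB, hcard⟩ := key
    have hpos : (0 : ℝ) < 4 ^ Fintype.card (𝒯.get i) := by positivity
    refine le_of_mul_le_mul_right ?_ hpos
    calc _ ≤ (B.card : ℝ) * Fintype.card (CliffordGate (𝒯.get i)) := by exact_mod_cast hcard
      _ = _ := by rw [hB]; ring

/-- There is a stabilizer of the output state that is allowed by `a` and nontrivial on the support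
of the gate `c`. -/
def CliffordCircuit.HasStab (D : CliffordCircuit 𝒯) (a : Fin n → Finset PBit)
    (c : Fin 𝒯.length) : Prop :=
  ∃ g ∈ D.stab, (∀ q, g q ∈ a q) ∧ ∃ q ∈ 𝒯.get c, g q ≠ 0

theorem IsTwoLayer.exists_gateCond {k : ℕ} (H : IsTwoLayer 𝒯 k) {a : Fin n → Finset PBit}
    {c : Fin 𝒯.length} (hc : k ≤ (c : ℕ)) {D : CliffordCircuit 𝒯} (hD : D.HasStab a c) :
    ∃ g : PVec (Fin n), (∀ q, (∀ i : Fin 𝒯.length, (i : ℕ) < k → q ∉ 𝒯.get i) → (g q).1 = 0) ∧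
      ∀ i, GateCond k a c g i (D i) := by
  obtain ⟨_, ⟨z, hz, rfl⟩, hza, q₀, hq₀, hne⟩ := hD
  refine ⟨D.firstAct k z, fun q hq => ?_, fun i => ?_⟩
  · rw [firstAct_of_notMem D z hq]
    exact hz q (by simp)
  · rw [GateCond]
    split_ifs with hik
    · exact ⟨fun s => z s, fun s => hz s (by simp), (H.firstAct_restrict D z hik).symm⟩
    · have h := H.act_restrict D z (not_lt.1 hik)
      rw [← h]
      refine ⟨fun s => hza s, ?_⟩
      rintro rfl h0
      rw [h0, map_zero] at h
      exact hne (congrFun h ⟨q₀, hq₀⟩)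

/-- The factor of the qubit `q` in the contribution of Pauli operators supported on the gates `σ`,
for the number of allowed values. -/
def tileWeight (𝒯 : CircuitTemplate n) (k : ℕ) (a : Fin n → Finset PBit)
    (σ : Finset (Fin 𝒯.length)) (q : Fin n) : ℝ :=
  if ∃ i ∈ σ, k ≤ (i : ℕ) ∧ q ∈ 𝒯.get i then ((a q).card : ℝ) / 2 else 1

/-- The factor of the qubit `q` in the contribution of Pauli operators supported on the gates `σ`,
for the boundary of `σ`. -/
def wallWeight (𝒯 : CircuitTemplate n) (σ : Finset (Fin 𝒯.length)) (q : Fin n) : ℝ :=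
  if (∃ i ∈ σ, q ∈ 𝒯.get i) ∧ ∃ i, i ∉ σ ∧ q ∈ 𝒯.get i then 1 / 2 else 1

/-- The values at `q` of Pauli operators supported on the gates `σ`. -/
def midAllowed (𝒯 : CircuitTemplate n) (k : ℕ) (σ : Finset (Fin 𝒯.length)) (q : Fin n) :
    Finset PBit :=
  Finset.univ.filter fun v => ((∃ i, i ∉ σ ∧ q ∈ 𝒯.get i) → v = 0) ∧
    ((∀ i : Fin 𝒯.length, (i : ℕ) < k → q ∉ 𝒯.get i) → v.1 = 0)

/-- A qubit lies in one tile t and in at most one shifted square s. With both in σ, 4 ⋅ (2/4) ⋅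
(|a|/4) = |a|/2. With only one in σ, `g` must vanish at the qubit, which leaves 1/2 for s or |a|/4
for t. With t in σ and no s, the value is of Z-type and 2 ⋅ |a|/4 = |a|/2. -/
theorem IsTwoLayer.weight_le {k : ℕ} (H : IsTwoLayer 𝒯 k) (a : Fin n → Finset PBit)
    (σ : Finset (Fin 𝒯.length)) (q : Fin n) :
    ((midAllowed 𝒯 k σ q).card : ℝ) *
      ∏ i ∈ σ, (if q ∈ 𝒯.get i then (allowedCard k a i q : ℝ) / 4 else 1) ≤
    tileWeight 𝒯 k a σ q * wallWeight 𝒯 σ q := by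
  obtain ⟨t, ht, hqt⟩ := H.cover q
  have htu : ∀ i : Fin 𝒯.length, k ≤ (i : ℕ) → q ∈ 𝒯.get i → i = t := by
    intro i hi hq
    by_contra h
    exact Finset.disjoint_left.1 (H.disjoint i t h (iff_of_false hi.not_gt ht.not_gt)) hq hqt
  have htile : (∃ i ∈ σ, k ≤ (i : ℕ) ∧ q ∈ 𝒯.get i) ↔ t ∈ σ := by
    constructor
    · rintro ⟨i, hi, hik, hq⟩
      rwa [← htu i hik hq]
    · exact fun h => ⟨t, h, ht, hqt⟩
  have hat : (allowedCard k a t q : ℝ) = (a q).card := by rw [allowedCard, if_neg ht.not_gt]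
  rw [← Fintype.prod_ite_mem, tileWeight, if_congr htile rfl rfl]
  have c0 : ((Finset.univ.filter fun v : PBit => v = 0).card : ℝ) = 1 := by
    exact_mod_cast (by decide : (Finset.univ.filter fun v : PBit => v = 0).card = 1)
  have c2 : ((Finset.univ.filter fun v : PBit => v.1 = 0).card : ℝ) = 2 := by
    rw [card_filter_fst_eq_zero]; norm_num
  have c4 : ((Finset.univ : Finset PBit).card : ℝ) = 4 := by
    rw [Finset.card_univ]; norm_num [ZMod.card]
  by_cases hs : ∃ s : Fin 𝒯.length, (s : ℕ) < k ∧ q ∈ 𝒯.get s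
  · obtain ⟨s, hsk, hqs⟩ := hs
    have hsu : ∀ i : Fin 𝒯.length, (i : ℕ) < k → q ∈ 𝒯.get i → i = s := by
      intro i hi hq
      by_contra h
      exact Finset.disjoint_left.1 (H.disjoint i s h (iff_of_true hi hsk)) hq hqs
    have hst : s ≠ t := by rintro rfl; omega
    have hall : ∀ i, q ∈ 𝒯.get i → i = s ∨ i = t := fun i hi =>
      (lt_or_ge (i : ℕ) k).imp (fun h => hsu i h hi) fun h => htu i h hi
    have has : (allowedCard k a s q : ℝ) = 2 := by rw [allowedCard, if_pos hsk]; norm_num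
    rw [Finset.prod_eq_mul s t hst]
    rotate_left
    · rintro i - hi
      rw [if_neg fun h => not_or.2 hi (hall i h), ite_self]
    · simp
    · simp
    rw [if_pos hqs, if_pos hqt, has, hat]
    have hin : (∃ i ∈ σ, q ∈ 𝒯.get i) ↔ (s ∈ σ ∨ t ∈ σ) := by
      constructor
      · rintro ⟨i, hi, hq⟩
        rcases hall i hq with rfl | rfl
        · exact Or.inl hi
        · exact Or.inr hi
      · rintro (h | h)
        · exact ⟨s, h, hqs⟩
        · exact ⟨t, h, hqt⟩
    have hout : (∃ i, i ∉ σ ∧ q ∈ 𝒯.get i) ↔ (s ∉ σ ∨ t ∉ σ) := by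
      constructor
      · rintro ⟨i, hi, hq⟩
        rcases hall i hq with rfl | rfl
        · exact Or.inl hi
        · exact Or.inr hi
      · rintro (h | h)
        · exact ⟨s, h, hqs⟩
        · exact ⟨t, h, hqt⟩
    have hz : ¬ ∀ i : Fin 𝒯.length, (i : ℕ) < k → q ∉ 𝒯.get i := fun h => h s hsk hqs
    rw [wallWeight, if_congr (and_congr hin hout) rfl rfl]
    simp only [midAllowed, hout, hz, false_imp_iff, and_true]
    by_cases h1 : s ∈ σ <;> by_cases h2 : t ∈ σ <;>
      simp only [h1, h2, not_true, not_false_iff, or_true, true_or, or_false, false_or, if_true,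
        if_false, and_true, true_and, and_false, false_and, true_imp_iff, false_imp_iff, c0,
        or_self, and_self, Finset.filter_true, c4] <;> linarith
  · have hz : ∀ i : Fin 𝒯.length, (i : ℕ) < k → q ∉ 𝒯.get i := fun i hi h => hs ⟨i, hi, h⟩
    have hall : ∀ i, q ∈ 𝒯.get i → i = t := fun i hi =>
      htu i (not_lt.1 fun h => hz i h hi) hi
    rw [Finset.prod_eq_single t]
    rotate_left
    · rintro i - hi
      rw [if_neg fun h => hi (hall i h), ite_self]
    · simp
    rw [if_pos hqt, hat]
    have hin : (∃ i ∈ σ, q ∈ 𝒯.get i) ↔ t ∈ σ := by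
      constructor
      · rintro ⟨i, hi, hq⟩
        rwa [← hall i hq]
      · exact fun h => ⟨t, h, hqt⟩
    have hout : (∃ i, i ∉ σ ∧ q ∈ 𝒯.get i) ↔ t ∉ σ := by
      constructor
      · rintro ⟨i, hi, hq⟩
        rwa [← hall i hq]
      · exact fun h => ⟨t, h, hqt⟩
    have hz' : (∀ i : Fin 𝒯.length, (i : ℕ) < k → q ∉ 𝒯.get i) ↔ True := iff_true_intro hz
    rw [wallWeight, if_congr (and_congr hin hout) rfl rfl]
    simp only [midAllowed, hout, hz', true_imp_iff]
    have hboth : ∀ v : PBit, (v = 0 ∧ v.1 = 0) ↔ v = 0 := fun v =>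
      ⟨And.left, fun h => ⟨h, by rw [h]; rfl⟩⟩
    by_cases h2 : t ∈ σ <;>
      simp only [h2, not_true, not_false_iff, if_true, if_false, and_true, true_and, and_false,
        false_imp_iff, true_imp_iff, c2, hboth, c0] <;> linarith

open Classical in
/-- First moment bound for the existence of a stabilizer of the output state with prescribed
properties. -/
theorem IsTwoLayer.card_hasStab_le {k : ℕ} (H : IsTwoLayer 𝒯 k) {a : Fin n → Finset PBit}
    (ha : ∀ q, 0 ∈ a q) {c : Fin 𝒯.length} (hc : k ≤ (c : ℕ)) :
    ((Finset.univ.filter fun D : CliffordCircuit 𝒯 => D.HasStab a c).card : ℝ) ≤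
      Fintype.card (CliffordCircuit 𝒯) * ∑ σ : Finset (Fin 𝒯.length) with c ∈ σ,
        ∏ q, (tileWeight 𝒯 k a σ q * wallWeight 𝒯 σ q) := by
  let Bd : Finset (PVec (Fin n)) := Finset.univ.filter fun g =>
    ∀ q, (∀ i : Fin 𝒯.length, (i : ℕ) < k → q ∉ 𝒯.get i) → (g q).1 = 0
  have h1 : ((Finset.univ.filter fun D : CliffordCircuit 𝒯 => D.HasStab a c).card : ℝ) ≤
      ∑ g ∈ Bd, ∏ i, ((Finset.univ.filter fun γ => GateCond k a c g i γ).card : ℝ) := by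
    have hsub : (Finset.univ.filter fun D : CliffordCircuit 𝒯 => D.HasStab a c) ⊆
        Bd.biUnion fun g => Fintype.piFinset fun i =>
          Finset.univ.filter fun γ => GateCond k a c g i γ := by
      intro D hD
      obtain ⟨g, hg, hcond⟩ := H.exists_gateCond hc (Finset.mem_filter.1 hD).2
      refine Finset.mem_biUnion.2 ⟨g, by simpa [Bd] using hg, ?_⟩
      rw [Fintype.mem_piFinset]
      exact fun i => by simpa using hcond i
    have := (Finset.card_le_card hsub).trans Finset.card_biUnion_le
    simp only [Fintype.card_piFinset] at this
    exact_mod_cast this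
  refine h1.trans ?_
  have h2 : ∀ g ∈ Bd, ∏ i, ((Finset.univ.filter fun γ => GateCond k a c g i γ).card : ℝ) ≤
      Fintype.card (CliffordCircuit 𝒯) *
        ∏ i, (gateWeight k a i + if i ≠ c ∧ ∀ q ∈ 𝒯.get i, g q = 0 then 1 else 0) := by
    intro g _
    rw [Fintype.card_pi, Nat.cast_prod, ← Finset.prod_mul_distrib]
    exact Finset.prod_le_prod (fun i _ => Nat.cast_nonneg _) fun i _ => card_gateCond_le k ha hc g i
  refine (Finset.sum_le_sum h2).trans ?_
  rw [← Finset.mul_sum]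
  refine mul_le_mul_of_nonneg_left ?_ (Nat.cast_nonneg _)
  -- In the expanded product, σ is the set of gates contributing their weight; at the others `g` has
  -- to vanish. Since the indicator is zero at `c`, only sets σ containing `c` survive.
  simp only [Finset.prod_add]
  rw [Finset.sum_comm, Finset.powerset_univ, Finset.sum_filter]
  refine Finset.sum_le_sum fun σ _ => ?_
  have hw0 : 0 ≤ ∏ i ∈ σ, gateWeight k a i := Finset.prod_nonneg fun i _ =>
    Finset.prod_nonneg fun q _ => by split_ifs <;> positivity
  split_ifs with hcσ
  · calc ∑ g ∈ Bd, (∏ i ∈ σ, gateWeight k a i) *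
          ∏ i ∈ Finset.univ \ σ, (if i ≠ c ∧ ∀ q ∈ 𝒯.get i, g q = 0 then (1 : ℝ) else 0)
        ≤ ∑ g : PVec (Fin n), (∏ i ∈ σ, gateWeight k a i) *
          (if g ∈ Fintype.piFinset (midAllowed 𝒯 k σ) then 1 else 0) := by
          refine (Finset.sum_le_sum (g := fun g => (∏ i ∈ σ, gateWeight k a i) *
            (if g ∈ Fintype.piFinset (midAllowed 𝒯 k σ) then (1 : ℝ) else 0)) ?_).trans
            (Finset.sum_le_sum_of_subset_of_nonneg (Finset.subset_univ _) fun g _ _ =>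
              mul_nonneg hw0 (by split_ifs <;> norm_num))
          intro g hg
          refine mul_le_mul_of_nonneg_left ?_ hw0
          rw [Finset.prod_ite_zero]
          split_ifs with h3 h4
          · simp
          · refine absurd ?_ h4
            rw [Fintype.mem_piFinset]
            intro q
            refine Finset.mem_filter.2 ⟨Finset.mem_univ _, ?_, (Finset.mem_filter.1 hg).2 q⟩
            rintro ⟨i, hi, hq⟩
            exact (h3 i (by simp [hi])).2 q hq
          · norm_num
          · exact le_rfl
      _ = (∏ i ∈ σ, gateWeight k a i) * ∏ q, ((midAllowed 𝒯 k σ q).card : ℝ) := by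
          rw [← Finset.mul_sum, Finset.sum_boole]
          congr 1
          rw [Finset.filter_mem_eq_inter, Finset.univ_inter, Fintype.card_piFinset, Nat.cast_prod]
      _ = ∏ q, (((midAllowed 𝒯 k σ q).card : ℝ) *
            ∏ i ∈ σ, (if q ∈ 𝒯.get i then (allowedCard k a i q : ℝ) / 4 else 1)) := by
          rw [Finset.prod_mul_distrib, mul_comm]
          congr 1
          exact Finset.prod_comm
      _ ≤ _ := Finset.prod_le_prod (fun q _ => mul_nonneg (Nat.cast_nonneg _)
            (Finset.prod_nonneg fun i _ => by split_ifs <;> positivity))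
            fun q _ => H.weight_le a σ q
  · refine (Finset.sum_eq_zero fun g _ => ?_).le
    rw [Finset.prod_eq_zero (i := c) (s := Finset.univ \ σ) (by simp [hcσ]) (by simp), mul_zero]

end FirstMoment

end

noncomputable section

/-! ### Summing over domain walls along a spanning tree -/

section WallSum

variable {n : ℕ} {𝒯 : CircuitTemplate n}

/-- A rooted tree on the gates of the template, given by the parent function `par`, such that the
support of each gate overlaps in at least `e` qubits with that of its parent, which is in the other
layer. -/
structure IsOverlapTree (𝒯 : CircuitTemplate n) (k e : ℕ) (r : Fin 𝒯.length)
    (par : Fin 𝒯.length → Fin 𝒯.length) (rank : Fin 𝒯.length → ℕ) : Prop where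
  rank_lt : ∀ i, i ≠ r → rank (par i) < rank i
  layer : ∀ i, i ≠ r → ((i : ℕ) < k ↔ ¬ (par i : ℕ) < k)
  overlap : ∀ i, i ≠ r → e ≤ (𝒯.get i ∩ 𝒯.get (par i)).card

/-- The gates at which `σ` changes along the edge to the parent. -/
def treeDiff {N : ℕ} (r : Fin N) (par : Fin N → Fin N) (σ : Finset (Fin N)) : Finset (Fin N) :=
  Finset.univ.filter fun i => if i = r then i ∈ σ else ¬ (i ∈ σ ↔ par i ∈ σ)

/-- Membership in σ is recovered from the root outwards, by induction on the rank. -/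
theorem treeDiff_injective {N : ℕ} {r : Fin N} {par : Fin N → Fin N} {rank : Fin N → ℕ}
    (h : ∀ i, i ≠ r → rank (par i) < rank i) : Function.Injective (treeDiff r par) := by
  intro σ τ hst
  have key : ∀ (m : ℕ) (i : Fin N), rank i < m → (i ∈ σ ↔ i ∈ τ) := by
    intro m
    induction m with
    | zero => intro i hi; omega
    | succ m ih =>
      intro i hi
      have h1 : i ∈ treeDiff r par σ ↔ i ∈ treeDiff r par τ := by rw [hst]
      simp only [treeDiff, Finset.mem_filter, Finset.mem_univ, true_and] at h1
      by_cases hir : i = r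
      · simpa only [hir, if_true] using h1
      · simp only [hir, if_false] at h1
        have h2 := ih (par i) (by have := h i hir; omega)
        tauto
  ext i
  exact key _ i (Nat.lt_succ_self _)

variable {k e : ℕ} {r : Fin 𝒯.length} {par : Fin 𝒯.length → Fin 𝒯.length}
  {rank : Fin 𝒯.length → ℕ}

/-- Each tree edge along which σ changes contributes at least `e` wall qubits. Different edges
contribute different qubits: a qubit lies in at most one gate per layer, so it determines the two
ends of the edge, and the rank tells child from parent. -/
theorem prod_wallWeight_le (H : IsTwoLayer 𝒯 k) (O : IsOverlapTree 𝒯 k e r par rank)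
    (σ : Finset (Fin 𝒯.length)) :
    ∏ q, wallWeight 𝒯 σ q ≤ ∏ i ∈ treeDiff r par σ, (if i = r then 1 else (1 / 2 : ℝ) ^ e) := by
  set W : Finset (Fin n) := Finset.univ.filter fun q =>
    (∃ i ∈ σ, q ∈ 𝒯.get i) ∧ ∃ i, i ∉ σ ∧ q ∈ 𝒯.get i with hW
  set E : Finset (Fin 𝒯.length) := (treeDiff r par σ).filter fun i => ¬ i = r with hE
  have h1 : ∏ q, wallWeight 𝒯 σ q = (1 / 2 : ℝ) ^ W.card := by
    simp only [wallWeight]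
    rw [Finset.prod_ite, Finset.prod_const, Finset.prod_const_one, mul_one]
  have h2 : ∏ i ∈ treeDiff r par σ, (if i = r then 1 else (1 / 2 : ℝ) ^ e) =
      (1 / 2 : ℝ) ^ (e * E.card) := by
    rw [Finset.prod_ite, Finset.prod_const_one, one_mul, Finset.prod_const, ← pow_mul]
  rw [h1, h2]
  refine pow_le_pow_of_le_one (by norm_num) (by norm_num) ?_
  have hdisj : (E : Set (Fin 𝒯.length)).PairwiseDisjoint
      fun i => 𝒯.get i ∩ 𝒯.get (par i) := by
    intro i hi j hj hij
    have hir : i ≠ r := (Finset.mem_filter.1 hi).2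
    have hjr : j ≠ r := (Finset.mem_filter.1 hj).2
    refine Finset.disjoint_left.2 fun q hqi hqj => ?_
    rw [Finset.mem_inter] at hqi hqj
    have heq : ∀ a b : Fin 𝒯.length, ((a : ℕ) < k ↔ (b : ℕ) < k) → q ∈ 𝒯.get a → q ∈ 𝒯.get b →
        a = b := by
      intro a b hab ha hb
      by_contra hne
      exact Finset.disjoint_left.1 (H.disjoint a b hne hab) ha hb
    have li := O.layer i hir
    have lj := O.layer j hjr
    by_cases hl : (i : ℕ) < k ↔ (j : ℕ) < k
    · exact hij (heq i j hl hqi.1 hqj.1)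
    · have e1 := heq i (par j) (by tauto) hqi.1 hqj.2
      have e2 := heq j (par i) (by tauto) hqj.1 hqi.2
      have r1 := O.rank_lt i hir
      have r2 := O.rank_lt j hjr
      rw [← e1] at r2
      rw [← e2] at r1
      omega
  calc e * E.card ≤ ∑ i ∈ E, (𝒯.get i ∩ 𝒯.get (par i)).card := by
        rw [mul_comm, ← smul_eq_mul]
        exact Finset.card_nsmul_le_sum _ _ _ fun i hi => O.overlap i (Finset.mem_filter.1 hi).2
    _ = (E.biUnion fun i => 𝒯.get i ∩ 𝒯.get (par i)).card := (Finset.card_biUnion hdisj).symm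
    _ ≤ W.card := by
        refine Finset.card_le_card fun q hq => ?_
        obtain ⟨i, hi, hq⟩ := Finset.mem_biUnion.1 hq
        rw [Finset.mem_inter] at hq
        obtain ⟨hi, hir⟩ := Finset.mem_filter.1 hi
        have hi := (Finset.mem_filter.1 hi).2
        rw [if_neg hir] at hi
        refine Finset.mem_filter.2 ⟨Finset.mem_univ _, ?_⟩
        by_cases h : i ∈ σ
        · exact ⟨⟨i, h, hq.1⟩, par i, by tauto, hq.2⟩
        · exact ⟨⟨par i, by tauto, hq.2⟩, i, h, hq.1⟩

/-- By injectivity, the sum over σ is at most the sum over all sets of changes, which factors over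
the gates: 2 for the root and 1 + 2^(-e) for each other gate. -/
theorem sum_prod_wallWeight_le (H : IsTwoLayer 𝒯 k) (O : IsOverlapTree 𝒯 k e r par rank) :
    ∑ σ : Finset (Fin 𝒯.length), ∏ q, wallWeight 𝒯 σ q ≤
      2 * (1 + (1 / 2 : ℝ) ^ e) ^ (𝒯.length - 1) := by
  set x : Fin 𝒯.length → ℝ := fun i => if i = r then 1 else (1 / 2 : ℝ) ^ e with hx
  have hx0 : ∀ i, 0 ≤ x i := fun i => by simp only [hx]; split_ifs <;> positivity
  calc ∑ σ : Finset (Fin 𝒯.length), ∏ q, wallWeight 𝒯 σ q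
      ≤ ∑ σ, ∏ i ∈ treeDiff r par σ, x i :=
        Finset.sum_le_sum fun σ _ => prod_wallWeight_le H O σ
    _ = ∑ δ ∈ Finset.univ.image (treeDiff r par), ∏ i ∈ δ, x i :=
        (Finset.sum_image (f := fun δ => ∏ i ∈ δ, x i)
          fun σ _ τ _ h => treeDiff_injective O.rank_lt h).symm
    _ ≤ ∑ δ : Finset (Fin 𝒯.length), ∏ i ∈ δ, x i :=
        Finset.sum_le_sum_of_subset_of_nonneg (Finset.subset_univ _) fun δ _ _ =>
          Finset.prod_nonneg fun i _ => hx0 i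
    _ = ∏ i, (x i + 1) := by
        rw [Finset.prod_add]
        simp
    _ = 2 * (1 + (1 / 2 : ℝ) ^ e) ^ (𝒯.length - 1) := by
        rw [← Finset.mul_prod_erase _ _ (Finset.mem_univ r)]
        congr 1
        · norm_num [hx]
        · rw [Finset.prod_congr rfl (g := fun _ => 1 + (1 / 2 : ℝ) ^ e), Finset.prod_const,
            Finset.card_erase_of_mem (Finset.mem_univ _), Finset.card_univ, Fintype.card_fin]
          intro i hi
          simp only [hx]
          rw [if_neg (Finset.ne_of_mem_erase hi), add_comm]

/-- All values on `X`, only the identity on `Y`, and `I` and `Z` elsewhere. -/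
def allowedValues (X Y : Finset (Fin n)) (q : Fin n) : Finset PBit :=
  if q ∈ X then Finset.univ else if q ∈ Y then {0} else Finset.univ.filter fun v => v.1 = 0

theorem zero_mem_allowedValues (X Y : Finset (Fin n)) (q : Fin n) : 0 ∈ allowedValues X Y q := by
  unfold allowedValues
  split_ifs <;> simp

theorem card_allowedValues (X Y : Finset (Fin n)) (q : Fin n) :
    ((allowedValues X Y q).card : ℝ) / 2 = if q ∈ X then 2 else if q ∈ Y then 1 / 2 else 1 := by
  unfold allowedValues
  split_ifs
  · rw [Finset.card_univ]; norm_num [ZMod.card]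
  · simp
  · rw [card_filter_fst_eq_zero]; norm_num

theorem prod_card_allowedValues {X Y : Finset (Fin n)} (hXY : Disjoint X Y) :
    ∏ q, ((allowedValues X Y q).card : ℝ) / 2 = 2 ^ X.card * (1 / 2) ^ Y.card := by
  simp only [card_allowedValues]
  have : ∀ q : Fin n, (if q ∈ X then (2 : ℝ) else if q ∈ Y then 1 / 2 else 1) =
      (if q ∈ X then 2 else 1) * if q ∈ Y then 1 / 2 else 1 := by
    intro q
    by_cases hX : q ∈ X
    · simp [hX, Finset.disjoint_left.1 hXY hX]
    · simp [hX]
  simp only [this]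
  rw [Finset.prod_mul_distrib, Fintype.prod_ite_mem, Fintype.prod_ite_mem, Finset.prod_const,
    Finset.prod_const]

theorem prod_tileWeight_le (X Y : Finset (Fin n)) (σ : Finset (Fin 𝒯.length)) :
    ∏ q, tileWeight 𝒯 k (allowedValues X Y) σ q ≤ 2 ^ X.card := by
  have h : ∏ q : Fin n, (if q ∈ X then (2 : ℝ) else 1) = 2 ^ X.card := by
    rw [Fintype.prod_ite_mem, Finset.prod_const]
  rw [← h]
  refine Finset.prod_le_prod (fun q _ => ?_) fun q _ => ?_
  · unfold tileWeight
    split_ifs <;> positivity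
  · unfold tileWeight
    rw [card_allowedValues]
    split_ifs <;> norm_num

open Classical in
/-- The fraction of the circuits whose output state has a stabilizer that is of `Z`-type outside
`X`, trivial on `Y`, and nontrivial on the support of the gate `c`. -/
theorem card_hasStab_allowedValues_le (H : IsTwoLayer 𝒯 k) (O : IsOverlapTree 𝒯 k e r par rank)
    {X Y : Finset (Fin n)} (hXY : Disjoint X Y) {c : Fin 𝒯.length} (hc : k ≤ (c : ℕ)) :
    ((Finset.univ.filter fun D : CliffordCircuit 𝒯 => D.HasStab (allowedValues X Y) c).card : ℝ) ≤
      Fintype.card (CliffordCircuit 𝒯) * (2 ^ X.card * (1 / 2) ^ Y.card +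
        2 ^ X.card * (2 * (1 + (1 / 2 : ℝ) ^ e) ^ (𝒯.length - 1) - 2)) := by
  refine (H.card_hasStab_le (zero_mem_allowedValues X Y) hc).trans
    (mul_le_mul_of_nonneg_left ?_ (Nat.cast_nonneg _))
  have hwall : ∀ σ : Finset (Fin 𝒯.length), 0 ≤ ∏ q, wallWeight 𝒯 σ q := fun σ =>
    Finset.prod_nonneg fun q _ => by unfold wallWeight; split_ifs <;> norm_num
  have hne : (∅ : Finset (Fin 𝒯.length)) ≠ Finset.univ := fun h => by
    have := Finset.mem_univ c
    rw [← h] at this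
    simp at this
  -- The full and the empty set have no walls, so each contributes exactly 1; this is the 2 that is
  -- subtracted. The full set supplies the main term below, and the empty set never occurs because
  -- `c ∈ σ`.
  have hsum : ∑ σ ∈ (Finset.univ.erase Finset.univ).erase (∅ : Finset (Fin 𝒯.length)),
      ∏ q, wallWeight 𝒯 σ q ≤ 2 * (1 + (1 / 2 : ℝ) ^ e) ^ (𝒯.length - 1) - 2 := by
    have h1 := sum_prod_wallWeight_le H O
    rw [← Finset.add_sum_erase _ _ (Finset.mem_univ (Finset.univ : Finset (Fin 𝒯.length))),
      ← Finset.add_sum_erase _ _ (Finset.mem_erase.2 ⟨hne, Finset.mem_univ _⟩)] at h1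
    have e1 : ∏ q, wallWeight 𝒯 Finset.univ q = 1 := by simp [wallWeight]
    have e2 : ∏ q, wallWeight 𝒯 ∅ q = 1 := by simp [wallWeight]
    rw [e1, e2] at h1
    linarith
  rw [← Finset.add_sum_erase _ _ (Finset.mem_filter.2 ⟨Finset.mem_univ Finset.univ,
    Finset.mem_univ c⟩)]
  refine add_le_add ?_ ?_
  · rw [← prod_card_allowedValues hXY]
    refine (Finset.prod_congr rfl fun q _ => ?_).le
    have h1 : ∃ i ∈ (Finset.univ : Finset (Fin 𝒯.length)), k ≤ (i : ℕ) ∧ q ∈ 𝒯.get i := by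
      simpa using H.cover q
    rw [tileWeight, if_pos h1]
    simp [wallWeight]
  · calc _ ≤ ∑ σ ∈ (Finset.univ.erase Finset.univ).erase (∅ : Finset (Fin 𝒯.length)),
          2 ^ X.card * ∏ q, wallWeight 𝒯 σ q := by
          refine (Finset.sum_le_sum fun σ _ => ?_).trans
            (Finset.sum_le_sum_of_subset_of_nonneg ?_ fun σ _ _ =>
              mul_nonneg (by positivity) (hwall σ))
          · rw [Finset.prod_mul_distrib]
            exact mul_le_mul_of_nonneg_right (prod_tileWeight_le X Y σ) (hwall σ)
          · intro σ hσ
            obtain ⟨h1, h2⟩ := Finset.mem_erase.1 hσ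
            have hcσ := (Finset.mem_filter.1 h2).2
            exact Finset.mem_erase.2 ⟨Finset.ne_empty_of_mem hcσ,
              Finset.mem_erase.2 ⟨h1, Finset.mem_univ _⟩⟩
      _ ≤ _ := by
          rw [← Finset.mul_sum]
          exact mul_le_mul_of_nonneg_left hsum (by positivity)

end WallSum

end

noncomputable section

/-! ### Realising transvections by changing one gate -/

section Averaging

variable {n : ℕ} {𝒯 : CircuitTemplate n}

theorem cliffAct_injective {Q : Type} [Fintype Q] [DecidableEq Q] (t : cliffordGroup Q) :
    Function.Injective (cliffAct t) := by
  rw [← LinearMap.ker_eq_bot, LinearMap.ker_eq_bot']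
  intro g hg
  refine eq_of_symp_eq fun k => ?_
  rw [← symp_cliffAct t, hg, map_zero, map_zero]

open Classical in
/-- If the two-qubit transvections can be implemented by injective maps on circuits, then a
fraction `1 / 16` of the circuits in which the third qubit is not pure has GHZ-type
entanglement. -/
theorem card_le_card_hasGHZTypeMIE {t : Fin 3 → Fin n} (ht : Function.Injective t)
    {T : Finset (Fin n)} (hT : (T : Set (Fin n)) = Set.range t) (G : CliffordCircuit 𝒯 → Prop) [DecidablePred G]
    (F : PBit → PBit → CliffordCircuit 𝒯 → CliffordCircuit 𝒯)
    (hF : ∀ x y, Function.Injective (F x y))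
    (hpure : ∀ D, G D → ∀ l ∈ measured D.stab t, l 0 = 0 → l 1 = 0 → l 2 = 0)
    (htransv : ∀ D, G D → ∀ x y, ∀ l ∈ measured D.stab t,
      transv ![x, y, 0] l ∈ measured (F x y D).stab t) :
    (Finset.univ.filter G).card ≤
      16 * (Finset.univ.filter fun D : CliffordCircuit 𝒯 => HasGHZTypeMIE D.outputState T).card := by
  set X := Finset.univ.filter fun D : CliffordCircuit 𝒯 => HasGHZTypeMIE D.outputState T
  -- Every circuit satisfying `G` has a pair (x, y) for which the modified circuit is of GHZ type.
  -- There are 16 pairs, and each modification is injective.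
  have hsub : Finset.univ.filter G ⊆ (Finset.univ : Finset (PBit × PBit)).biUnion fun u =>
      Finset.univ.filter fun D => F u.1 u.2 D ∈ X := by
    intro D hD
    have hG := (Finset.mem_filter.1 hD).2
    obtain ⟨x, y, p, r, hpr, hr, hp⟩ :=
      (D.isLagrangian_stab.measured ht).exists_transv_ghz_generators (hpure D hG)
    refine Finset.mem_biUnion.2 ⟨(x, y), Finset.mem_univ _, ?_⟩
    simp only [X, Finset.mem_filter, Finset.mem_univ, true_and]
    have hmap : ∀ l ∈ (measured D.stab t).map (transv ![x, y, 0]),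
        l ∈ measured (F x y D).stab t := by
      rintro _ ⟨l, hl, rfl⟩
      exact htransv D hG x y l hl
    exact hasGHZTypeMIE_of_measured (fun g hg => (F x y D).pauliOp_mulVec_outputState hg) hT p r hpr
      (hmap r hr) fun a b hab => hmap _ (hp a b hab)
  refine (Finset.card_le_card hsub).trans (Finset.card_biUnion_le.trans ?_)
  calc ∑ u : PBit × PBit, (Finset.univ.filter fun D => F u.1 u.2 D ∈ X).card
      ≤ ∑ _u : PBit × PBit, X.card := Finset.sum_le_sum fun u _ =>
        Finset.card_le_card_of_injOn (F u.1 u.2) (fun D hD => (Finset.mem_filter.1 hD).2)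
          fun D _ D' _ h => hF u.1 u.2 h
    _ = 16 * X.card := by
        rw [Finset.sum_const, smul_eq_mul]
        rfl

theorem IsTwoLayer.stab_update {k : ℕ} (H : IsTwoLayer 𝒯 k) (D : CliffordCircuit 𝒯)
    {c : Fin 𝒯.length} (hc : k ≤ (c : ℕ)) (τ : cliffordGroup (𝒯.get c)) (g : PVec (Fin n)) :
    g ∈ CliffordCircuit.stab (Function.update D c (τ • D c)) ↔
      ∃ g₀ ∈ D.stab, embedAct (𝒯.get c) (cliffAct τ) g₀ = g := by
  constructor
  · rintro ⟨z, hz, rfl⟩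
    exact ⟨D.act z, ⟨z, hz, rfl⟩, (H.act_update D hc τ z).symm⟩
  · rintro ⟨_, ⟨z, hz, rfl⟩, rfl⟩
    exact ⟨z, hz, H.act_update D hc τ z⟩

/-- `w` is the input, on the support of the gate `c`, of a stabilizer with values `x` at `h` and `y`
at `i` that is of `Z`-type on all other qubits outside the support of `c`. -/
def CliffordCircuit.IsExtension (D : CliffordCircuit 𝒯) (c : Fin 𝒯.length) (h i : Fin n)
    (x y : PBit) (w : PVec (𝒯.get c)) : Prop :=
  ∃ g ∈ D.stab, g h = x ∧ g i = y ∧ (∀ q, q ∉ 𝒯.get c → q ≠ h → q ≠ i → (g q).1 = 0) ∧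
    (fun s : 𝒯.get c => g s) = gateAct (D c) w

/-- The extension is recorded at the input of the gate `c`, so multiplying that gate on the left by
`τ` does not change it. Recording the output instead would break the injectivity of `twist`. -/
theorem IsTwoLayer.isExtension_update {k : ℕ} (H : IsTwoLayer 𝒯 k) (D : CliffordCircuit 𝒯)
    {c : Fin 𝒯.length} (hc : k ≤ (c : ℕ)) (τ : cliffordGroup (𝒯.get c)) {h i : Fin n}
    (hh : h ∉ 𝒯.get c) (hi : i ∉ 𝒯.get c) (x y : PBit) :
    CliffordCircuit.IsExtension (Function.update D c (τ • D c)) c h i x y =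
      D.IsExtension c h i x y := by
  funext w
  apply propext
  constructor
  · rintro ⟨g, hg, hx, hy, hz, hw⟩
    obtain ⟨g₀, hg₀, rfl⟩ := (H.stab_update D hc τ g).1 hg
    rw [embedAct_of_notMem _ _ hh] at hx
    rw [embedAct_of_notMem _ _ hi] at hy
    refine ⟨g₀, hg₀, hx, hy, fun q hq h1 h2 => ?_, ?_⟩
    · rw [← hz q hq h1 h2, embedAct_of_notMem _ _ hq]
    · rw [embedAct_restrict, Function.update_self, gateAct_smul] at hw
      exact cliffAct_injective τ hw
  · rintro ⟨g, hg, hx, hy, hz, hw⟩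
    refine ⟨_, (H.stab_update D hc τ _).2 ⟨g, hg, rfl⟩, ?_, ?_, fun q hq h1 h2 => ?_, ?_⟩
    · rw [embedAct_of_notMem _ _ hh, hx]
    · rw [embedAct_of_notMem _ _ hi, hy]
    · rw [embedAct_of_notMem _ _ hq, hz q hq h1 h2]
    · rw [embedAct_restrict, Function.update_self, gateAct_smul, hw]

/-- Multiply the gate `c` by a transvection that implements a transvection on the qubits `h` and
`i`. -/
def CliffordCircuit.twist (c : Fin 𝒯.length) (h i : Fin n) (x y : PBit) (D : CliffordCircuit 𝒯) :
    CliffordCircuit 𝒯 :=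
  Function.update D c
    (transvCliff (gateAct (D c) (Classical.epsilon (D.IsExtension c h i x y))) • D c)

/-- The twisted circuit has the same extensions, hence the same chosen input `w`. A transvection
fixes its own vector, so the twisted gate still maps `w` to that vector; thus the multiplier can be
read off and undone. -/
theorem IsTwoLayer.twist_injective {k : ℕ} (H : IsTwoLayer 𝒯 k)
    {c : Fin 𝒯.length} (hc : k ≤ (c : ℕ)) {h i : Fin n}
    (hh : h ∉ 𝒯.get c) (hi : i ∉ 𝒯.get c) (x y : PBit) :
    Function.Injective (CliffordCircuit.twist (𝒯 := 𝒯) c h i x y) := by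
  have hext : ∀ D : CliffordCircuit 𝒯, (D.twist c h i x y).IsExtension c h i x y =
      D.IsExtension c h i x y := fun D => H.isExtension_update D hc _ hh hi x y
  have hgate : ∀ D : CliffordCircuit 𝒯,
      gateAct (D.twist c h i x y c) (Classical.epsilon (D.IsExtension c h i x y)) =
        gateAct (D c) (Classical.epsilon (D.IsExtension c h i x y)) := by
    intro D
    rw [CliffordCircuit.twist, Function.update_self, gateAct_smul, cliffAct_transvCliff,
      transv_self]
  intro D D' hDD'
  have e1 : D.IsExtension c h i x y = D'.IsExtension c h i x y := by
    rw [← hext D, hDD', hext D']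
  have e2 := hgate D
  rw [hDD', e1, hgate D'] at e2
  funext j
  by_cases hj : j = c
  · subst hj
    have := congrFun hDD' j
    rw [CliffordCircuit.twist, CliffordCircuit.twist, Function.update_self, Function.update_self,
      e1, e2] at this
    exact MulAction.injective _ this
  · have := congrFun hDD' j
    rwa [CliffordCircuit.twist, CliffordCircuit.twist, Function.update_of_ne hj,
      Function.update_of_ne hj] at this

/-- Let `W` be the set of pairs of values at `h` and `i` that are attained. A pair orthogonal to `W`
extends to a stabilizer that is trivial on the support of `c` and of Z-type elsewhere off `h`, `i`.
The hypotheses `hH` and `hI` force that pair to vanish, so `W` is everything. -/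
theorem CliffordCircuit.exists_isExtension (D : CliffordCircuit 𝒯) {c cH cI : Fin 𝒯.length}
    (hsurj : ∀ γ : CliffordGate (𝒯.get c), Function.Surjective (gateAct γ))
    {h i : Fin n} (hhi : h ≠ i) (hhH : h ∈ 𝒯.get cH) (hiI : i ∈ 𝒯.get cI)
    (hh : h ∉ 𝒯.get c) (hi : i ∉ 𝒯.get c)
    (hH : ¬ D.HasStab (allowedValues {h, i} (𝒯.get c)) cH)
    (hI : ¬ D.HasStab (allowedValues {h, i} (𝒯.get c)) cI) (x y : PBit) :
    ∃ w, D.IsExtension c h i x y w := by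
  let S : Set (Fin n) := {q | q ∈ 𝒯.get c ∨ q = h ∨ q = i}
  let W : Submodule (ZMod 2) (PVec (Fin 2)) :=
    (D.stab ⊓ zOff S).map (LinearMap.funLeft (ZMod 2) PBit ![h, i])
  have hbot : symp.orthogonal W = ⊥ := by
    rw [eq_bot_iff]
    intro w hw
    rw [LinearMap.BilinForm.mem_orthogonal_iff] at hw
    obtain ⟨m, hm, hmS, hmz⟩ := D.isLagrangian_stab.exists_extension S
      (Pi.single h (w 0) + Pi.single i (w 1)) fun g hg hgz => by
        have : symp (fun a => g (![h, i] a)) w = 0 := hw _ ⟨g, ⟨hg, hgz⟩, rfl⟩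
        rw [symp_apply, Fin.sum_univ_two] at this
        rw [symp_comm, map_add, LinearMap.add_apply, symp_single, symp_single, sympAt_comm,
          sympAt_comm (w 1)]
        exact this
    have hmh : m h = w 0 := by rw [hmS h (Or.inr (Or.inl rfl))]; simp [hhi]
    have hmi : m i = w 1 := by rw [hmS i (Or.inr (Or.inr rfl))]; simp [hhi.symm]
    have hall : ∀ q, m q ∈ allowedValues {h, i} (𝒯.get c) q := by
      intro q
      unfold allowedValues
      split_ifs with h1 h2
      · exact Finset.mem_univ _
      · have hqh : q ≠ h := fun e => hh (e ▸ h2)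
        have hqi : q ≠ i := fun e => hi (e ▸ h2)
        rw [hmS q (Or.inl h2)]
        simp [hqh, hqi]
      · simp only [Finset.mem_insert, Finset.mem_singleton, not_or] at h1
        rw [Finset.mem_filter]
        refine ⟨Finset.mem_univ _, ?_⟩
        have hqS : q ∉ S := by
          rintro (e | e | e)
          exacts [h2 e, h1.1 e, h1.2 e]
        rw [hmz q hqS]
        simp [h1]
    have h0 : w 0 = 0 := by
      by_contra hne
      exact hH ⟨m, hm, hall, h, hhH, hmh ▸ hne⟩
    have h1 : w 1 = 0 := by
      by_contra hne
      exact hI ⟨m, hm, hall, i, hiI, hmi ▸ hne⟩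
    rw [Submodule.mem_bot]
    funext a
    fin_cases a
    exacts [h0, h1]
  have htop : W = ⊤ := by
    rw [← LinearMap.BilinForm.orthogonal_orthogonal symp_nondegenerate symp_isRefl W, hbot,
      eq_top_iff]
    intro w _
    rw [LinearMap.BilinForm.mem_orthogonal_iff]
    intro z hz
    rw [(Submodule.mem_bot _).1 hz, map_zero, LinearMap.zero_apply]
  have hmem : ![x, y] ∈ W := by rw [htop]; trivial
  obtain ⟨g, ⟨hg, hgz⟩, hgxy⟩ := hmem
  obtain ⟨w, hw⟩ := hsurj (D c) fun s => g s
  refine ⟨w, g, hg, congrFun hgxy 0, congrFun hgxy 1, fun q hq h1 h2 => hgz q ?_, hw.symm⟩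
  rintro (e | e | e)
  exacts [hq e, h1 e, h2 e]

theorem symp_three_zero (x y : PBit) (l : PVec (Fin 3)) :
    symp ![x, y, 0] l = sympAt x (l 0) + sympAt y (l 1) := by
  rw [symp_fin_three]
  simp [sympAt_zero_left]

/-- Let m be the stabilizer behind `l`, g the extension, v its part on the gate, A the embedded
transvection along v, and s the form of (x, y, 0) with `l`. The stabilizer Am + s⋅Ag of the new
state works: on the gate it is m + sv + sv = m, and off the gate it is m + sg, which adds s⋅x at
`h`, s⋅y at `i` and only Z-type factors elsewhere. -/
theorem IsTwoLayer.transv_mem_measured_twist {k : ℕ} (H : IsTwoLayer 𝒯 k) (D : CliffordCircuit 𝒯)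
    {c : Fin 𝒯.length} (hc : k ≤ (c : ℕ)) {h i j : Fin n} (hhi : h ≠ i)
    (hh : h ∉ 𝒯.get c) (hi : i ∉ 𝒯.get c) (hj : j ∈ 𝒯.get c) {x y : PBit}
    (hex : ∃ w, D.IsExtension c h i x y w) {l : PVec (Fin 3)}
    (hl : l ∈ measured D.stab ![h, i, j]) :
    transv ![x, y, 0] l ∈ measured (D.twist c h i x y).stab ![h, i, j] := by
  obtain ⟨g, hg, hgx, hgy, hgz, hgw⟩ := Classical.epsilon_spec hex
  obtain ⟨m, hm, hmz, hml⟩ := mem_measured.1 hl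
  have hm0 : m h = l 0 := hml 0
  have hm1 : m i = l 1 := hml 1
  have hm2 : m j = l 2 := hml 2
  set s : ZMod 2 := symp ![x, y, 0] l with hs
  set v := gateAct (D c) (Classical.epsilon (D.IsExtension c h i x y)) with hv
  have hmz' : ∀ q, q ≠ h → q ≠ i → q ≠ j → (m q).1 = 0 := by
    intro q h0 h1 h2
    refine hmz q ?_
    rintro ⟨a, ha⟩
    fin_cases a
    exacts [h0 ha.symm, h1 ha.symm, h2 ha.symm]
  -- The stabilizers `g` and `m` commute, and off the gate only `h` and `i` can contribute to the
  -- form, since both operators are of Z-type on the other qubits there.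
  have hsymp : symp v (fun q : 𝒯.get c => m q) = s := by
    have h1 : symp g m = 0 := (D.isLagrangian_stab m).1 hm g hg
    rw [symp_eq_add_compl (𝒯.get c), hgw] at h1
    have h2 : ∑ q : {q // q ∉ 𝒯.get c}, sympAt (g q) (m q) = s := by
      rw [Finset.sum_eq_add_of_mem (⟨h, hh⟩ : {q // q ∉ 𝒯.get c}) ⟨i, hi⟩ (Finset.mem_univ _)
        (Finset.mem_univ _) (fun e => hhi (congrArg Subtype.val e)), hs, symp_three_zero, hgx, hgy,
        hm0, hm1]
      rintro ⟨q, hq⟩ - ⟨h0, h1⟩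
      have h0' : q ≠ h := fun e => h0 (Subtype.ext e)
      have h1' : q ≠ i := fun e => h1 (Subtype.ext e)
      have h2' : q ≠ j := fun e => hq (e ▸ hj)
      simp [sympAt, hgz q hq h0' h1', hmz' q h0' h1' h2']
    rw [h2] at h1
    have key : ∀ a b : ZMod 2, a + b = 0 → a = b := by decide
    exact key _ _ h1
  set A := embedAct (𝒯.get c) (cliffAct (transvCliff v)) with hA
  have hmemA : ∀ g ∈ D.stab, A g ∈ (D.twist c h i x y).stab := fun g hg =>
    (H.stab_update D hc _ _).2 ⟨g, hg, rfl⟩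
  have hoff : ∀ q, q ∉ 𝒯.get c → (A m + s • A g) q = m q + s • g q := by
    intro q hq
    rw [Pi.add_apply, Pi.smul_apply, hA, embedAct_of_notMem _ _ hq, embedAct_of_notMem _ _ hq]
  have hon : ∀ q, q ∈ 𝒯.get c → (A m + s • A g) q = m q := by
    intro q hq
    have e1 := congrFun (embedAct_restrict (𝒯.get c) (cliffAct (transvCliff v)) m) ⟨q, hq⟩
    have e2 := congrFun (embedAct_restrict (𝒯.get c) (cliffAct (transvCliff v)) g) ⟨q, hq⟩
    rw [cliffAct_transvCliff, transv_apply, hsymp] at e1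
    rw [hgw, cliffAct_transvCliff, transv_self] at e2
    dsimp only [Pi.add_apply, Pi.smul_apply] at e1 e2
    rw [Pi.add_apply, Pi.smul_apply, hA, e1, e2, add_assoc, ← add_smul]
    have : s + s = 0 := CharTwo.add_self_eq_zero s
    rw [this, zero_smul, add_zero]
  have hjh : j ≠ h := fun e => hh (e ▸ hj)
  have hji : j ≠ i := fun e => hi (e ▸ hj)
  refine mem_measured.2 ⟨A m + s • A g, Submodule.add_mem _ (hmemA m hm)
    (Submodule.smul_mem _ _ (hmemA g hg)), ?_, ?_⟩
  · intro q hq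
    have h0 : q ≠ h := fun e => hq ⟨0, e.symm⟩
    have h1 : q ≠ i := fun e => hq ⟨1, e.symm⟩
    have h2 : q ≠ j := fun e => hq ⟨2, e.symm⟩
    by_cases hqc : q ∈ 𝒯.get c
    · rw [hon q hqc, hmz' q h0 h1 h2]
    · rw [hoff q hqc, Prod.fst_add, hmz' q h0 h1 h2, Prod.smul_fst, hgz q hqc h0 h1, smul_zero,
        add_zero]
  · intro a
    rw [transv_apply, ← hs]
    fin_cases a
    · change (A m + s • A g) h = l 0 + s • x
      rw [hoff h hh, hm0, hgx]
    · change (A m + s • A g) i = l 1 + s • y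
      rw [hoff i hi, hm1, hgy]
    · change (A m + s • A g) j = l 2 + s • 0
      rw [hon j hj, hm2, smul_zero, add_zero]

/-- A measured stabilizer acting on `j` alone comes from a stabilizer that is trivial at `h` and
`i`, nontrivial at `j`, and of Z-type elsewhere. -/
theorem measured_pure_of_not_hasStab {D : CliffordCircuit 𝒯} {h i j : Fin n} (hjh : j ≠ h)
    (hji : j ≠ i) {c : Fin 𝒯.length}
    (hj : j ∈ 𝒯.get c) (hD : ¬ D.HasStab (allowedValues {j} {h, i}) c) {l : PVec (Fin 3)}
    (hl : l ∈ measured D.stab ![h, i, j]) (h0 : l 0 = 0) (h1 : l 1 = 0) : l 2 = 0 := by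
  obtain ⟨g, hg, hgz, hgl⟩ := mem_measured.1 hl
  by_contra hne
  refine hD ⟨g, hg, fun q => ?_, j, hj, fun h => hne (by rw [← h]; exact (hgl 2).symm)⟩
  have hgh : g h = 0 := (hgl 0).trans h0
  have hgi : g i = 0 := (hgl 1).trans h1
  unfold allowedValues
  split_ifs with e1 e2
  · exact Finset.mem_univ _
  · simp only [Finset.mem_insert, Finset.mem_singleton] at e2
    rcases e2 with rfl | rfl
    · simp [hgh]
    · simp [hgi]
  · simp only [Finset.mem_insert, Finset.mem_singleton, not_or] at e1 e2
    rw [Finset.mem_filter]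
    refine ⟨Finset.mem_univ _, hgz q ?_⟩
    rintro ⟨a, ha⟩
    fin_cases a
    exacts [e2.1 ha.symm, e2.2 ha.symm, e1 ha.symm]

theorem range_three (h i j : Fin n) :
    (({h, i, j} : Finset (Fin n)) : Set (Fin n)) = Set.range ![h, i, j] := by
  ext q
  simp only [Finset.coe_insert, Finset.coe_singleton, Set.mem_insert_iff, Set.mem_singleton_iff,
    Set.mem_range, Fin.exists_fin_succ, IsEmpty.exists_iff, Matrix.cons_val_zero,
    Matrix.cons_val_succ, or_false, eq_comm (a := q)]

theorem injective_three {h i j : Fin n} (hhi : h ≠ i) (hjh : j ≠ h) (hji : j ≠ i) :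
    Function.Injective ![h, i, j] := by
  intro a b hab
  fin_cases a <;> fin_cases b <;> simp_all [eq_comm]

variable {k e : ℕ} {r : Fin 𝒯.length} {par : Fin 𝒯.length → Fin 𝒯.length}
  {rank : Fin 𝒯.length → ℕ}

open Classical in
/-- The fraction of the circuits for which three given qubits, one of which is not in the same
square of the second layer as the others, exhibit GHZ-type entanglement. -/
theorem card_hasGHZTypeMIE_ge (H : IsTwoLayer 𝒯 k) (O : IsOverlapTree 𝒯 k e r par rank)
    {h i j : Fin n} (hhi : h ≠ i) {c : Fin 𝒯.length} (hc : k ≤ (c : ℕ)) (hj : j ∈ 𝒯.get c)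
    (hh : h ∉ 𝒯.get c) (hi : i ∉ 𝒯.get c) :
    (Fintype.card (CliffordCircuit 𝒯) : ℝ) * (1 / 2 - 8 * (1 / 2) ^ (𝒯.get c).card -
      10 * (2 * (1 + (1 / 2 : ℝ) ^ e) ^ (𝒯.length - 1) - 2)) ≤
    16 * (Finset.univ.filter fun D : CliffordCircuit 𝒯 =>
      HasGHZTypeMIE D.outputState {h, i, j}).card := by
  have hjh : j ≠ h := fun e => hh (e ▸ hj)
  have hji : j ≠ i := fun e => hi (e ▸ hj)
  obtain ⟨cH, hcH, hhH⟩ := H.cover h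
  obtain ⟨cI, hcI, hiI⟩ := H.cover i
  set B1 := Finset.univ.filter fun D : CliffordCircuit 𝒯 => D.HasStab (allowedValues {j} {h, i}) c
    with hB1
  set B2 := Finset.univ.filter fun D : CliffordCircuit 𝒯 =>
    D.HasStab (allowedValues {h, i} (𝒯.get c)) cH with hB2
  set B3 := Finset.univ.filter fun D : CliffordCircuit 𝒯 =>
    D.HasStab (allowedValues {h, i} (𝒯.get c)) cI with hB3
  have hdis1 : Disjoint ({j} : Finset (Fin n)) {h, i} := by
    simp [hjh, hji]
  have hdis2 : Disjoint ({h, i} : Finset (Fin n)) (𝒯.get c) := by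
    rw [Finset.disjoint_left]
    intro q hq
    simp only [Finset.mem_insert, Finset.mem_singleton] at hq
    rcases hq with rfl | rfl <;> assumption
  -- With Z the wall error and δ = 2^(-|tile|), the three failure fractions are at most 2/4 + 2Z, 4δ
  -- + 4Z and 4δ + 4Z, in total 1/2 + 8δ + 10Z.
  have b1 := card_hasStab_allowedValues_le H O hdis1 hc
  have b2 := card_hasStab_allowedValues_le H O hdis2 hcH
  have b3 := card_hasStab_allowedValues_le H O hdis2 hcI
  have hcard2 : ({h, i} : Finset (Fin n)).card = 2 := Finset.card_pair hhi
  rw [hcard2] at b1 b2 b3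
  rw [Finset.card_singleton] at b1
  set G : CliffordCircuit 𝒯 → Prop := fun D => D ∉ B1 ∧ D ∉ B2 ∧ D ∉ B3 with hG
  have hmain : (Finset.univ.filter G).card ≤ 16 * (Finset.univ.filter fun D : CliffordCircuit 𝒯 =>
      HasGHZTypeMIE D.outputState {h, i, j}).card := by
    refine card_le_card_hasGHZTypeMIE (injective_three hhi hjh hji) (range_three h i j) G
      (CliffordCircuit.twist c h i) (fun x y => H.twist_injective hc hh hi x y) ?_ ?_
    · intro D hD l hl h0 h1
      have : ¬ D.HasStab (allowedValues {j} {h, i}) c := by simpa [hB1] using hD.1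
      exact measured_pure_of_not_hasStab hjh hji hj this hl h0 h1
    · intro D hD x y l hl
      have h2 : ¬ D.HasStab (allowedValues {h, i} (𝒯.get c)) cH := by simpa [hB2] using hD.2.1
      have h3 : ¬ D.HasStab (allowedValues {h, i} (𝒯.get c)) cI := by simpa [hB3] using hD.2.2
      exact H.transv_mem_measured_twist D hc hhi hh hi hj (D.exists_isExtension
        (fun γ => LinearMap.injective_iff_surjective.1 (gateAct_injective γ)) hhi hhH hiI hh hi
        h2 h3 x y) hl
  have hcover : Fintype.card (CliffordCircuit 𝒯) ≤
      (Finset.univ.filter G).card + (B1.card + (B2.card + B3.card)) := by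
    rw [← Finset.card_univ]
    calc (Finset.univ : Finset (CliffordCircuit 𝒯)).card
        ≤ (Finset.univ.filter G ∪ (B1 ∪ (B2 ∪ B3))).card := by
          refine Finset.card_le_card fun D _ => ?_
          simp only [Finset.mem_union, Finset.mem_filter, Finset.mem_univ, true_and, hG]
          tauto
      _ ≤ _ := (Finset.card_union_le _ _).trans (Nat.add_le_add_left ((Finset.card_union_le _ _).trans
            (Nat.add_le_add_left (Finset.card_union_le _ _) _)) _)
  have hmain' : ((Finset.univ.filter G).card : ℝ) ≤
      16 * (Finset.univ.filter fun D : CliffordCircuit 𝒯 =>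
        HasGHZTypeMIE D.outputState {h, i, j}).card := by exact_mod_cast hmain
  have hcover' : (Fintype.card (CliffordCircuit 𝒯) : ℝ) ≤
      (Finset.univ.filter G).card + (B1.card + (B2.card + B3.card)) := by exact_mod_cast hcover
  refine le_trans ?_ hmain'
  generalize 2 * (1 + (1 / 2 : ℝ) ^ e) ^ (𝒯.length - 1) - 2 = Z at *
  generalize (1 / 2 : ℝ) ^ (𝒯.get c).card = δ at *
  linarith

open Classical in
/-- The fraction of the circuits for which three given qubits exhibit GHZ-type entanglement, for a
template with a single gate that acts on all qubits. -/
theorem card_hasGHZTypeMIE_ge_of_single (H : IsTwoLayer 𝒯 0)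
    (O : IsOverlapTree 𝒯 0 e r par rank) (hlen : 𝒯.length = 1)
    {h i j : Fin n} (hhi : h ≠ i) (hjh : j ≠ h) (hji : j ≠ i) :
    (Fintype.card (CliffordCircuit 𝒯) : ℝ) * (1 / 2) ≤
    16 * (Finset.univ.filter fun D : CliffordCircuit 𝒯 =>
      HasGHZTypeMIE D.outputState {h, i, j}).card := by
  obtain ⟨c, hc, hj⟩ := H.cover j
  have hall : ∀ q, q ∈ 𝒯.get c := by
    intro q
    obtain ⟨c', _, hq⟩ := H.cover q
    have : c' = c := by ext; omega
    rwa [this] at hq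
  have hdis1 : Disjoint ({j} : Finset (Fin n)) {h, i} := by
    simp [hjh, hji]
  have b1 := card_hasStab_allowedValues_le H O hdis1 hc
  have hcard2 : ({h, i} : Finset (Fin n)).card = 2 := Finset.card_pair hhi
  have hZ : 2 * (1 + (1 / 2 : ℝ) ^ e) ^ (𝒯.length - 1) - 2 = 0 := by
    rw [hlen]; norm_num
  rw [hcard2, Finset.card_singleton, hZ] at b1
  set B1 := Finset.univ.filter fun D : CliffordCircuit 𝒯 => D.HasStab (allowedValues {j} {h, i}) c
    with hB1
  have hmain : (Finset.univ.filter fun D => D ∉ B1).card ≤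
      16 * (Finset.univ.filter fun D : CliffordCircuit 𝒯 =>
      HasGHZTypeMIE D.outputState {h, i, j}).card := by
    -- Here `h` and `i` lie in the support of the gate, so the desired transvection is multiplied
    -- into it directly, with a vector that does not depend on the circuit.
    let u : PBit → PBit → PVec (𝒯.get c) := fun x y q =>
      if (q : Fin n) = h then x else if (q : Fin n) = i then y else 0
    refine card_le_card_hasGHZTypeMIE (injective_three hhi hjh hji) (range_three h i j)
      (fun D => D ∉ B1)
      (fun x y D => Function.update D c (transvCliff (u x y) • D c)) ?_ ?_ ?_
    · intro x y D D' hDD'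
      funext b
      have hb : b = c := by ext; omega
      subst hb
      have := congrFun hDD' b
      dsimp only at this
      rw [Function.update_self, Function.update_self] at this
      exact MulAction.injective _ this
    · intro D hD l hl h0 h1
      have : ¬ D.HasStab (allowedValues {j} {h, i}) c := by simpa [hB1] using hD
      exact measured_pure_of_not_hasStab hjh hji hj this hl h0 h1
    · intro D _ x y l hl
      obtain ⟨g, hg, hgz, hgl⟩ := mem_measured.1 hl
      have hsymp : symp (u x y) (fun q : 𝒯.get c => g q) = symp ![x, y, 0] l := by
        rw [symp_three_zero, symp_apply, Finset.sum_eq_add_of_mem (⟨h, hall h⟩ : 𝒯.get c)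
          ⟨i, hall i⟩ (Finset.mem_univ _) (Finset.mem_univ _)
          (fun e => hhi (congrArg Subtype.val e)), ← hgl 0, ← hgl 1]
        · simp [u, hhi.symm]
        · rintro ⟨q, hq⟩ - ⟨h0, h1⟩
          have h0' : q ≠ h := fun e => h0 (Subtype.ext e)
          have h1' : q ≠ i := fun e => h1 (Subtype.ext e)
          simp [u, h0', h1', sympAt_zero_left]
      have hval : ∀ q, embedAct (𝒯.get c) (cliffAct (transvCliff (u x y))) g q =
          g q + symp ![x, y, 0] l • (if q = h then x else if q = i then y else 0) := by
        intro q
        have e1 := congrFun (embedAct_restrict (𝒯.get c) (cliffAct (transvCliff (u x y))) g)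
          ⟨q, hall q⟩
        rw [cliffAct_transvCliff, transv_apply, hsymp] at e1
        exact e1
      refine mem_measured.2 ⟨_, (H.stab_update D hc _ _).2 ⟨g, hg, rfl⟩, ?_, ?_⟩
      · intro q hq
        have h0 : q ≠ h := fun e => hq ⟨0, e.symm⟩
        have h1 : q ≠ i := fun e => hq ⟨1, e.symm⟩
        rw [hval q, if_neg h0, if_neg h1, smul_zero, add_zero, hgz q hq]
      · intro a
        rw [hval, hgl, transv_apply]
        fin_cases a
        · simp
        · simp [hhi.symm]
        · simp [hjh, hji]
  have hcover : Fintype.card (CliffordCircuit 𝒯) ≤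
      (Finset.univ.filter fun D => D ∉ B1).card + B1.card := by
    rw [← Finset.card_univ]
    calc (Finset.univ : Finset (CliffordCircuit 𝒯)).card
        ≤ ((Finset.univ.filter fun D => D ∉ B1) ∪ B1).card := by
          refine Finset.card_le_card fun D _ => ?_
          simp only [Finset.mem_union, Finset.mem_filter, Finset.mem_univ, true_and]
          tauto
      _ ≤ _ := Finset.card_union_le _ _
  have hmain' : ((Finset.univ.filter fun D => D ∉ B1).card : ℝ) ≤
      16 * (Finset.univ.filter fun D : CliffordCircuit 𝒯 =>
        HasGHZTypeMIE D.outputState {h, i, j}).card := by exact_mod_cast hmain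
  have hcover' : (Fintype.card (CliffordCircuit 𝒯) : ℝ) ≤
      (Finset.univ.filter fun D => D ∉ B1).card + B1.card := by exact_mod_cast hcover
  refine le_trans ?_ hmain'
  linarith

end Averaging

end

noncomputable section

/-! ### Geometry of the coarse-grained template -/

section Grid

theorem mem_gridSquare {n L τ r c : ℕ} {q : Fin n} : q ∈ gridSquare n L τ r c ↔
    (r ≤ (q : ℕ) / L ∧ (q : ℕ) / L < r + τ) ∧ (c ≤ (q : ℕ) % L ∧ (q : ℕ) % L < c + τ) := by
  simp [gridSquare]

theorem card_gridSquare_le (n L τ r c : ℕ) : (gridSquare n L τ r c).card ≤ τ ^ 2 := by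
  calc (gridSquare n L τ r c).card
      ≤ (Finset.Ico r (r + τ) ×ˢ Finset.Ico c (c + τ)).card := by
        refine Finset.card_le_card_of_injOn (fun q => ((q : ℕ) / L, (q : ℕ) % L)) ?_ ?_
        · intro q hq
          have := mem_gridSquare.1 (Finset.mem_coe.1 hq)
          simpa using this
        · intro q _ q' _ h
          simp only [Prod.mk.injEq] at h
          ext
          rw [← Nat.div_add_mod (q : ℕ) L, h.1, h.2, Nat.div_add_mod]
    _ = τ ^ 2 := by simp [sq]

/-- Both squares contain the f × f square with corner (R, C). -/
theorem le_card_gridSquare_inter {L τ f r c r' c' R C : ℕ}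
    (h1 : r ≤ R) (h2 : r' ≤ R) (h3 : R + f ≤ r + τ) (h4 : R + f ≤ r' + τ) (h5 : R + f ≤ L)
    (h1' : c ≤ C) (h2' : c' ≤ C) (h3' : C + f ≤ c + τ) (h4' : C + f ≤ c' + τ) (h5' : C + f ≤ L) :
    f ^ 2 ≤ (gridSquare (L * L) L τ r c ∩ gridSquare (L * L) L τ r' c').card := by
  have hlt : ∀ x : Fin f × Fin f, (R + x.1) * L + (C + x.2) < L * L := by
    intro x
    have hx1 := x.1.2
    have hx2 := x.2.2
    calc (R + x.1) * L + (C + x.2) < (R + x.1) * L + L := by omega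
      _ = (R + x.1 + 1) * L := by ring
      _ ≤ L * L := Nat.mul_le_mul_right _ (by omega)
  have hdiv : ∀ x : Fin f × Fin f, ((R + x.1) * L + (C + x.2)) / L = R + x.1 := by
    intro x
    have hx2 := x.2.2
    rw [Nat.add_comm, Nat.add_mul_div_right _ _ (by omega), Nat.div_eq_of_lt (by omega), zero_add]
  have hmod : ∀ x : Fin f × Fin f, ((R + x.1) * L + (C + x.2)) % L = C + x.2 := by
    intro x
    have hx2 := x.2.2
    rw [Nat.add_comm, Nat.add_mul_mod_self_right, Nat.mod_eq_of_lt (by omega)]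
  calc f ^ 2 = (Finset.univ : Finset (Fin f × Fin f)).card := by simp [sq]
    _ ≤ _ := by
      refine Finset.card_le_card_of_injOn (fun x => ⟨_, hlt x⟩) ?_ ?_
      · intro x _
        have hx1 := x.1.2
        have hx2 := x.2.2
        simp only [Finset.coe_inter, Set.mem_inter_iff, Finset.mem_coe, mem_gridSquare, hdiv, hmod]
        omega
      · intro x _ y _ hxy
        have h := congrArg Fin.val hxy
        dsimp only at h
        have e1 := hdiv x
        have e2 := hmod x
        rw [h, hdiv] at e1
        rw [h, hmod] at e2
        ext <;> omega

theorem eq_of_mem_interval {τ f a b x : ℕ} (h1 : a * τ + f ≤ x) (h2 : x < a * τ + f + τ)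
    (h3 : b * τ + f ≤ x) (h4 : x < b * τ + f + τ) : a = b := by
  have key : ∀ a b : ℕ, x < a * τ + f + τ → b * τ + f ≤ x → b ≤ a := by
    intro a b h2 h3
    by_contra h
    have : (a + 1) * τ ≤ b * τ := Nat.mul_le_mul_right _ (by omega)
    rw [add_mul] at this
    omega
  exact le_antisymm (key b a h4 h1) (key a b h2 h3)

/-- A shifted interval covers the second half of the tile with the same index and the first ⌊τ/2⌋
positions of the next tile. -/
theorem exists_interval_inter {m τ a b : ℕ} (hab : a = b ∨ a = b + 1) (ha : a < m) :
    ∃ R, a * τ ≤ R ∧ b * τ + τ / 2 ≤ R ∧ R + τ / 2 ≤ a * τ + τ ∧ R + τ / 2 ≤ b * τ + τ / 2 + τ ∧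
      R + τ / 2 ≤ m * τ := by
  have h1 : (a + 1) * τ ≤ m * τ := Nat.mul_le_mul_right _ (by omega)
  rw [add_mul] at h1
  rcases hab with rfl | rfl
  · exact ⟨a * τ + τ / 2, by omega, by omega, by omega, by omega, by omega⟩
  · rw [add_mul] at h1 ⊢
    exact ⟨b * τ + 1 * τ, by omega, by omega, by omega, by omega, by omega⟩

variable (n m τ : ℕ)

/-- The cells of a square grid, row by row. -/
def gridCells (m : ℕ) : List (ℕ × ℕ) := List.range m ×ˢ List.range m

theorem mem_gridCells {m : ℕ} {p : ℕ × ℕ} : p ∈ gridCells m ↔ p.1 < m ∧ p.2 < m := by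
  rw [gridCells, List.mem_product]
  simp

theorem nodup_gridCells (m : ℕ) : (gridCells m).Nodup :=
  List.Nodup.product List.nodup_range List.nodup_range

theorem length_gridCells (m : ℕ) : (gridCells m).length = m * m := by
  rw [gridCells, List.length_product, List.length_range]

theorem coarseGrainedTemplate_eq : coarseGrainedTemplate n m τ =
    (gridCells (m - 1)).map
      (fun p => gridSquare n (m * τ) τ (p.1 * τ + τ / 2) (p.2 * τ + τ / 2)) ++
    (gridCells m).map (fun p => gridSquare n (m * τ) τ (p.1 * τ) (p.2 * τ)) := rfl

theorem length_coarseGrainedTemplate :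
    (coarseGrainedTemplate n m τ).length = (m - 1) * (m - 1) + m * m := by
  rw [coarseGrainedTemplate_eq, List.length_append, List.length_map, List.length_map,
    length_gridCells, length_gridCells]

/-- The grid cell of a gate. -/
def gateCell (i : ℕ) : ℕ × ℕ :=
  if i < (m - 1) * (m - 1) then (gridCells (m - 1)).getD i (0, 0)
  else (gridCells m).getD (i - (m - 1) * (m - 1)) (0, 0)

variable {n m τ}

theorem get_of_lt {i : Fin (coarseGrainedTemplate n m τ).length} (hi : (i : ℕ) < (m - 1) * (m - 1)) :
    gateCell m i ∈ gridCells (m - 1) ∧ (coarseGrainedTemplate n m τ).get i =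
      gridSquare n (m * τ) τ ((gateCell m i).1 * τ + τ / 2) ((gateCell m i).2 * τ + τ / 2) := by
  have hi' : (i : ℕ) < (gridCells (m - 1)).length := by rwa [length_gridCells]
  have hcell : gateCell m i = (gridCells (m - 1))[(i : ℕ)] := by
    rw [gateCell, if_pos hi, List.getD_eq_getElem _ _ hi']
  rw [hcell]
  refine ⟨List.getElem_mem _, ?_⟩
  rw [List.get_eq_getElem]
  simp only [coarseGrainedTemplate_eq]
  rw [List.getElem_append_left (by simpa using hi'), List.getElem_map]

theorem get_of_ge {i : Fin (coarseGrainedTemplate n m τ).length} (hi : (m - 1) * (m - 1) ≤ (i : ℕ)) :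
    gateCell m i ∈ gridCells m ∧ (coarseGrainedTemplate n m τ).get i =
      gridSquare n (m * τ) τ ((gateCell m i).1 * τ) ((gateCell m i).2 * τ) := by
  have hlen := i.2.trans_eq (length_coarseGrainedTemplate n m τ)
  have hi' : (i : ℕ) - (m - 1) * (m - 1) < (gridCells m).length := by rw [length_gridCells]; omega
  have hcell : gateCell m i = (gridCells m)[(i : ℕ) - (m - 1) * (m - 1)] := by
    rw [gateCell, if_neg (by omega), List.getD_eq_getElem _ _ hi']
  rw [hcell]
  refine ⟨List.getElem_mem _, ?_⟩
  rw [List.get_eq_getElem]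
  simp only [coarseGrainedTemplate_eq]
  rw [List.getElem_append_right (by simpa [length_gridCells] using hi), List.getElem_map]
  simp only [List.length_map, length_gridCells]

theorem gateCell_injective {i j : Fin (coarseGrainedTemplate n m τ).length}
    (hij : (i : ℕ) < (m - 1) * (m - 1) ↔ (j : ℕ) < (m - 1) * (m - 1))
    (h : gateCell m i = gateCell m j) : i = j := by
  have hi := i.2.trans_eq (length_coarseGrainedTemplate n m τ)
  have hj := j.2.trans_eq (length_coarseGrainedTemplate n m τ)
  by_cases hk : (i : ℕ) < (m - 1) * (m - 1)
  · have hk' := hij.1 hk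
    rw [gateCell, gateCell, if_pos hk, if_pos hk',
      List.getD_eq_getElem _ _ (by rwa [length_gridCells]),
      List.getD_eq_getElem _ _ (by rwa [length_gridCells]),
      (nodup_gridCells _).getElem_inj_iff] at h
    exact Fin.ext h
  · have hk' : ¬ (j : ℕ) < (m - 1) * (m - 1) := fun h => hk (hij.2 h)
    rw [gateCell, gateCell, if_neg hk, if_neg hk',
      List.getD_eq_getElem _ _ (by rw [length_gridCells]; omega),
      List.getD_eq_getElem _ _ (by rw [length_gridCells]; omega),
      (nodup_gridCells _).getElem_inj_iff] at h
    ext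
    omega

theorem exists_gate_of_lt {p : ℕ × ℕ} (hp : p ∈ gridCells (m - 1)) :
    ∃ i : Fin (coarseGrainedTemplate n m τ).length,
      (i : ℕ) < (m - 1) * (m - 1) ∧ gateCell m i = p := by
  obtain ⟨i, hi, rfl⟩ := List.getElem_of_mem hp
  have hi' := hi
  rw [length_gridCells] at hi'
  refine ⟨⟨i, by rw [length_coarseGrainedTemplate]; omega⟩, hi', ?_⟩
  rw [gateCell, if_pos hi', List.getD_eq_getElem _ _ hi]

theorem exists_gate_of_ge {p : ℕ × ℕ} (hp : p ∈ gridCells m) :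
    ∃ i : Fin (coarseGrainedTemplate n m τ).length,
      (m - 1) * (m - 1) ≤ (i : ℕ) ∧ gateCell m i = p := by
  obtain ⟨i, hi, rfl⟩ := List.getElem_of_mem hp
  have hi' := hi
  rw [length_gridCells] at hi'
  refine ⟨⟨(m - 1) * (m - 1) + i, by rw [length_coarseGrainedTemplate]; omega⟩,
    Nat.le_add_right _ _, ?_⟩
  rw [gateCell, if_neg (by simp)]
  simp only [Nat.add_sub_cancel_left]
  rw [List.getD_eq_getElem _ _ hi]

theorem isTwoLayer_coarseGrainedTemplate (hn : n = (m * τ) * (m * τ)) :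
    IsTwoLayer (coarseGrainedTemplate n m τ) ((m - 1) * (m - 1)) where
  disjoint := by
    intro i j hij hl
    by_contra hd
    obtain ⟨q, hqi, hqj⟩ := Finset.not_disjoint_iff.1 hd
    refine hij (gateCell_injective hl ?_)
    by_cases hk : (i : ℕ) < (m - 1) * (m - 1)
    · rw [(get_of_lt hk).2, mem_gridSquare] at hqi
      rw [(get_of_lt (hl.1 hk)).2, mem_gridSquare] at hqj
      exact Prod.ext (eq_of_mem_interval hqi.1.1 hqi.1.2 hqj.1.1 hqj.1.2)
        (eq_of_mem_interval hqi.2.1 hqi.2.2 hqj.2.1 hqj.2.2)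
    · have hk' : ¬ (j : ℕ) < (m - 1) * (m - 1) := fun h => hk (hl.2 h)
      rw [(get_of_ge (not_lt.1 hk)).2, mem_gridSquare] at hqi
      rw [(get_of_ge (not_lt.1 hk')).2, mem_gridSquare] at hqj
      exact Prod.ext (eq_of_mem_interval (f := 0) hqi.1.1 hqi.1.2 hqj.1.1 hqj.1.2)
        (eq_of_mem_interval (f := 0) hqi.2.1 hqi.2.2 hqj.2.1 hqj.2.2)
  cover := by
    intro q
    have hq : (q : ℕ) < (m * τ) * (m * τ) := lt_of_lt_of_eq q.2 hn
    have hL : 0 < m * τ := Nat.pos_of_ne_zero fun h => by simp [h] at hq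
    have hτ : 0 < τ := Nat.pos_of_mul_pos_left hL
    have hr : (q : ℕ) / (m * τ) < m * τ := Nat.div_lt_of_lt_mul hq
    have hc : (q : ℕ) % (m * τ) < m * τ := Nat.mod_lt _ hL
    obtain ⟨i, hi, hcell⟩ := exists_gate_of_ge (n := n) (m := m) (τ := τ)
      (p := ((q : ℕ) / (m * τ) / τ, (q : ℕ) % (m * τ) / τ))
      (mem_gridCells.2 ⟨(Nat.div_lt_iff_lt_mul hτ).2 hr, (Nat.div_lt_iff_lt_mul hτ).2 hc⟩)
    refine ⟨i, hi, ?_⟩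
    rw [(get_of_ge hi).2, hcell, mem_gridSquare]
    exact ⟨⟨Nat.div_mul_le_self _ _, Nat.lt_div_mul_add hτ⟩,
      Nat.div_mul_le_self _ _, Nat.lt_div_mul_add hτ⟩

/-- The root is the tile (0, 0). A shifted square has the tile with the same indices as its parent;
any other tile (a, b) has the shifted square (a - 1, b - 1), with truncated subtraction, so that on
the first row or column the index stays 0 and the overlap persists. -/
theorem exists_isOverlapTree (hm : 1 ≤ m) (hn : n = (m * τ) * (m * τ)) :
    ∃ r par rank, IsOverlapTree (coarseGrainedTemplate n m τ) ((m - 1) * (m - 1)) ((τ / 2) ^ 2)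
      r par rank := by
  obtain ⟨r, hr, hr0⟩ := exists_gate_of_ge (n := n) (m := m) (τ := τ) (p := (0, 0))
    (mem_gridCells.2 ⟨hm, hm⟩)
  have key : ∀ i : Fin (coarseGrainedTemplate n m τ).length,
      ∃ j : Fin (coarseGrainedTemplate n m τ).length, i ≠ r →
      ((i : ℕ) < (m - 1) * (m - 1) → (m - 1) * (m - 1) ≤ (j : ℕ) ∧ gateCell m j = gateCell m i) ∧
      ((m - 1) * (m - 1) ≤ (i : ℕ) → (j : ℕ) < (m - 1) * (m - 1) ∧
        gateCell m j = ((gateCell m i).1 - 1, (gateCell m i).2 - 1)) := by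
    intro i
    by_cases hir : i = r
    · exact ⟨r, fun h => absurd hir h⟩
    by_cases hk : (i : ℕ) < (m - 1) * (m - 1)
    · have h1 := mem_gridCells.1 (get_of_lt hk).1
      obtain ⟨j, hj, hc⟩ := exists_gate_of_ge (n := n) (m := m) (τ := τ) (p := gateCell m i)
        (mem_gridCells.2 ⟨by omega, by omega⟩)
      exact ⟨j, fun _ => ⟨fun _ => ⟨hj, hc⟩, fun h => by omega⟩⟩
    · have h1 := mem_gridCells.1 (get_of_ge (not_lt.1 hk)).1
      have h2 : (gateCell m i).1 ≠ 0 ∨ (gateCell m i).2 ≠ 0 := by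
        by_contra! h
        refine hir (gateCell_injective (iff_of_false hk hr.not_gt) ?_)
        rw [hr0]
        exact Prod.ext h.1 h.2
      obtain ⟨j, hj, hc⟩ := exists_gate_of_lt (n := n) (m := m) (τ := τ)
        (p := ((gateCell m i).1 - 1, (gateCell m i).2 - 1))
        (mem_gridCells.2 ⟨by dsimp only; omega, by dsimp only; omega⟩)
      exact ⟨j, fun _ => ⟨fun h => absurd h hk, fun _ => ⟨hj, hc⟩⟩⟩
  choose par hpar using key
  have hover : ∀ i j : Fin (coarseGrainedTemplate n m τ).length, (m - 1) * (m - 1) ≤ (i : ℕ) →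
      (j : ℕ) < (m - 1) * (m - 1) →
      ((gateCell m i).1 = (gateCell m j).1 ∨ (gateCell m i).1 = (gateCell m j).1 + 1) →
      ((gateCell m i).2 = (gateCell m j).2 ∨ (gateCell m i).2 = (gateCell m j).2 + 1) →
      (τ / 2) ^ 2 ≤ ((coarseGrainedTemplate n m τ).get i ∩
        (coarseGrainedTemplate n m τ).get j).card := by
    intro i j hi hj h1 h2
    have hmem := mem_gridCells.1 (get_of_ge hi).1
    obtain ⟨R, a1, a2, a3, a4, a5⟩ := exists_interval_inter (τ := τ) h1 hmem.1
    obtain ⟨C, b1, b2, b3, b4, b5⟩ := exists_interval_inter (τ := τ) h2 hmem.2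
    rw [(get_of_ge hi).2, (get_of_lt hj).2]
    subst hn
    exact le_card_gridSquare_inter a1 a2 a3 a4 a5 b1 b2 b3 b4 b5
  -- The index sum is doubled so that a shifted square ranks strictly between its parent tile and
  -- its child tiles.
  refine ⟨r, par, fun i => 2 * ((gateCell m i).1 + (gateCell m i).2) +
    if (i : ℕ) < (m - 1) * (m - 1) then 1 else 0, ?_, ?_, ?_⟩
  · intro i hir
    obtain ⟨h1, h2⟩ := hpar i hir
    by_cases hk : (i : ℕ) < (m - 1) * (m - 1)
    · obtain ⟨h3, h4⟩ := h1 hk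
      rw [if_pos hk, if_neg h3.not_gt, h4]
      omega
    · obtain ⟨h3, h4⟩ := h2 (not_lt.1 hk)
      have h5 : (gateCell m i).1 ≠ 0 ∨ (gateCell m i).2 ≠ 0 := by
        by_contra! h
        refine hir (gateCell_injective (iff_of_false hk hr.not_gt) ?_)
        rw [hr0]
        exact Prod.ext h.1 h.2
      rw [if_neg hk, if_pos h3, h4]
      dsimp only
      omega
  · intro i hir
    obtain ⟨h1, h2⟩ := hpar i hir
    by_cases hk : (i : ℕ) < (m - 1) * (m - 1)
    · exact iff_of_true hk (h1 hk).1.not_gt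
    · exact iff_of_false hk (not_not.2 (h2 (not_lt.1 hk)).1)
  · intro i hir
    obtain ⟨h1, h2⟩ := hpar i hir
    by_cases hk : (i : ℕ) < (m - 1) * (m - 1)
    · obtain ⟨h3, h4⟩ := h1 hk
      rw [Finset.inter_comm]
      exact hover _ _ h3 hk (Or.inl (by rw [h4])) (Or.inl (by rw [h4]))
    · obtain ⟨h3, h4⟩ := h2 (not_lt.1 hk)
      refine hover _ _ (not_lt.1 hk) h3 ?_ ?_ <;> rw [h4] <;> dsimp only <;> omega

theorem le_card_get_of_ge (hn : n = (m * τ) * (m * τ))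
    {i : Fin (coarseGrainedTemplate n m τ).length} (hi : (m - 1) * (m - 1) ≤ (i : ℕ)) :
    (τ / 2) ^ 2 ≤ ((coarseGrainedTemplate n m τ).get i).card := by
  have hmem := mem_gridCells.1 (get_of_ge hi).1
  obtain ⟨R, a1, a2, a3, a4, a5⟩ := exists_interval_inter (τ := τ) (Or.inl rfl) hmem.1
  obtain ⟨C, b1, b2, b3, b4, b5⟩ := exists_interval_inter (τ := τ) (Or.inl rfl) hmem.2
  rw [(get_of_ge hi).2, ← Finset.inter_self (gridSquare _ _ _ _ _)]
  subst hn
  exact le_card_gridSquare_inter a1 a1 a3 a3 a5 b1 b1 b3 b3 b5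

end Grid

/-! ### Numerical estimates -/

section Numerics

theorem pow_thousand_le {m τ : ℕ} (hm : 1 ≤ m)
    (h : √(1000 * Real.logb 2 (m : ℝ)) ≤ (τ : ℝ)) : m ^ 1000 ≤ 2 ^ (τ ^ 2) := by
  have hm0 : (0 : ℝ) < m := by exact_mod_cast hm
  have h1 : 1000 * Real.logb 2 (m : ℝ) ≤ (τ : ℝ) ^ 2 :=
    (Real.sqrt_le_left (Nat.cast_nonneg τ)).1 h
  have h2 : Real.logb 2 ((m : ℝ) ^ 1000) ≤ ((τ ^ 2 : ℕ) : ℝ) := by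
    rw [Real.logb_pow]
    push_cast
    exact h1
  rw [Real.logb_le_iff_le_rpow (by norm_num) (by positivity), Real.rpow_natCast] at h2
  exact_mod_cast h2

/-- Since m ≥ 2, τ² ≥ 1000 > 31², so τ ≥ 32. -/
theorem sixteen_le_half {m τ : ℕ} (hm : 2 ≤ m) (h : m ^ 1000 ≤ 2 ^ (τ ^ 2)) : 16 ≤ τ / 2 := by
  have h1 : 2 ^ 1000 ≤ 2 ^ (τ ^ 2) := (Nat.pow_le_pow_left hm 1000).trans h
  have h2 : 1000 ≤ τ ^ 2 := (Nat.pow_le_pow_iff_right (by norm_num)).1 h1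
  have h3 : 31 < τ := by
    by_contra h4
    have : τ ^ 2 ≤ 31 ^ 2 := Nat.pow_le_pow_left (not_lt.1 h4) 2
    omega
  omega

/-- After taking 500th powers this reads 5000 + τ² ≤ 500f² in the exponent, with f = ⌊τ/2⌋ ≥ 16 and
τ ≤ 2f + 1. -/
theorem mul_sq_le_two_pow {m τ : ℕ} (hm : 2 ≤ m) (h : m ^ 1000 ≤ 2 ^ (τ ^ 2)) :
    2 ^ 10 * m ^ 2 ≤ 2 ^ ((τ / 2) ^ 2) := by
  have hf := sixteen_le_half hm h
  set f := τ / 2 with hfdef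
  have hτ : τ ≤ 2 * f + 1 := by omega
  have h1 : 5000 + τ ^ 2 ≤ f ^ 2 * 500 := by
    have : τ ^ 2 ≤ (2 * f + 1) ^ 2 := Nat.pow_le_pow_left hτ 2
    nlinarith
  refine (Nat.pow_le_pow_iff_left (n := 500) (by norm_num)).1 ?_
  calc (2 ^ 10 * m ^ 2) ^ 500 = 2 ^ 5000 * m ^ 1000 := by
        rw [mul_pow, ← pow_mul, ← pow_mul]
    _ ≤ 2 ^ 5000 * 2 ^ (τ ^ 2) := Nat.mul_le_mul_left _ h
    _ = 2 ^ (5000 + τ ^ 2) := (pow_add _ _ _).symm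
    _ ≤ 2 ^ (f ^ 2 * 500) := Nat.pow_le_pow_right (by norm_num) h1
    _ = (2 ^ (f ^ 2)) ^ 500 := pow_mul _ _ _

/-- With x = 2^(-e) one has xN ≤ 1/512, hence (1 + x)^N ≤ exp(1/512) ≤ 512/511. The second bound
uses m² ≥ 4. -/
theorem wall_error_le {m e N : ℕ} (hm : 2 ≤ m) (h : 2 ^ 10 * m ^ 2 ≤ 2 ^ e) (hN : N ≤ 2 * m ^ 2) :
    2 * (1 + (1 / 2 : ℝ) ^ e) ^ N - 2 ≤ 2 / 511 ∧ (1 / 2 : ℝ) ^ e ≤ 1 / 4096 := by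
  have hm' : (2 : ℝ) ≤ m := by exact_mod_cast hm
  have h' : (1024 : ℝ) * m ^ 2 ≤ 2 ^ e := by
    have : ((2 ^ 10 * m ^ 2 : ℕ) : ℝ) ≤ ((2 ^ e : ℕ) : ℝ) := by exact_mod_cast h
    push_cast at this
    linarith
  have hx : (1 / 2 : ℝ) ^ e = 1 / 2 ^ e := by rw [div_pow, one_pow]
  have hm2 : (4 : ℝ) ≤ (m : ℝ) ^ 2 := by nlinarith
  set x : ℝ := (1 / 2) ^ e with hxdef
  have hx0 : 0 ≤ x := by positivity
  have hx1 : x * (1024 * m ^ 2) ≤ 1 := by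
    rw [hx, div_mul_eq_mul_div, one_mul]
    exact div_le_one_of_le₀ h' (by positivity)
  constructor
  · have hy : x * N ≤ 1 / 512 := by
      have : (N : ℝ) ≤ 2 * m ^ 2 := by exact_mod_cast hN
      nlinarith
    have h1 : (1 + x) ^ N ≤ Real.exp (x * N) := by
      rw [mul_comm, Real.exp_nat_mul]
      refine pow_le_pow_left₀ (by positivity) ?_ N
      rw [add_comm]
      exact Real.add_one_le_exp x
    have h2 : Real.exp (x * N) ≤ Real.exp (1 / 512) := Real.exp_le_exp.2 hy
    have h3 : Real.exp (1 / 512) * (511 / 512) ≤ 1 := by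
      have := Real.add_one_le_exp (-(1 / 512 : ℝ))
      calc Real.exp (1 / 512) * (511 / 512) ≤ Real.exp (1 / 512) * Real.exp (-(1 / 512)) :=
            mul_le_mul_of_nonneg_left (by linarith) (Real.exp_pos _).le
        _ = 1 := by rw [← Real.exp_add, add_neg_cancel, Real.exp_zero]
    linarith
  · nlinarith

/-- With `K = m ^ 2` tiles of `N = τ ^ 2` qubits each, at most half of all triples lie inside one
tile. -/
theorem two_mul_mul_choose_three_le {K N : ℕ} (hK : 2 ≤ K) :
    2 * (K * N.choose 3) ≤ (K * N).choose 3 := by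
  have h1 := Nat.descFactorial_eq_factorial_mul_choose N 3
  have h2 := Nat.descFactorial_eq_factorial_mul_choose (K * N) 3
  simp only [Nat.descFactorial_succ, Nat.descFactorial_zero, Nat.sub_zero, mul_one] at h1 h2
  have hKN : 2 * N ≤ K * N := Nat.mul_le_mul_right _ hK
  have h3 : (N - 2) * (2 * (N - 1)) ≤ (K * N - 2) * (K * N - 1) :=
    Nat.mul_le_mul (by omega) (by omega)
  have h4 : Nat.factorial 3 = 6 := rfl
  rw [h4] at h1 h2
  have h5 : 6 * (2 * (K * N.choose 3)) ≤ 6 * (K * N).choose 3 := by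
    calc 6 * (2 * (K * N.choose 3)) = 2 * K * (6 * N.choose 3) := by ring
      _ = (N - 2) * (2 * (N - 1)) * (K * N) := by rw [← h1]; ring
      _ ≤ (K * N - 2) * (K * N - 1) * (K * N) := Nat.mul_le_mul_right _ h3
      _ = 6 * (K * N).choose 3 := by rw [← h2]; ring
  omega

end Numerics

/-! ### Averaging over the triples and the final bounds -/

section Probability

variable {n : ℕ} {𝒯 : CircuitTemplate n}

open Classical in
theorem le_ghzTypeMIEProb {β : ℝ} (hβ : 0 ≤ β) (hn : 3 ≤ n) (B : Finset (Finset (Fin n)))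
    (hB : 2 * B.card ≤ n.choose 3)
    (h : ∀ T : Finset (Fin n), T.card = 3 → T ∉ B → β * Fintype.card (CliffordCircuit 𝒯) ≤
      (Finset.univ.filter fun D : CliffordCircuit 𝒯 => HasGHZTypeMIE D.outputState T).card) :
    β / 2 ≤ ghzTypeMIEProb 𝒯 := by
  have hcard : Fintype.card {T : Finset (Fin n) // T.card = 3} = n.choose 3 := by
    rw [Fintype.card_finset_len, Fintype.card_fin]
  have hD : (0 : ℝ) < Fintype.card (CliffordCircuit 𝒯) := by
    have : Nonempty (CliffordCircuit 𝒯) := ⟨fun i => ((1 : cliffordGroup (𝒯.get i)) :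
      CliffordGate (𝒯.get i))⟩
    exact_mod_cast Fintype.card_pos
  have hC : (0 : ℝ) < n.choose 3 := by exact_mod_cast Nat.choose_pos hn
  have hnum : β * Fintype.card (CliffordCircuit 𝒯) * ((n.choose 3 : ℝ) / 2) ≤
      (Nat.card {p : CliffordCircuit 𝒯 × {T : Finset (Fin n) // T.card = 3} //
        HasGHZTypeMIE p.1.outputState p.2.1} : ℝ) := by
    have h1 : (Nat.card {p : CliffordCircuit 𝒯 × {T : Finset (Fin n) // T.card = 3} //
        HasGHZTypeMIE p.1.outputState p.2.1} : ℝ) =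
        ∑ T : {T : Finset (Fin n) // T.card = 3},
          ((Finset.univ.filter fun D : CliffordCircuit 𝒯 =>
            HasGHZTypeMIE D.outputState T.1).card : ℝ) := by
      rw [Nat.card_eq_fintype_card, Fintype.card_subtype, Finset.card_filter,
        Fintype.sum_prod_type_right]
      push_cast
      simp only [Finset.card_filter]
      push_cast
      rfl
    rw [h1]
    set A : Finset {T : Finset (Fin n) // T.card = 3} := Finset.univ.filter fun T => T.1 ∉ B
    have h2 : n.choose 3 ≤ A.card + B.card := by
      rw [← hcard, ← Finset.card_univ, ← Finset.card_filter_add_card_filter_not (s := Finset.univ)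
        (p := fun T : {T : Finset (Fin n) // T.card = 3} => T.1 ∉ B)]
      refine Nat.add_le_add_left ?_ _
      refine Finset.card_le_card_of_injOn Subtype.val ?_ Subtype.val_injective.injOn
      intro T hT
      simpa using hT
    have h3 : (n.choose 3 : ℝ) / 2 ≤ A.card := by
      have e1 : (n.choose 3 : ℝ) ≤ A.card + B.card := by exact_mod_cast h2
      have e2 : 2 * (B.card : ℝ) ≤ n.choose 3 := by exact_mod_cast hB
      linarith
    calc β * Fintype.card (CliffordCircuit 𝒯) * ((n.choose 3 : ℝ) / 2)
        ≤ β * Fintype.card (CliffordCircuit 𝒯) * A.card :=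
          mul_le_mul_of_nonneg_left h3 (by positivity)
      _ = ∑ _T ∈ A, β * Fintype.card (CliffordCircuit 𝒯) := by
          rw [Finset.sum_const, nsmul_eq_mul, mul_comm]
      _ ≤ ∑ T ∈ A, ((Finset.univ.filter fun D : CliffordCircuit 𝒯 =>
            HasGHZTypeMIE D.outputState T.1).card : ℝ) :=
          Finset.sum_le_sum fun T hT => h T.1 T.2 (Finset.mem_filter.1 hT).2
      _ ≤ _ := Finset.sum_le_sum_of_subset_of_nonneg (Finset.subset_univ _) fun _ _ _ =>
          Nat.cast_nonneg _
  rw [ghzTypeMIEProb, Nat.card_eq_fintype_card (α := _ × _), Fintype.card_prod, hcard,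
    Nat.cast_mul, le_div_iff₀ (mul_pos hD hC)]
  linarith

/-- Three qubits that are not all in the same square of the second layer can be ordered in such a
way that the last one is not in the same square as the first two. -/
theorem IsTwoLayer.exists_separated {k : ℕ} (H : IsTwoLayer 𝒯 k) {T : Finset (Fin n)}
    (hT : T.card = 3) (hsep : ∀ c : Fin 𝒯.length, k ≤ (c : ℕ) → ¬ T ⊆ 𝒯.get c) :
    ∃ h i j, T = {h, i, j} ∧ h ≠ i ∧ ∃ c : Fin 𝒯.length, k ≤ (c : ℕ) ∧ j ∈ 𝒯.get c ∧
      h ∉ 𝒯.get c ∧ i ∉ 𝒯.get c := by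
  obtain ⟨x, y, z, hxy, hxz, hyz, rfl⟩ := Finset.card_eq_three.1 hT
  obtain ⟨c, hc, hx⟩ := H.cover x
  have huniq : ∀ c' : Fin 𝒯.length, k ≤ (c' : ℕ) → ∀ q, q ∈ 𝒯.get c → q ∈ 𝒯.get c' → c = c' := by
    intro c' hc' q h1 h2
    by_contra hne
    exact Finset.disjoint_left.1 (H.disjoint c c' hne (iff_of_false hc.not_gt hc'.not_gt)) h1 h2
  by_cases hy : y ∈ 𝒯.get c
  · have hz : z ∉ 𝒯.get c := by
      intro hz
      refine hsep c hc fun q hq => ?_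
      simp only [Finset.mem_insert, Finset.mem_singleton] at hq
      rcases hq with rfl | rfl | rfl <;> assumption
    obtain ⟨c', hc', hz'⟩ := H.cover z
    refine ⟨x, y, z, rfl, hxy, c', hc', hz', fun h => hz ?_, fun h => hz ?_⟩
    · rwa [huniq c' hc' x hx h]
    · rwa [huniq c' hc' y hy h]
  · by_cases hz : z ∈ 𝒯.get c
    · obtain ⟨c', hc', hy'⟩ := H.cover y
      refine ⟨x, z, y, by rw [Finset.pair_comm], hxz, c', hc', hy', fun h => hy ?_, fun h => hy ?_⟩
      · rwa [huniq c' hc' x hx h]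
      · rwa [huniq c' hc' z hz h]
    · refine ⟨y, z, x, ?_, hyz, c, hc, hx, hy, hz⟩
      ext q
      simp only [Finset.mem_insert, Finset.mem_singleton]
      tauto

open Classical in
theorem ghzTypeMIEProb_coarseGrained_of_one {n τ : ℕ} (hn : 3 ≤ n) (hnm : n = 1 ^ 2 * τ ^ 2) :
    (1 / 64 : ℝ) ≤ ghzTypeMIEProb (coarseGrainedTemplate n 1 τ) := by
  have hn' : n = (1 * τ) * (1 * τ) := by rw [hnm]; ring
  have H := isTwoLayer_coarseGrainedTemplate hn'
  obtain ⟨r, par, rank, O⟩ := exists_isOverlapTree le_rfl hn'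
  have := le_ghzTypeMIEProb (𝒯 := coarseGrainedTemplate n 1 τ) (β := 1 / 32) (by norm_num) hn ∅
    (by simp) fun T hT _ => by
      obtain ⟨x, y, z, hxy, hxz, hyz, rfl⟩ := Finset.card_eq_three.1 hT
      have := card_hasGHZTypeMIE_ge_of_single H O (length_coarseGrainedTemplate n 1 τ) hxy hxz.symm
        hyz.symm
      linarith
  linarith

open Classical in
theorem ghzTypeMIEProb_coarseGrained_of_two_le {n m τ : ℕ} (hn : 3 ≤ n) (hm : 2 ≤ m)
    (hnm : n = m ^ 2 * τ ^ 2) (h : √(1000 * Real.logb 2 (m : ℝ)) ≤ (τ : ℝ)) :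
    (1 / 80 : ℝ) ≤ ghzTypeMIEProb (coarseGrainedTemplate n m τ) := by
  have hn' : n = (m * τ) * (m * τ) := by rw [hnm]; ring
  have H := isTwoLayer_coarseGrainedTemplate hn'
  obtain ⟨r, par, rank, O⟩ := exists_isOverlapTree (by omega) hn'
  have hpow := mul_sq_le_two_pow hm (pow_thousand_le (by omega) h)
  have hlen : (coarseGrainedTemplate n m τ).length - 1 ≤ 2 * m ^ 2 := by
    rw [length_coarseGrainedTemplate]
    have : (m - 1) * (m - 1) ≤ m * m := Nat.mul_le_mul (by omega) (by omega)
    rw [sq]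
    omega
  obtain ⟨hZ, hδ⟩ := wall_error_le hm hpow hlen
  set B : Finset (Finset (Fin n)) := (Finset.univ.filter fun
    c : Fin (coarseGrainedTemplate n m τ).length => (m - 1) * (m - 1) ≤ (c : ℕ)).biUnion
      fun c => ((coarseGrainedTemplate n m τ).get c).powersetCard 3 with hBdef
  have hB : 2 * B.card ≤ n.choose 3 := by
    have h1 : B.card ≤ m ^ 2 * (τ ^ 2).choose 3 := by
      have hc : (Finset.univ.filter fun c : Fin (coarseGrainedTemplate n m τ).length =>
          (m - 1) * (m - 1) ≤ (c : ℕ)).card ≤ m ^ 2 := by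
        rw [sq, ← length_gridCells m, ← List.toFinset_card_of_nodup (nodup_gridCells m)]
        refine Finset.card_le_card_of_injOn (fun c => gateCell m c) ?_ ?_
        · intro c hc
          have hc' := (Finset.mem_filter.1 (Finset.mem_coe.1 hc)).2
          exact List.mem_toFinset.2 (get_of_ge hc').1
        · intro c hc c' hc' hcc
          have h1 := (Finset.mem_filter.1 (Finset.mem_coe.1 hc)).2
          have h2 := (Finset.mem_filter.1 (Finset.mem_coe.1 hc')).2
          exact gateCell_injective (iff_of_false h1.not_gt h2.not_gt) hcc
      refine (Finset.card_biUnion_le_card_mul _ _ ((τ ^ 2).choose 3) fun c hc => ?_).trans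
        (Nat.mul_le_mul_right _ hc)
      rw [Finset.card_powersetCard, (get_of_ge (Finset.mem_filter.1 hc).2).2]
      exact Nat.choose_le_choose 3 (card_gridSquare_le _ _ _ _ _)
    have h2 : 2 * (m ^ 2 * (τ ^ 2).choose 3) ≤ (m ^ 2 * τ ^ 2).choose 3 :=
      two_mul_mul_choose_three_le (by nlinarith)
    exact ((Nat.mul_le_mul_left 2 h1).trans h2).trans_eq (by rw [← hnm])
  -- The value β = 1/40 is (2/5)/16, where 2/5 is a lower bound for 1/2 - 8/4096 - 20/511.
  have := le_ghzTypeMIEProb (𝒯 := coarseGrainedTemplate n m τ) (β := 1 / 40) (by norm_num) hn B hB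
    fun T hT hTB => by
      obtain ⟨h, i, j, rfl, hhi, c, hc, hj, hh, hi⟩ := H.exists_separated hT fun c hc hsub =>
        hTB (Finset.mem_biUnion.2 ⟨c, by simpa using hc, Finset.mem_powersetCard.2 ⟨hsub, hT⟩⟩)
      have h1 := card_hasGHZTypeMIE_ge H O hhi hc hj hh hi
      have h2 : (1 / 2 : ℝ) ^ ((coarseGrainedTemplate n m τ).get c).card ≤ 1 / 4096 :=
        (pow_le_pow_of_le_one (by norm_num) (by norm_num) (le_card_get_of_ge hn' hc)).trans hδ
      have h3 : (0 : ℝ) ≤ Fintype.card (CliffordCircuit (coarseGrainedTemplate n m τ)) :=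
        Nat.cast_nonneg _
      have h4 := mul_le_mul_of_nonneg_left (show (2 / 5 : ℝ) ≤
        1 / 2 - 8 * (1 / 2) ^ ((coarseGrainedTemplate n m τ).get c).card -
        10 * (2 * (1 + (1 / 2 : ℝ) ^ ((τ / 2) ^ 2)) ^
          ((coarseGrainedTemplate n m τ).length - 1) - 2) by linarith) h3
      have h5 := h4.trans h1
      linarith
  linarith

end Probability

end

theorem mainTheorem5 :
    (∀ n m τ : ℕ, 3 ≤ n → n = m ^ 2 * τ ^ 2 → √(1000 * Real.logb 2 (m : ℝ)) ≤ (τ : ℝ) →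
      (0.005 : ℝ) ≤ ghzTypeMIEProb (coarseGrainedTemplate n m τ)) ∧
    (∀ 𝒜 : CircuitArchitecture,
      (∀ (n : ℕ) (hn : n ∈ 𝒜.sizes), 3 ≤ n ∧ ∃ m τ : ℕ, n = m ^ 2 * τ ^ 2 ∧
        √(1000 * Real.logb 2 (m : ℝ)) ≤ (τ : ℝ) ∧ 𝒜.template n hn = coarseGrainedTemplate n m τ) →
      𝒜.LongRangeTripartiteMIE) := by
  have main : ∀ n m τ : ℕ, 3 ≤ n → n = m ^ 2 * τ ^ 2 →
      √(1000 * Real.logb 2 (m : ℝ)) ≤ (τ : ℝ) →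
      (0.005 : ℝ) ≤ ghzTypeMIEProb (coarseGrainedTemplate n m τ) := by
    intro n m τ hn hnm h
    rcases Nat.lt_or_ge m 2 with hm | hm
    -- The case m = 0 would give n = 0, against n ≥ 3.
    · interval_cases m
      · simp at hnm
        omega
      · have := ghzTypeMIEProb_coarseGrained_of_one hn hnm
        norm_num at this ⊢
        linarith
    · have := ghzTypeMIEProb_coarseGrained_of_two_le hn hm hnm h
      norm_num at this ⊢
      linarith
  refine ⟨main, fun 𝒜 h𝒜 => ⟨0.005, by norm_num, fun n hn => ?_⟩⟩
  obtain ⟨h3, m, τ, hnm, hτ, htemp⟩ := h𝒜 n hn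
  rw [htemp]
  exact main n m τ h3 hnm hτ
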